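/- Let $(X_i)_{i\in\mathbb Z}$ be a sequence of independent and identically distributed real-valued random variables that are centered and in $\mathbb L^3$, with positive variance $\sigma^2$, and let $X$ have the law of $X_1$. Put $S_n = X_1+\cdots+X_n$, $\mu_3=\mathbb E(X^3)$ and $\lambda_3=\mathbb E(|X|^3)$. For $x>0$ let $\psi_x$ be the even convex function on $\mathbb R$ given by $\psi_x(t)=t^2/4$ if $|t|\le 2x$ and $\psi_x(t)=|tx|-x^2$ if $|t|>2x$, and for probability laws $\mu,\nu$ on $\mathbb R$ let $$\kappa_{\psi_x}(\mu,\nu)=\inf\{\mathbb E(\psi_x(U-V)) : U\sim\mu,\ V\sim\nu\},$$ the infimum being over all couplings. Set $\gamma_0=3/5$, $\gamma_1=3.0376$, $\gamma_2=0.64584$, $\gamma_3=1.6917$ and $$C_0(X)=\gamma_1\sigma^2+\sigma^{-4}\bigl(\gamma_0\lambda_3^2+\gamma_3\mu_3^2\bigr).$$ Then, for every integer $n\ge 1$ and every real $x>0$, $$\sqrt{\kappa_{\psi_x}\bigl(P_{S_n},\mathcal N(0,n\sigma^2)\bigr)}\le\sqrt{C_0(X)+\gamma_2\sigma^{-2}\,\mathbb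 E\bigl(|X|^3\min(|X|,8x)\bigr)}+0.968\,\sigma^{-2}|\mu_3|,$$ where $P_{S_n}$ is the law of $S_n$ and $\mathcal N(0,n\sigma^2)$ is the Gaussian law with mean $0$ and variance $n\sigma^2$. -/

import Mathlib

open MeasureTheory ProbabilityTheory
open scoped NNReal ENNReal

/-- The set of couplings of `μ` and `ν`: joint laws on `ℝ × ℝ` of pairs `(X, Y)` with
`X ∼ μ` and `Y ∼ ν`. -/
def couplings (μ ν : Measure ℝ) : Set (Measure (ℝ × ℝ)) :=
  {π | π.map Prod.fst = μ ∧ π.map Prod.snd = ν}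

/-- The transport cost `κ_ψ(μ, ν) = inf {E ψ(X - Y) : X ∼ μ, Y ∼ ν}` of a non-negative cost
function `ψ`, as an element of `[0, ∞]`. -/
noncomputable def transportCost (ψ : ℝ → ℝ) (μ ν : Measure ℝ) : ℝ≥0∞ :=
  ⨅ π ∈ couplings μ ν, ∫⁻ p, ENNReal.ofReal (ψ (p.1 - p.2)) ∂π

/-- The even convex function equal to `t² / 4` for `|t| ≤ 2x` and to `|t x| - x²` otherwise. -/
noncomputable def psiCost (x t : ℝ) : ℝ :=
  if |t| ≤ 2 * x then t ^ 2 / 4 else |t * x| - x ^ 2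

/-- `C₀(X) = γ₁ σ² + σ⁻⁴ (γ₀ λ₃² + γ₃ μ₃²)` with `γ₀ = 3/5`, `γ₁ = 3.0376`, `γ₃ = 1.6917`, as a
function of `σ`, `λ₃ = E |X|³` and `μ₃ = E X³`. -/
noncomputable def constC0 (σ lam3 mu3 : ℝ) : ℝ :=
  3.0376 * σ ^ 2 + (σ ^ 4)⁻¹ * (3 / 5 * lam3 ^ 2 + 1.6917 * mu3 ^ 2)

/-! After dividing by σ, the summands have unit variance. Let S be their sum, G an independent
standard Gaussian, φ the standard Gaussian density, and f_t the density of tS + G. The variables s_t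
(tS + G), with s_t = √n / √(1 + n t²), all have variance n; they join N(0, n) at t = 0 to S as t →
∞. Let Θ_t be the increasing map carrying the law at a fixed time T to the law at time t
(`flowMap`). The coupling used is S against √n Θ_0(TS + G), and S - √n Θ_0 = (S - s_T (TS + G)) +
(s_T (TS + G) - √n Θ_0). The first bracket has quadratic norm at most 1/T (`l2norm_initial_le`). The
second is the integral over (0, T] of the velocity of t ↦ s_t Θ_t, namely `speed n t` times `drift`
/ f_t at Θ_t (`hasDerivAt_scale_mul_flowMap`). Since Θ_t has density f_t, norms of the velocity
become norms of `drift` in L²(1/f_t), and Minkowski's inequality brings them inside the time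
integral.

To bound `drift` = E[S φ(z - tS) - n t H₁(z - tS)], with H₁ = zφ and H₂ = (z² - 1)φ, each summand is
expanded in one coordinate a = ω_i about the sum of the others. The mean and the variance cancel the
low order terms. The remaining t² μ₃ H₂ / 2 is cancelled by a corrector β a added to the weight of
H₁, at the price of a term t β Σ ω_i H₁(z - tS), whose norm is only of order √n; this is the source
of the |μ₃| term. The polynomial part then has mean zero (`integral_polyPart`) and only remainders
survive (`drift_integrand_eq`). Their norms are explicit because Hermite functions and Gaussian
translates have explicit norms in L²(1/φ); passing from φ to f_t costs a factor exp(t²/4)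
(`lintegral_others_le`). Translates by |ta| > 2 are not expanded, since their norm grows like
exp((ta)²/2): they are left at the total sum, where the Cauchy-Schwarz bound costs nothing.

A quadratic estimate of everything would need a fourth moment. But ψ_x is the infimal convolution of
t²/4 and x|t|, so an error of the form u + b costs at most u²/4 + x b (`psiCost_le`). Values |a| ≤ R
go into `driftMain`, estimated in L², and values |a| > R into `driftRest`, estimated in L¹ with
third moments only. For R = 8x the two contributions combine into E(|X|³ min(|X|, 8x)).

Because n · `speed n t` ≤ t⁻³ and the remainders are of third order in ta, the time integrals are
bounded uniformly in n: about T E(a⁴; |a| ≤ R) for the main part and E(|a|³; |a| > R) for the rest.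
Choosing T to balance 1/T against the main part, and comparing constants (`numerical_bound`), gives
the result for unit variance; scaling by σ gives the general case. -/

/-! ### Quadratic norms of extended non-negative functions -/

section QuadraticNorm

variable {α β : Type*} [MeasurableSpace α] [MeasurableSpace β]

/-- The `L²` norm of an extended non-negative function. -/
noncomputable def l2norm (Q : Measure β) (g : β → ℝ≥0∞) : ℝ≥0∞ :=
  (∫⁻ z, g z ^ 2 ∂Q) ^ (1 / 2 : ℝ)

theorem ENNReal.rpow_half_sq (a : ℝ≥0∞) : (a ^ (1 / 2 : ℝ)) ^ 2 = a := by
  rw [← ENNReal.rpow_natCast, ← ENNReal.rpow_mul]; norm_num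

theorem ENNReal.sq_rpow_half (a : ℝ≥0∞) : (a ^ 2) ^ (1 / 2 : ℝ) = a := by
  rw [← ENNReal.rpow_natCast, ← ENNReal.rpow_mul]; norm_num

theorem ENNReal.rpow_half_le_of_le_sq {a b : ℝ≥0∞} (h : a ≤ b ^ 2) : a ^ (1 / 2 : ℝ) ≤ b := by
  have := ENNReal.rpow_le_rpow h (by norm_num : (0 : ℝ) ≤ 1 / 2)
  rwa [ENNReal.sq_rpow_half] at this

theorem l2norm_sq (Q : Measure β) (g : β → ℝ≥0∞) : l2norm Q g ^ 2 = ∫⁻ z, g z ^ 2 ∂Q :=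
  ENNReal.rpow_half_sq _

theorem l2norm_le_of_sq_le {Q : Measure β} {g : β → ℝ≥0∞} {c : ℝ≥0∞}
    (h : ∫⁻ z, g z ^ 2 ∂Q ≤ c ^ 2) : l2norm Q g ≤ c :=
  ENNReal.rpow_half_le_of_le_sq h

theorem l2norm_mono {Q : Measure β} {g h : β → ℝ≥0∞} (hgh : ∀ z, g z ≤ h z) :
    l2norm Q g ≤ l2norm Q h := by
  apply l2norm_le_of_sq_le
  rw [l2norm_sq]
  exact lintegral_mono fun z => pow_le_pow_left' (hgh z) 2

theorem lintegral_mul_le_l2norm {Q : Measure β} {g h : β → ℝ≥0∞} (hg : AEMeasurable g Q)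
    (hh : AEMeasurable h Q) : ∫⁻ z, g z * h z ∂Q ≤ l2norm Q g * l2norm Q h := by
  have := ENNReal.lintegral_mul_le_Lp_mul_Lq Q
    (Real.HolderConjugate.two_two) hg hh
  simpa [l2norm] using this

theorem l2norm_add_le {Q : Measure β} {g h : β → ℝ≥0∞} (hg : AEMeasurable g Q)
    (hh : AEMeasurable h Q) : l2norm Q (fun z => g z + h z) ≤ l2norm Q g + l2norm Q h := by
  have := ENNReal.lintegral_Lp_add_le hg hh (by norm_num : (1 : ℝ) ≤ 2)
  simpa [l2norm] using this

theorem l2norm_const_mul {Q : Measure β} {g : β → ℝ≥0∞} (hg : AEMeasurable g Q) (c : ℝ≥0∞) :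
    l2norm Q (fun z => c * g z) = c * l2norm Q g := by
  simp only [l2norm, mul_pow]
  rw [lintegral_const_mul'' _ (hg.pow_const 2), ENNReal.mul_rpow_of_nonneg _ _ (by norm_num),
    ENNReal.sq_rpow_half]

theorem l2norm_sum_le {ι : Type*} (s : Finset ι) {Q : Measure β} {g : ι → β → ℝ≥0∞}
    (hg : ∀ i, AEMeasurable (g i) Q) :
    l2norm Q (fun z => ∑ i ∈ s, g i z) ≤ ∑ i ∈ s, l2norm Q (g i) := by
  classical
  induction s using Finset.induction_on with
  | empty => simp [l2norm]
  | insert a s ha ih =>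
    simp only [Finset.sum_insert ha]
    exact (l2norm_add_le (hg a) (Finset.aemeasurable_fun_sum s fun i _ => hg i)).trans (by gcongr)

/-- Minkowski's integral inequality for quadratic norms. -/
theorem l2norm_lintegral_le {ν : Measure α} {Q : Measure β} [SFinite ν] [SFinite Q]
    {F : α → β → ℝ≥0∞} (hF : Measurable (Function.uncurry F)) :
    l2norm Q (fun z => ∫⁻ a, F a z ∂ν) ≤ ∫⁻ a, l2norm Q (F a) ∂ν := by
  have hF1 : ∀ z, Measurable fun a => F a z := fun z => hF.of_uncurry_right
  have hF2 : ∀ a, Measurable (F a) := fun a => hF.of_uncurry_left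
  have hN : Measurable fun a => l2norm Q (F a) := by
    unfold l2norm
    exact (Measurable.lintegral_prod_right' (f := fun p : α × β => F p.1 p.2 ^ 2)
      (hF.pow_const 2)).pow_const _
  apply l2norm_le_of_sq_le
  -- The square of an integral is a double integral over a and b; Tonelli moves z innermost, where
  -- Cauchy-Schwarz separates a from b.
  calc ∫⁻ z, (∫⁻ a, F a z ∂ν) ^ 2 ∂Q
      = ∫⁻ z, ∫⁻ a, ∫⁻ b, F a z * F b z ∂ν ∂ν ∂Q := by
        refine lintegral_congr fun z => ?_
        rw [sq, ← lintegral_mul_const _ (hF1 z)]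
        refine lintegral_congr fun a => ?_
        rw [lintegral_const_mul _ (hF1 z)]
    _ = ∫⁻ a, ∫⁻ z, ∫⁻ b, F a z * F b z ∂ν ∂Q ∂ν := by
        rw [lintegral_lintegral_swap]
        refine Measurable.aemeasurable ?_
        refine Measurable.lintegral_prod_right' (f := fun p : (β × α) × α =>
          F p.1.2 p.1.1 * F p.2 p.1.1) ?_
        exact (hF.comp (by fun_prop : Measurable fun p : (β × α) × α => (p.1.2, p.1.1))).mul
          (hF.comp (by fun_prop : Measurable fun p : (β × α) × α => (p.2, p.1.1)))
    _ = ∫⁻ a, ∫⁻ b, ∫⁻ z, F a z * F b z ∂Q ∂ν ∂ν := by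
        refine lintegral_congr fun a => ?_
        rw [lintegral_lintegral_swap]
        refine Measurable.aemeasurable ?_
        exact (hF.comp (by fun_prop : Measurable fun p : β × α => (a, p.1))).mul
          (hF.comp (by fun_prop : Measurable fun p : β × α => (p.2, p.1)))
    _ ≤ ∫⁻ a, ∫⁻ b, l2norm Q (F a) * l2norm Q (F b) ∂ν ∂ν := by
        refine lintegral_mono fun a => lintegral_mono fun b => ?_
        exact lintegral_mul_le_l2norm (hF2 a).aemeasurable (hF2 b).aemeasurable
    _ = (∫⁻ a, l2norm Q (F a) ∂ν) ^ 2 := by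
        rw [sq, ← lintegral_mul_const _ hN]
        refine lintegral_congr fun a => ?_
        rw [lintegral_const_mul _ hN]

end QuadraticNorm

/-! ### The standard Gaussian density -/

/-- The density of the standard Gaussian law. -/
noncomputable def stdDensity (z : ℝ) : ℝ := gaussianPDFReal 0 1 z

theorem stdDensity_eq (z : ℝ) : stdDensity z = (√(2 * Real.pi))⁻¹ * Real.exp (-z ^ 2 / 2) := by
  simp [stdDensity, gaussianPDFReal]

theorem stdDensity_pos (z : ℝ) : 0 < stdDensity z :=
  gaussianPDFReal_pos _ _ _ one_ne_zero

@[fun_prop]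
theorem continuous_stdDensity : Continuous stdDensity := by
  have : stdDensity = fun z => (√(2 * Real.pi))⁻¹ * Real.exp (-z ^ 2 / 2) :=
    funext stdDensity_eq
  rw [this]; fun_prop

@[fun_prop]
theorem measurable_stdDensity : Measurable stdDensity := continuous_stdDensity.measurable

theorem hasDerivAt_stdDensity (z : ℝ) : HasDerivAt stdDensity (-z * stdDensity z) z := by
  have : stdDensity = fun z => (√(2 * Real.pi))⁻¹ * Real.exp (-z ^ 2 / 2) :=
    funext stdDensity_eq
  rw [this]
  have h : HasDerivAt (fun z : ℝ => -z ^ 2 / 2) (-z) z := by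
    have := ((hasDerivAt_pow 2 z).neg).div_const 2
    exact this.congr_deriv (by norm_num; ring)
  exact (h.exp.const_mul _).congr_deriv (by ring)

theorem stdDensity_sub (z y : ℝ) :
    stdDensity (z - y) = stdDensity z * Real.exp (y * z - y ^ 2 / 2) := by
  rw [stdDensity_eq, stdDensity_eq, mul_assoc, ← Real.exp_add]; ring_nf

theorem integrable_pow_mul_stdDensity (k : ℕ) : Integrable fun z => z ^ k * stdDensity z := by
  have h := (integrable_rpow_mul_exp_neg_mul_sq (b := 1 / 2) (by norm_num) (s := k)
    (by have : (0 : ℝ) ≤ k := k.cast_nonneg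
        linarith)).const_mul (√(2 * Real.pi))⁻¹
  refine h.congr (ae_of_all _ fun z => ?_)
  simp only [Real.rpow_natCast, stdDensity_eq]; ring_nf

theorem integral_stdDensity : ∫ z, stdDensity z = 1 :=
  integral_gaussianPDFReal_eq_one 0 one_ne_zero

/-- Integration by parts against φ' = -zφ. With the moments of orders 0 and 1 this yields all
moments up to order 4, enough for squares of second order Taylor polynomials. -/
theorem integral_pow_succ_succ_mul_stdDensity (k : ℕ) :
    ∫ z, z ^ (k + 2) * stdDensity z = (k + 1) * ∫ z, z ^ k * stdDensity z := by
  have h := integral_mul_deriv_eq_deriv_mul_of_integrable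
    (u := fun z : ℝ => z ^ (k + 1)) (u' := fun z : ℝ => ((k + 1 : ℕ) : ℝ) * z ^ k)
    (v := stdDensity) (v' := fun z => -z * stdDensity z)
    (fun z _ => by simpa using hasDerivAt_pow (k + 1) z) (fun z _ => hasDerivAt_stdDensity z)
    (by refine (integrable_pow_mul_stdDensity (k + 2)).neg.congr (ae_of_all _ fun z => ?_)
        simp; ring)
    (by refine ((integrable_pow_mul_stdDensity k).const_mul ((k + 1 : ℕ) : ℝ)).congr
          (ae_of_all _ fun z => ?_)
        simp; ring)
    (integrable_pow_mul_stdDensity (k + 1))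
  have e1 : ∫ z, z ^ (k + 2) * stdDensity z = -∫ z, z ^ (k + 1) * (-z * stdDensity z) := by
    rw [← integral_neg]; congr 1; ext z; ring
  rw [e1, h, neg_neg, ← integral_const_mul]
  congr 1; ext z; push_cast; ring

theorem integral_mul_stdDensity : ∫ z, z * stdDensity z = 0 := by
  have h := integral_neg_eq_self (fun z => z * stdDensity z) volume
  have e : ∀ z, -z * stdDensity (-z) = -(z * stdDensity z) := fun z => by
    rw [stdDensity_eq, stdDensity_eq]; ring_nf
  simp only [e, integral_neg] at h
  linarith

/-- Integral of a quartic polynomial against a translated Gaussian density. -/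
theorem integral_quartic_mul_stdDensity (m c0 c1 c2 c3 c4 : ℝ) :
    Integrable (fun z => (c0 + c1 * z + c2 * z ^ 2 + c3 * z ^ 3 + c4 * z ^ 4)
      * stdDensity (z - m)) ∧
    ∫ z, (c0 + c1 * z + c2 * z ^ 2 + c3 * z ^ 3 + c4 * z ^ 4) * stdDensity (z - m)
      = c0 + c1 * m + c2 * (m ^ 2 + 1) + c3 * (m ^ 3 + 3 * m) + c4 * (m ^ 4 + 6 * m ^ 2 + 3) := by
  have m0 : ∫ z, z ^ 0 * stdDensity z = 1 := by simpa using integral_stdDensity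
  have m1 : ∫ z, z ^ 1 * stdDensity z = 0 := by simpa using integral_mul_stdDensity
  have m2 : ∫ z, z ^ 2 * stdDensity z = 1 := by
    rw [integral_pow_succ_succ_mul_stdDensity 0, m0]; norm_num
  have m3 : ∫ z, z ^ 3 * stdDensity z = 0 := by
    rw [integral_pow_succ_succ_mul_stdDensity 1, m1]; norm_num
  have m4 : ∫ z, z ^ 4 * stdDensity z = 3 := by
    rw [integral_pow_succ_succ_mul_stdDensity 2, m2]; norm_num
  set d0 := c0 + c1 * m + c2 * m ^ 2 + c3 * m ^ 3 + c4 * m ^ 4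
  set d1 := c1 + 2 * c2 * m + 3 * c3 * m ^ 2 + 4 * c4 * m ^ 3
  set d2 := c2 + 3 * c3 * m + 6 * c4 * m ^ 2
  set d3 := c3 + 4 * c4 * m
  have i := integrable_pow_mul_stdDensity
  have i0 := (i 0).const_mul d0
  have i1 := (i 1).const_mul d1
  have i2 := (i 2).const_mul d2
  have i3 := (i 3).const_mul d3
  have i4 := (i 4).const_mul c4
  have key : (fun z => (c0 + c1 * (z + m) + c2 * (z + m) ^ 2 + c3 * (z + m) ^ 3
      + c4 * (z + m) ^ 4) * stdDensity (z + m - m)) = fun z => d0 * (z ^ 0 * stdDensity z)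
      + d1 * (z ^ 1 * stdDensity z) + d2 * (z ^ 2 * stdDensity z) + d3 * (z ^ 3 * stdDensity z)
      + c4 * (z ^ 4 * stdDensity z) := by
    ext z; simp only [add_sub_cancel_right, d0, d1, d2, d3]; ring
  have hint := (((i0.fun_add i1).fun_add i2).fun_add i3).fun_add i4
  constructor
  · have h2 : Integrable (fun z => (c0 + c1 * (z + m) + c2 * (z + m) ^ 2 + c3 * (z + m) ^ 3
      + c4 * (z + m) ^ 4) * stdDensity (z + m - m)) := by rw [key]; exact hint
    have := h2.comp_sub_right m
    simpa using this
  · rw [← integral_add_right_eq_self _ m, key, integral_add (((i0.fun_add i1).fun_add i2).fun_add i3) i4,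
      integral_add ((i0.fun_add i1).fun_add i2) i3, integral_add (i0.fun_add i1) i2, integral_add i0 i1]
    simp only [integral_const_mul, m0, m1, m2, m3, m4, d0, d1, d2, d3]; ring

/-- The squared norm of `b` in `L²(1/φ)`, where `φ` is the standard Gaussian density. -/
noncomputable def gaussNormSq (b : ℝ → ℝ) : ℝ≥0∞ :=
  ∫⁻ z, ENNReal.ofReal (b z ^ 2 / stdDensity z)

theorem gaussNormSq_eq {b : ℝ → ℝ} {c : ℝ}
    (hi : Integrable fun z => b z ^ 2 / stdDensity z) (h : ∫ z, b z ^ 2 / stdDensity z = c) :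
    gaussNormSq b = ENNReal.ofReal c := by
  rw [gaussNormSq, ← h, ofReal_integral_eq_lintegral_ofReal hi]
  exact ae_of_all _ fun z => div_nonneg (sq_nonneg _) (stdDensity_pos z).le

/-- The Hermite polynomials 1, z, z² - 1 are orthogonal for the Gaussian law, with squared norms 1,
1, 2. -/
theorem gaussNormSq_quadratic (c0 c1 c2 : ℝ) :
    gaussNormSq (fun z => (c0 + c1 * z + c2 * (z ^ 2 - 1)) * stdDensity z)
      = ENNReal.ofReal (c0 ^ 2 + c1 ^ 2 + 2 * c2 ^ 2) := by
  have h := integral_quartic_mul_stdDensity 0 ((c0 - c2) ^ 2) (2 * (c0 - c2) * c1)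
    (c1 ^ 2 + 2 * (c0 - c2) * c2) (2 * c1 * c2) (c2 ^ 2)
  have e : (fun z => ((c0 + c1 * z + c2 * (z ^ 2 - 1)) * stdDensity z) ^ 2 / stdDensity z)
      = fun z => ((c0 - c2) ^ 2 + (2 * (c0 - c2) * c1) * z + (c1 ^ 2 + 2 * (c0 - c2) * c2) * z ^ 2
        + (2 * c1 * c2) * z ^ 3 + (c2 ^ 2) * z ^ 4) * stdDensity (z - 0) := by
    ext z
    have := (stdDensity_pos z).ne'
    rw [sub_zero]; field_simp; ring
  refine gaussNormSq_eq (by rw [e]; exact h.1) ?_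
  rw [e, h.2]; ring

/-- Completing the square: dividing by φ turns a squared translate by y into a translate by 2y of
mass exp(y²). Hence all the norms needed reduce to quartic polynomials integrated against translated
Gaussians. -/
theorem sq_stdDensity_sub_div (z y : ℝ) :
    stdDensity (z - y) ^ 2 / stdDensity z = Real.exp (y ^ 2) * stdDensity (z - 2 * y) := by
  have := (stdDensity_pos z).ne'
  rw [stdDensity_sub, stdDensity_sub z (2 * y), div_eq_iff this, mul_pow, ← Real.exp_nat_mul]
  have : Real.exp (y ^ 2) * (stdDensity z * Real.exp (2 * y * z - (2 * y) ^ 2 / 2)) * stdDensity z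
    = stdDensity z ^ 2 * (Real.exp (y ^ 2) * Real.exp (2 * y * z - (2 * y) ^ 2 / 2)) := by ring
  rw [this, ← Real.exp_add]; congr 2; push_cast; ring

/-- The squared norm of the second order Taylor remainder of a translated Gaussian density. -/
theorem gaussNormSq_taylor (y : ℝ) :
    gaussNormSq (fun z => stdDensity (z - y)
      - (1 + y * z + y ^ 2 / 2 * (z ^ 2 - 1)) * stdDensity z)
      = ENNReal.ofReal (Real.exp (y ^ 2) - 1 - y ^ 2 - y ^ 4 / 2) := by
  set c2 := y ^ 2 / 2 with hc2
  have h1 := integral_quartic_mul_stdDensity (2 * y) (Real.exp (y ^ 2)) 0 0 0 0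
  have h2 := integral_quartic_mul_stdDensity y (-2 * (1 - c2)) (-2 * y) (-2 * c2) 0 0
  have h3 := integral_quartic_mul_stdDensity 0 ((1 - c2) ^ 2) (2 * (1 - c2) * y)
    (y ^ 2 + 2 * (1 - c2) * c2) (2 * y * c2) (c2 ^ 2)
  -- The expanded square has pieces centred at 2y, y and 0. The outcome agrees with the Hermite
  -- expansion φ(z - y) = Σ y^k/k! He_k(z) φ(z), whose tail k ≥ 3 has squared norm Σ y^(2k)/k!.
  have e : (fun z => (stdDensity (z - y)
      - (1 + y * z + c2 * (z ^ 2 - 1)) * stdDensity z) ^ 2 / stdDensity z)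
      = fun z => (Real.exp (y ^ 2) + 0 * z + 0 * z ^ 2 + 0 * z ^ 3 + 0 * z ^ 4)
          * stdDensity (z - 2 * y) + (-2 * (1 - c2) + -2 * y * z + -2 * c2 * z ^ 2 + 0 * z ^ 3
          + 0 * z ^ 4) * stdDensity (z - y) + ((1 - c2) ^ 2 + 2 * (1 - c2) * y * z
          + (y ^ 2 + 2 * (1 - c2) * c2) * z ^ 2 + 2 * y * c2 * z ^ 3 + c2 ^ 2 * z ^ 4)
          * stdDensity (z - 0) := by
    ext z
    have := (stdDensity_pos z).ne'
    have e1 := sq_stdDensity_sub_div z y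
    have : (stdDensity (z - y) - (1 + y * z + c2 * (z ^ 2 - 1)) * stdDensity z) ^ 2 / stdDensity z
      = stdDensity (z - y) ^ 2 / stdDensity z
        - 2 * (1 + y * z + c2 * (z ^ 2 - 1)) * stdDensity (z - y)
        + (1 + y * z + c2 * (z ^ 2 - 1)) ^ 2 * stdDensity z := by field_simp; ring
    rw [this, e1, sub_zero]; ring
  refine gaussNormSq_eq (by rw [e]; exact (h1.1.fun_add h2.1).fun_add h3.1) ?_
  rw [e, integral_add (h1.1.fun_add h2.1) h3.1, integral_add h1.1 h2.1, h1.2, h2.2, h3.2, hc2]; ring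

/-- The squared norm of the first order Taylor remainder of the derivative of a translated
Gaussian density. -/
theorem gaussNormSq_taylor_deriv (y : ℝ) :
    gaussNormSq (fun z => (z - y) * stdDensity (z - y)
      - (z + y * (z ^ 2 - 1)) * stdDensity z)
      = ENNReal.ofReal ((1 + y ^ 2) * Real.exp (y ^ 2) - 1 - 2 * y ^ 2) := by
  have h1 := integral_quartic_mul_stdDensity (2 * y) (Real.exp (y ^ 2) * y ^ 2)
    (-2 * y * Real.exp (y ^ 2)) (Real.exp (y ^ 2)) 0 0
  have h2 := integral_quartic_mul_stdDensity y (-2 * y ^ 2) (2 * y * (1 + 1)) (-2 * (1 - y ^ 2))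
    (-2 * y) 0
  have h3 := integral_quartic_mul_stdDensity 0 (y ^ 2) (-2 * y) (1 - 2 * y ^ 2) (2 * y) (y ^ 2)
  -- Same three centres. In Hermite terms the remainder is the tail k ≥ 2 of Σ y^k/k! He_(k+1) φ, of
  -- squared norm Σ (k+1) y^(2k)/k!.
  have e : (fun z => ((z - y) * stdDensity (z - y)
      - (z + y * (z ^ 2 - 1)) * stdDensity z) ^ 2 / stdDensity z)
      = fun z => (Real.exp (y ^ 2) * y ^ 2 + -2 * y * Real.exp (y ^ 2) * z
          + Real.exp (y ^ 2) * z ^ 2 + 0 * z ^ 3 + 0 * z ^ 4) * stdDensity (z - 2 * y)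
          + (-2 * y ^ 2 + 2 * y * (1 + 1) * z + -2 * (1 - y ^ 2) * z ^ 2 + -2 * y * z ^ 3
          + 0 * z ^ 4) * stdDensity (z - y)
          + (y ^ 2 + -2 * y * z + (1 - 2 * y ^ 2) * z ^ 2 + 2 * y * z ^ 3 + y ^ 2 * z ^ 4)
          * stdDensity (z - 0) := by
    ext z
    have := (stdDensity_pos z).ne'
    have e1 := sq_stdDensity_sub_div z y
    have : ((z - y) * stdDensity (z - y) - (z + y * (z ^ 2 - 1)) * stdDensity z) ^ 2
        / stdDensity z
      = (z - y) ^ 2 * (stdDensity (z - y) ^ 2 / stdDensity z)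
        - 2 * (z - y) * (z + y * (z ^ 2 - 1)) * stdDensity (z - y)
        + (z + y * (z ^ 2 - 1)) ^ 2 * stdDensity z := by field_simp; ring
    rw [this, e1, sub_zero]; ring
  refine gaussNormSq_eq (by rw [e]; exact (h1.1.fun_add h2.1).fun_add h3.1) ?_
  rw [e, integral_add (h1.1.fun_add h2.1) h3.1, integral_add h1.1 h2.1, h1.2, h2.2, h3.2]; ring

/-! ### Numerical majorants of the Gaussian norms -/

/-- Remainders of the exponential series scale at least polynomially. -/
theorem exp_sub_sum_le {Y a : ℝ} (hY : 0 ≤ Y) (hYa : Y ≤ a) (ha : 0 < a) (N : ℕ) :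
    Real.exp Y - ∑ j ∈ Finset.range N, Y ^ j / j.factorial
      ≤ (Y / a) ^ N * (Real.exp a - ∑ j ∈ Finset.range N, a ^ j / j.factorial) := by
  have hs : ∀ b : ℝ, HasSum (fun j : ℕ => b ^ (j + N) / (j + N).factorial)
      (Real.exp b - ∑ j ∈ Finset.range N, b ^ j / j.factorial) := fun b => by
    have h := NormedSpace.expSeries_div_hasSum_exp (𝔸 := ℝ) b
    rw [← Real.exp_eq_exp_ℝ] at h
    exact (hasSum_nat_add_iff' N).2 h
  -- Termwise comparison of the two tails: Y^(j+N) ≤ (Y/a)^N a^(j+N) because Y ≤ a.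
  refine hasSum_le (fun j => ?_) (hs Y) ((hs a).mul_left _)
  rw [← mul_div_assoc]
  gcongr
  rw [div_pow, pow_add, pow_add]
  have h1 : Y ^ j ≤ a ^ j := pow_le_pow_left₀ hY hYa j
  have h2 : Y ^ N / a ^ N * (a ^ j * a ^ N) = a ^ j * Y ^ N := by field_simp
  rw [h2]; gcongr

theorem exp_four_le : Real.exp 4 ≤ 54.6 := by
  have h : Real.exp 4 = Real.exp 1 ^ 4 := by rw [← Real.exp_nat_mul]; norm_num
  rw [h]
  have := Real.exp_one_lt_d9
  calc Real.exp 1 ^ 4 ≤ 2.7182818286 ^ 4 := by gcongr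
    _ ≤ 54.6 := by norm_num

/-- The remainder of order 5 is compared with its value at 4: the exponential series at 4, stopped
at degree 4, is 103/3, and (54.6 - 103/3) / 4^5 < 0.0198. -/
theorem exp_le_quartic {Y : ℝ} (h0 : 0 ≤ Y) (h4 : Y ≤ 4) :
    Real.exp Y - 1 - Y - Y ^ 2 / 2 ≤ Y ^ 3 / 6 + Y ^ 4 / 24 + 0.0198 * Y ^ 5 := by
  have h := exp_sub_sum_le h0 h4 (by norm_num) 5
  simp only [Finset.sum_range_succ, Finset.sum_range_zero, Nat.factorial] at h
  have e := exp_four_le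
  have : (Y / 4) ^ 5 * (54.6 - 103 / 3) ≤ 0.0198 * Y ^ 5 := by
    rw [div_pow]; have : 0 ≤ Y ^ 5 := by positivity
    nlinarith
  have h5 : (0 : ℝ) ≤ (Y / 4) ^ 5 := by positivity
  norm_num at h
  nlinarith

/-- The majorant is a perfect square so that the norm itself can be read off. The leading
coefficient is 1/6, and 0.4083 lies just above its square root. -/
theorem exp_taylor_le {y : ℝ} (hy : |y| ≤ 2) :
    Real.exp (y ^ 2) - 1 - y ^ 2 - y ^ 4 / 2 ≤ (|y| ^ 3 * (0.4083 + 0.0996 * y ^ 2)) ^ 2 := by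
  have hY : y ^ 2 ≤ 4 := by nlinarith [sq_abs y, abs_nonneg y]
  have h := exp_le_quartic (sq_nonneg y) hY
  have e : (|y| ^ 3 * (0.4083 + 0.0996 * y ^ 2)) ^ 2
      = (y ^ 2) ^ 3 * (0.4083 + 0.0996 * y ^ 2) ^ 2 := by
    rw [mul_pow, ← pow_mul, ← sq_abs y]; ring
  rw [e]
  have h3 : 0 ≤ (y ^ 2) ^ 3 := by positivity
  have : 1 / 6 + y ^ 2 / 24 + 0.0198 * (y ^ 2) ^ 2 ≤ (0.4083 + 0.0996 * y ^ 2) ^ 2 := by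
    nlinarith [sq_nonneg y, mul_nonneg (sq_nonneg y) (sub_nonneg.2 hY)]
  nlinarith

/-- Again a perfect square: the leading coefficient is 3/2, and 1.2248 lies just above its square
root. In the proof 643/15 is the exponential series at 4 stopped at degree 5. -/
theorem exp_taylor_deriv_le {y : ℝ} (hy : |y| ≤ 2) :
    (1 + y ^ 2) * Real.exp (y ^ 2) - 1 - 2 * y ^ 2
      ≤ (y ^ 2 * (1.2248 + 0.35 * y ^ 2 + 0.09 * y ^ 4)) ^ 2 := by
  have hY : y ^ 2 ≤ 4 := by nlinarith [sq_abs y, abs_nonneg y]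
  set Y := y ^ 2 with hYd
  have hY0 : 0 ≤ Y := sq_nonneg y
  have h := exp_sub_sum_le hY0 hY (by norm_num) 6
  simp only [Finset.sum_range_succ, Finset.sum_range_zero, Nat.factorial] at h
  have e := exp_four_le
  have h5 : (0 : ℝ) ≤ (Y / 4) ^ 6 := by positivity
  norm_num at h
  have h6 : Real.exp Y ≤ 1 + Y + Y ^ 2 / 2 + Y ^ 3 / 6 + Y ^ 4 / 24 + Y ^ 5 / 120
      + (Y / 4) ^ 6 * (54.6 - 643 / 15) := by nlinarith
  have e4 : y ^ 4 = Y ^ 2 := by rw [hYd]; ring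
  rw [e4]
  have h7 : (1 + Y) * Real.exp Y ≤ (1 + Y) * (1 + Y + Y ^ 2 / 2 + Y ^ 3 / 6 + Y ^ 4 / 24
      + Y ^ 5 / 120 + (Y / 4) ^ 6 * (54.6 - 643 / 15)) := by gcongr
  have key : 1.5 + 2 / 3 * Y + 5 / 24 * Y ^ 2 + Y ^ 3 / 20 + Y ^ 4 / 120
      + (1 + Y) * Y ^ 4 * ((54.6 - 643 / 15) / 4096) ≤ (1.2248 + 0.35 * Y + 0.09 * Y ^ 2) ^ 2 := by
    have h4 : 0 ≤ 4 - Y := by linarith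
    nlinarith [mul_nonneg hY0 h4, mul_nonneg (mul_nonneg hY0 h4) hY0,
      mul_nonneg (mul_nonneg hY0 h4) (sq_nonneg Y), mul_nonneg (mul_nonneg hY0 h4)
      (sq_nonneg (Y - 2)), mul_nonneg (mul_nonneg hY0 h4) (pow_nonneg hY0 3), 
      mul_nonneg (mul_nonneg hY0 h4) (mul_nonneg hY0 (sq_nonneg (Y - 2))), 
      mul_nonneg (mul_nonneg hY0 h4) (mul_nonneg hY0 (sq_nonneg (Y - 3)))]
  have hY2 : 0 ≤ Y ^ 2 := sq_nonneg Y
  nlinarith [mul_le_mul_of_nonneg_left key hY2]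


/-! ### Norms relative to the inverse of a density -/

section InverseWeight

variable {Ω : Type*} [MeasurableSpace Ω]

/-- The measure with density `1 / D` with respect to Lebesgue measure. -/
noncomputable def invWeight (D : ℝ → ℝ) : Measure ℝ :=
  volume.withDensity fun z => (ENNReal.ofReal (D z))⁻¹

theorem lintegral_invWeight {D : ℝ → ℝ} (hD : Measurable D) (hpos : ∀ z, 0 < D z)
    (g : ℝ → ℝ≥0∞) :
    ∫⁻ z, g z ∂(invWeight D) = ∫⁻ z, (ENNReal.ofReal (D z))⁻¹ * g z := by
  rw [invWeight, lintegral_withDensity_eq_lintegral_mul_non_measurable₀]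
  · rfl
  · exact (hD.ennreal_ofReal.inv).aemeasurable
  · exact ae_of_all _ fun z => by simpa using hpos z

theorem sigmaFinite_invWeight {D : ℝ → ℝ} (hpos : ∀ z, 0 < D z) :
    SigmaFinite (invWeight D) := by
  refine SigmaFinite.withDensity_of_ne_top (ae_of_all _ fun z => ?_)
  simpa using hpos z

/-- Cauchy-Schwarz after multiplying and dividing by the square root of φ(z - T). The second factor
is the Gaussian mixture itself, to be compared with the reference density. -/
theorem sq_lintegral_mul_le (P : Measure Ω) {T : Ω → ℝ} (hT : Measurable T) {Y : Ω → ℝ≥0∞}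
    (hY : Measurable Y) {p : ℝ → ℝ} (hp : Measurable p) (z : ℝ) :
    (∫⁻ ω, Y ω * ‖p (z - T ω)‖ₑ ∂P) ^ 2
      ≤ (∫⁻ ω, Y ω ^ 2 * ENNReal.ofReal (p (z - T ω) ^ 2 / stdDensity (z - T ω)) ∂P)
        * ∫⁻ ω, ENNReal.ofReal (stdDensity (z - T ω)) ∂P := by
  have e : ∀ ω, Y ω * ‖p (z - T ω)‖ₑ
      = (Y ω * ENNReal.ofReal (|p (z - T ω)| / √(stdDensity (z - T ω))))
        * ENNReal.ofReal (√(stdDensity (z - T ω))) := fun ω => by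
    have h := stdDensity_pos (z - T ω)
    rw [mul_assoc, ← ENNReal.ofReal_mul (by positivity),
      div_mul_cancel₀ _ (Real.sqrt_pos.2 h).ne', ← Real.norm_eq_abs, ofReal_norm]
  simp only [e]
  refine (pow_le_pow_left' (lintegral_mul_le_l2norm ?_ ?_) 2).trans_eq ?_
  · fun_prop
  · fun_prop
  · rw [mul_pow, l2norm_sq, l2norm_sq]
    congr 1
    · refine lintegral_congr fun ω => ?_
      have h := stdDensity_pos (z - T ω)
      rw [mul_pow, ← ENNReal.ofReal_pow (by positivity), div_pow, Real.sq_sqrt h.le, sq_abs]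
    · refine lintegral_congr fun ω => ?_
      rw [← ENNReal.ofReal_pow (by positivity), Real.sq_sqrt (stdDensity_pos _).le]

/-- Cauchy--Schwarz bound for a mixture of translates of a function, relative to a density which
dominates the corresponding mixture of Gaussian densities. -/
theorem l2norm_mixture_le (P : Measure Ω) [SFinite P] {T : Ω → ℝ} (hT : Measurable T)
    {Y : Ω → ℝ≥0∞} (hY : Measurable Y) {p : ℝ → ℝ} (hp : Measurable p) {D : ℝ → ℝ}
    (hD : Measurable D) (hpos : ∀ z, 0 < D z) {C K V : ℝ≥0∞}
    (hC : ∀ z, ∫⁻ ω, ENNReal.ofReal (stdDensity (z - T ω)) ∂P ≤ C ^ 2 * ENNReal.ofReal (D z))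
    (hK : gaussNormSq p ≤ K ^ 2) (hV : l2norm P Y ≤ V) :
    l2norm (invWeight D) (fun z => ∫⁻ ω, Y ω * ‖p (z - T ω)‖ₑ ∂P) ≤ C * (K * V) := by
  apply l2norm_le_of_sq_le
  rw [lintegral_invWeight hD hpos]
  calc ∫⁻ z, (ENNReal.ofReal (D z))⁻¹ * (∫⁻ ω, Y ω * ‖p (z - T ω)‖ₑ ∂P) ^ 2
      ≤ ∫⁻ z, C ^ 2 *
        ∫⁻ ω, Y ω ^ 2 * ENNReal.ofReal (p (z - T ω) ^ 2 / stdDensity (z - T ω)) ∂P := by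
        refine lintegral_mono fun z => ?_
        have hz : ENNReal.ofReal (D z) ≠ 0 := by simpa using hpos z
        -- The mixture factor is at most C² D(z), which cancels the weight 1/D(z).
        refine (mul_le_mul_right ((sq_lintegral_mul_le P hT hY hp z).trans
          (mul_le_mul_right (hC z) _)) _).trans_eq ?_
        rw [mul_comm, ← mul_assoc, mul_assoc _ (ENNReal.ofReal (D z)),
          ENNReal.mul_inv_cancel hz ENNReal.ofReal_ne_top, mul_one, mul_comm]
    _ = C ^ 2 * ∫⁻ ω, (∫⁻ z : ℝ,
        Y ω ^ 2 * ENNReal.ofReal (p (z - T ω) ^ 2 / stdDensity (z - T ω))) ∂P := by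
        rw [lintegral_const_mul, lintegral_lintegral_swap]
        · refine Measurable.aemeasurable ?_
          fun_prop
        · refine Measurable.lintegral_prod_right' (f := fun x : ℝ × Ω => Y x.2 ^ 2 *
            ENNReal.ofReal (p (x.1 - T x.2) ^ 2 / stdDensity (x.1 - T x.2))) ?_
          fun_prop
    _ = C ^ 2 * ∫⁻ ω, Y ω ^ 2 * gaussNormSq p ∂P := by
        congr 1
        refine lintegral_congr fun ω => ?_
        rw [lintegral_const_mul _ (by fun_prop), gaussNormSq,
          lintegral_sub_right_eq_self
            (fun z => ENNReal.ofReal (p z ^ 2 / stdDensity z)) (T ω)]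
    _ = C ^ 2 * (l2norm P Y ^ 2 * gaussNormSq p) := by
        rw [lintegral_mul_const _ (by fun_prop), l2norm_sq]
    _ ≤ (C * (K * V)) ^ 2 := by
        rw [mul_pow, mul_pow, mul_comm (K ^ 2)]
        gcongr

/-- The `L¹` norm is dominated by the norm weighted by the inverse of a probability density. -/
theorem lintegral_le_l2norm_invWeight {D : ℝ → ℝ} (hD : Measurable D) (hpos : ∀ z, 0 < D z)
    (h1 : ∫⁻ z, ENNReal.ofReal (D z) ≤ 1) {q : ℝ → ℝ≥0∞} (hq : Measurable q) :
    ∫⁻ z, q z ≤ l2norm (invWeight D) q := by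
  have hz : ∀ z, ENNReal.ofReal (D z) ≠ 0 := fun z => by simpa using hpos z
  have e : ∫⁻ z, q z = ∫⁻ z, q z * ENNReal.ofReal (D z) ∂(invWeight D) := by
    rw [lintegral_invWeight hD hpos]
    refine lintegral_congr fun z => ?_
    rw [mul_comm (q z), ← mul_assoc, ENNReal.inv_mul_cancel (hz z) ENNReal.ofReal_ne_top, one_mul]
  have e2 : l2norm (invWeight D) (fun z => ENNReal.ofReal (D z)) ≤ 1 := by
    apply l2norm_le_of_sq_le
    rw [lintegral_invWeight hD hpos, one_pow]
    refine le_trans (le_of_eq (lintegral_congr fun z => ?_)) h1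
    rw [sq, ← mul_assoc, ENNReal.inv_mul_cancel (hz z) ENNReal.ofReal_ne_top, one_mul]
  rw [e]
  refine (lintegral_mul_le_l2norm hq.aemeasurable hD.ennreal_ofReal.aemeasurable).trans ?_
  calc _ ≤ l2norm (invWeight D) q * 1 := by gcongr
    _ = _ := mul_one _

end InverseWeight

/-! ### Sums of independent variables with a common law -/

section IID

variable {n : ℕ} {μ : Measure ℝ} [IsProbabilityMeasure μ]

/-- The law of `n` independent variables with common law `μ`. -/
noncomputable abbrev iidLaw (μ : Measure ℝ) (n : ℕ) : Measure (Fin n → ℝ) :=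
  Measure.pi fun _ => μ

/-- The sum of all coordinates. -/
def total (ω : Fin n → ℝ) : ℝ := ∑ i, ω i

/-- The sum of all coordinates but one. -/
def others (i : Fin n) (ω : Fin n → ℝ) : ℝ := ∑ j ∈ Finset.univ.erase i, ω j

theorem total_eq (i : Fin n) (ω : Fin n → ℝ) : total ω = ω i + others i ω := by
  rw [total, others, Finset.add_sum_erase _ _ (Finset.mem_univ i)]

@[fun_prop]
theorem measurable_total : Measurable (total (n := n)) := by unfold total; fun_prop

@[fun_prop]
theorem measurable_others (i : Fin n) : Measurable (others i) := by unfold others; fun_prop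

theorem iIndepFun_coord : iIndepFun (fun (i : Fin n) (ω : Fin n → ℝ) => ω i) (iidLaw μ n) :=
  iIndepFun_pi (X := fun _ : Fin n => (id : ℝ → ℝ)) fun _ => aemeasurable_id

theorem map_coord (i : Fin n) : (iidLaw μ n).map (fun ω => ω i) = μ :=
  (measurePreserving_eval (fun _ : Fin n => μ) i).map_eq

theorem map_coord_others (i : Fin n) :
    (iidLaw μ n).map (fun ω => (ω i, others i ω))
      = μ.prod ((iidLaw μ n).map (others i)) := by
  have h := (iIndepFun_coord (μ := μ) (n := n)).indepFun_finsetSum_of_notMem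
    (fun i => by fun_prop) (Finset.notMem_erase i Finset.univ)
  have h2 : IndepFun (fun ω : Fin n → ℝ => ω i) (others i) (iidLaw μ n) := by
    refine h.symm.congr (ae_of_all _ fun _ => rfl) (ae_of_all _ fun ω => ?_)
    simp [others]
  rw [(indepFun_iff_map_prod_eq_prod_map_map (measurable_pi_apply i).aemeasurable
    (measurable_others i).aemeasurable).1 h2, map_coord]

theorem lintegral_coord (i : Fin n) {g : ℝ → ℝ≥0∞} (hg : Measurable g) :
    ∫⁻ ω, g (ω i) ∂(iidLaw μ n) = ∫⁻ a, g a ∂μ := by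
  rw [← lintegral_map hg (measurable_pi_apply i), map_coord]

theorem lintegral_coord_others (i : Fin n) {G : ℝ → ℝ → ℝ≥0∞}
    (hG : Measurable (Function.uncurry G)) :
    ∫⁻ ω, G (ω i) (others i ω) ∂(iidLaw μ n)
      = ∫⁻ ω, ∫⁻ a, G a (others i ω) ∂μ ∂(iidLaw μ n) := by
  have h := lintegral_map (μ := iidLaw μ n) hG (g := fun ω => (ω i, others i ω)) (by fun_prop)
  have h0 : ∫⁻ ω, G (ω i) (others i ω) ∂(iidLaw μ n)
      = ∫⁻ ω, Function.uncurry G (ω i, others i ω) ∂(iidLaw μ n) := rfl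
  rw [h0, ← h, map_coord_others, lintegral_prod_symm _ hG.aemeasurable,
    lintegral_map (Measurable.lintegral_prod_left' hG) (by fun_prop)]
  rfl

theorem integral_coord_others (i : Fin n) {G : ℝ → ℝ → ℝ}
    (hG : Measurable (Function.uncurry G))
    (hi : Integrable (fun ω => G (ω i) (others i ω)) (iidLaw μ n)) :
    Integrable (fun ω => ∫ a, G a (others i ω) ∂μ) (iidLaw μ n) ∧
    ∫ ω, G (ω i) (others i ω) ∂(iidLaw μ n)
      = ∫ ω, ∫ a, G a (others i ω) ∂μ ∂(iidLaw μ n) := by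
  have hm : AEMeasurable (fun ω : Fin n → ℝ => (ω i, others i ω)) (iidLaw μ n) := by fun_prop
  have hi2 : Integrable (Function.uncurry G) (μ.prod ((iidLaw μ n).map (others i))) := by
    rw [← map_coord_others]
    exact (integrable_map_measure hG.aestronglyMeasurable hm).2 hi
  have : IsProbabilityMeasure ((iidLaw μ n).map (others i)) :=
    Measure.isProbabilityMeasure_map (by fun_prop)
  have hswap := hi2.integral_prod_right
  constructor
  · exact (integrable_map_measure hswap.aestronglyMeasurable (by fun_prop)).1 hswap
  · have h0 : ∫ ω, G (ω i) (others i ω) ∂(iidLaw μ n)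
      = ∫ ω, Function.uncurry G (ω i, others i ω) ∂(iidLaw μ n) := rfl
    rw [h0, ← integral_map hm hG.aestronglyMeasurable, map_coord_others,
      integral_prod_symm _ hi2, integral_map (by fun_prop) hswap.aestronglyMeasurable]
    rfl

/-- The density of `t S + G`, where `S` is the sum and `G` is an independent standard Gaussian
variable. -/
noncomputable def smoothDensity (μ : Measure ℝ) (n : ℕ) (t z : ℝ) : ℝ :=
  ∫ ω, stdDensity (z - t * total ω) ∂(iidLaw μ n)

theorem stdDensity_le_one (z : ℝ) : stdDensity z ≤ 1 := by
  rw [stdDensity_eq]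
  have h1 : (√(2 * Real.pi))⁻¹ ≤ 1 := by
    apply inv_le_one_of_one_le₀
    rw [Real.one_le_sqrt]
    have := Real.pi_gt_three
    linarith
  have h2 : Real.exp (-z ^ 2 / 2) ≤ 1 := by
    rw [Real.exp_le_one_iff]; nlinarith [sq_nonneg z]
  exact mul_le_one₀ h1 (Real.exp_pos _).le h2

theorem integrable_stdDensity_comp {Ω : Type*} [MeasurableSpace Ω] {P : Measure Ω}
    [IsFiniteMeasure P] {T : Ω → ℝ} (hT : Measurable T) :
    Integrable (fun ω => stdDensity (T ω)) P := by
  refine Integrable.of_bound (C := 1) (measurable_stdDensity.comp hT).aestronglyMeasurable (ae_of_all _ fun ω => ?_)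
  rw [Real.norm_eq_abs, abs_of_pos (stdDensity_pos _)]
  exact stdDensity_le_one _

theorem ofReal_smoothDensity (t z : ℝ) :
    ENNReal.ofReal (smoothDensity μ n t z)
      = ∫⁻ ω, ENNReal.ofReal (stdDensity (z - t * total ω)) ∂(iidLaw μ n) := by
  rw [smoothDensity, ofReal_integral_eq_lintegral_ofReal]
  · exact integrable_stdDensity_comp (by fun_prop)
  · exact ae_of_all _ fun _ => (stdDensity_pos _).le

theorem smoothDensity_pos (t z : ℝ) : 0 < smoothDensity μ n t z := by
  rw [smoothDensity, integral_pos_iff_support_of_nonneg (fun _ => (stdDensity_pos _).le)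
    (integrable_stdDensity_comp (by fun_prop))]
  have : (Function.support fun ω : Fin n → ℝ => stdDensity (z - t * total ω)) = Set.univ := by
    ext ω; simp [(stdDensity_pos _).ne']
  rw [this]; simp

theorem continuous_smoothDensity :
    Continuous fun p : ℝ × ℝ => smoothDensity μ n p.1 p.2 := by
  unfold smoothDensity
  refine continuous_of_dominated (bound := fun _ => 1) ?_ ?_ (integrable_const _) ?_
  · exact fun p => (by fun_prop : Measurable _).aestronglyMeasurable
  · intro p
    refine ae_of_all _ fun ω => ?_
    rw [Real.norm_eq_abs, abs_of_pos (stdDensity_pos _)]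
    exact stdDensity_le_one _
  · refine ae_of_all _ fun ω => continuous_stdDensity.comp (by fun_prop)

theorem measurable_smoothDensity (t : ℝ) : Measurable (smoothDensity μ n t) :=
  (continuous_smoothDensity.comp (by fun_prop : Continuous fun z : ℝ => (t, z))).measurable

theorem lintegral_stdDensity : ∫⁻ z, ENNReal.ofReal (stdDensity z) = 1 :=
  lintegral_gaussianPDFReal_eq_one 0 one_ne_zero

theorem lintegral_smoothDensity (t : ℝ) :
    ∫⁻ z, ENNReal.ofReal (smoothDensity μ n t z) = 1 := by
  simp only [ofReal_smoothDensity]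
  rw [lintegral_lintegral_swap (Measurable.aemeasurable (by fun_prop))]
  have : ∀ ω : Fin n → ℝ, ∫⁻ z, ENNReal.ofReal (stdDensity (z - t * total ω)) = 1 := fun ω => by
    rw [lintegral_sub_right_eq_self (fun z => ENNReal.ofReal (stdDensity z)) (t * total ω),
      lintegral_stdDensity]
  simp [this]

/-- A Gaussian mixture with a centered mixing law of unit variance dominates a multiple of the
Gaussian density. -/
theorem exp_mul_stdDensity_le (hi : Integrable (fun a => a) μ) (hi2 : Integrable (fun a => a ^ 2) μ)
    (h1 : ∫ a, a ∂μ = 0) (h2 : ∫ a, a ^ 2 ∂μ = 1) (t z : ℝ) :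
    Real.exp (-t ^ 2 / 2) * stdDensity z ≤ ∫ a, stdDensity (z - t * a) ∂μ := by
  have hlow : ∀ a : ℝ, Real.exp (-t ^ 2 / 2) * stdDensity z
      * (1 + t ^ 2 / 2 + t * z * a - t ^ 2 / 2 * a ^ 2) ≤ stdDensity (z - t * a) := fun a => by
    rw [stdDensity_sub]
    -- The shift t²/2 makes the exponent centred when a has mean 0 and variance 1, so the tangent
    -- line loses nothing after averaging: this is Jensen's inequality.
    have h := Real.add_one_le_exp (t * a * z - (t * a) ^ 2 / 2 + t ^ 2 / 2)
    have e : Real.exp (t * a * z - (t * a) ^ 2 / 2) = Real.exp (-t ^ 2 / 2)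
        * Real.exp (t * a * z - (t * a) ^ 2 / 2 + t ^ 2 / 2) := by
      rw [← Real.exp_add]; ring_nf
    rw [e]
    have := stdDensity_pos z
    have h3 := Real.exp_pos (-t ^ 2 / 2)
    calc _ = Real.exp (-t ^ 2 / 2) * stdDensity z
          * (t * a * z - (t * a) ^ 2 / 2 + t ^ 2 / 2 + 1) := by ring
      _ ≤ Real.exp (-t ^ 2 / 2) * stdDensity z
          * Real.exp (t * a * z - (t * a) ^ 2 / 2 + t ^ 2 / 2) := by gcongr
      _ = _ := by ring
  have hint : Integrable (fun a => 1 + t ^ 2 / 2 + t * z * a - t ^ 2 / 2 * a ^ 2) μ :=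
    ((integrable_const _).fun_add (hi.const_mul _)).sub (hi2.const_mul _)
  have hval : ∫ a, (1 + t ^ 2 / 2 + t * z * a - t ^ 2 / 2 * a ^ 2) ∂μ = 1 := by
    rw [integral_sub ((integrable_const _).fun_add (hi.const_mul _)) (hi2.const_mul _),
      integral_add (integrable_const _) (hi.const_mul _), integral_const_mul, integral_const_mul,
      h1, h2]
    simp
  have := integral_mono (hint.const_mul (Real.exp (-t ^ 2 / 2) * stdDensity z))
    (integrable_stdDensity_comp (by fun_prop)) hlow
  rwa [integral_const_mul, hval, mul_one] at this

/-- The total is the sum of the others plus one independent coordinate, and averaging over that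
coordinate lowers a Gaussian density by at most the factor exp(-t²/2). The constant is written as
the square of exp(t²/4) because it enters norms through its square root. -/
theorem lintegral_others_le (hi : Integrable (fun a => a) μ)
    (hi2 : Integrable (fun a => a ^ 2) μ)
    (h1 : ∫ a, a ∂μ = 0) (h2 : ∫ a, a ^ 2 ∂μ = 1) (i : Fin n) (t z : ℝ) :
    ∫⁻ ω, ENNReal.ofReal (stdDensity (z - t * others i ω)) ∂(iidLaw μ n)
      ≤ ENNReal.ofReal (Real.exp (t ^ 2 / 4)) ^ 2 * ENNReal.ofReal (smoothDensity μ n t z) := by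
  have e : smoothDensity μ n t z
      = ∫ ω, ∫ a, stdDensity (z - t * others i ω - t * a) ∂μ ∂(iidLaw μ n) := by
    rw [smoothDensity, ← (integral_coord_others (μ := μ) i
      (G := fun a b => stdDensity (z - t * b - t * a)) (by fun_prop)
      (integrable_stdDensity_comp (by fun_prop))).2]
    congr 1; ext ω; rw [total_eq i]; congr 1; ring
  have hint := (integral_coord_others (μ := μ) i
      (G := fun a b => stdDensity (z - t * b - t * a)) (by fun_prop)
      (integrable_stdDensity_comp (by fun_prop))).1
  have hle : ∫ ω, Real.exp (-t ^ 2 / 2) * stdDensity (z - t * others i ω) ∂(iidLaw μ n)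
      ≤ smoothDensity μ n t z := by
    rw [e]
    exact integral_mono ((integrable_stdDensity_comp (by fun_prop)).const_mul _) hint
      fun ω => exp_mul_stdDensity_le hi hi2 h1 h2 t _
  rw [integral_const_mul] at hle
  rw [← ofReal_integral_eq_lintegral_ofReal (integrable_stdDensity_comp (by fun_prop))
    (ae_of_all _ fun _ => (stdDensity_pos _).le), ← ENNReal.ofReal_pow (Real.exp_pos _).le,
    ← ENNReal.ofReal_mul (by positivity)]
  apply ENNReal.ofReal_le_ofReal
  rw [← Real.exp_nat_mul]
  calc ∫ ω, stdDensity (z - t * others i ω) ∂(iidLaw μ n)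
      = Real.exp ((2 : ℕ) * (t ^ 2 / 4)) * (Real.exp (-t ^ 2 / 2)
        * ∫ ω, stdDensity (z - t * others i ω) ∂(iidLaw μ n)) := by
        rw [← mul_assoc, ← Real.exp_add]
        have : (((2 : ℕ) : ℝ) * (t ^ 2 / 4) + -t ^ 2 / 2) = 0 := by push_cast; ring
        rw [this]; simp
    _ ≤ _ := by gcongr

/-- Bound for the contribution of one coordinate through a function of its value and of the sum
of the other coordinates. -/
theorem l2norm_coord_le (hi : Integrable (fun a => a) μ)
    (hi2 : Integrable (fun a => a ^ 2) μ)
    (h1 : ∫ a, a ∂μ = 0) (h2 : ∫ a, a ^ 2 ∂μ = 1) (i : Fin n) (t : ℝ) {b : ℝ → ℝ → ℝ}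
    (hb : Measurable (Function.uncurry b)) {k : ℝ → ℝ≥0∞} (hk : ∀ a, gaussNormSq (b a) ≤ k a ^ 2) :
    l2norm (invWeight (smoothDensity μ n t))
      (fun z => ∫⁻ a, ∫⁻ ω, ‖b a (z - t * others i ω)‖ₑ ∂(iidLaw μ n) ∂μ)
      ≤ ENNReal.ofReal (Real.exp (t ^ 2 / 4)) * ∫⁻ a, k a ∂μ := by
  have hD := measurable_smoothDensity (μ := μ) (n := n) t
  have := sigmaFinite_invWeight (smoothDensity_pos (μ := μ) (n := n) t)
  have hmeas : Measurable (Function.uncurry fun (a z : ℝ) =>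
      ∫⁻ ω, ‖b a (z - t * others i ω)‖ₑ ∂(iidLaw μ n)) := by
    refine Measurable.lintegral_prod_right' (f := fun x : (ℝ × ℝ) × (Fin n → ℝ) =>
      ‖Function.uncurry b (x.1.1, x.1.2 - t * others i x.2)‖ₑ) ?_
    fun_prop
  refine (l2norm_lintegral_le (ν := μ) hmeas).trans ?_
  refine (lintegral_mono fun a => ?_).trans (lintegral_const_mul' _ _ ENNReal.ofReal_ne_top).le
  have := l2norm_mixture_le (iidLaw μ n) (T := fun ω => t * others i ω) (by fun_prop)
    (Y := fun _ => 1) measurable_const (p := b a) hb.of_uncurry_left hD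
    (smoothDensity_pos (μ := μ) (n := n) t) (C := ENNReal.ofReal (Real.exp (t ^ 2 / 4)))
    (lintegral_others_le hi hi2 h1 h2 i t) (hk a) (V := 1)
    (l2norm_le_of_sq_le (by simp))
  simpa using this

/-- Bound for a weighted mixture of translates by the total sum. -/
theorem l2norm_total_le (t : ℝ) {Y : (Fin n → ℝ) → ℝ≥0∞} (hY : Measurable Y) {p : ℝ → ℝ}
    (hp : Measurable p) (hp1 : gaussNormSq p ≤ 1) :
    l2norm (invWeight (smoothDensity μ n t))
      (fun z => ∫⁻ ω, Y ω * ‖p (z - t * total ω)‖ₑ ∂(iidLaw μ n)) ≤ l2norm (iidLaw μ n) Y := by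
  have := l2norm_mixture_le (iidLaw μ n) (T := fun ω => t * total ω) (by fun_prop)
    hY hp (measurable_smoothDensity (μ := μ) (n := n) t)
    (smoothDensity_pos (μ := μ) (n := n) t) (C := 1)
    (by intro z; rw [ofReal_smoothDensity]; simp) (K := 1) (by simpa using hp1) le_rfl
  simpa using this

end IID


/-! ### Decomposition of the velocity field -/

section Decomposition

variable {n : ℕ} {μ : Measure ℝ} [IsProbabilityMeasure μ]

/-- The indicator of `|t a| > 2`. -/
noncomputable def farInd (t a : ℝ) : ℝ := if 2 < |t * a| then 1 else 0

/-- The indicator of `|a| > R`. -/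
noncomputable def bigInd (R a : ℝ) : ℝ := if R < |a| then 1 else 0

theorem measurable_farInd : Measurable fun p : ℝ × ℝ => farInd p.1 p.2 := by
  unfold farInd
  exact Measurable.ite (measurableSet_lt measurable_const (by fun_prop)) measurable_const
    measurable_const

@[fun_prop]
theorem Measurable.farInd {α : Type*} [MeasurableSpace α] {f g : α → ℝ} (hf : Measurable f)
    (hg : Measurable g) : Measurable fun x => farInd (f x) (g x) :=
  measurable_farInd.comp (hf.prodMk hg)

@[fun_prop]
theorem measurable_bigInd (R : ℝ) : Measurable (bigInd R) := by
  unfold bigInd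
  exact Measurable.ite (measurableSet_lt measurable_const (by fun_prop)) measurable_const
    measurable_const

theorem farInd_cases (t a : ℝ) : farInd t a = 0 ∧ |t * a| ≤ 2 ∨ farInd t a = 1 ∧ 2 < |t * a| := by
  unfold farInd; split_ifs with h
  · exact Or.inr ⟨rfl, h⟩
  · exact Or.inl ⟨rfl, not_lt.1 h⟩

theorem bigInd_cases (R a : ℝ) : bigInd R a = 0 ∧ |a| ≤ R ∨ bigInd R a = 1 ∧ R < |a| := by
  unfold bigInd; split_ifs with h
  · exact Or.inr ⟨rfl, h⟩
  · exact Or.inl ⟨rfl, not_lt.1 h⟩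

theorem farInd_nonneg (t a : ℝ) : 0 ≤ farInd t a := by unfold farInd; split_ifs <;> norm_num
theorem farInd_le_one (t a : ℝ) : farInd t a ≤ 1 := by unfold farInd; split_ifs <;> norm_num
theorem bigInd_nonneg (R a : ℝ) : 0 ≤ bigInd R a := by unfold bigInd; split_ifs <;> norm_num
theorem bigInd_le_one (R a : ℝ) : bigInd R a ≤ 1 := by unfold bigInd; split_ifs <;> norm_num

/-- First Hermite weight. -/
noncomputable def hermOne (z : ℝ) : ℝ := z * stdDensity z

/-- Second Hermite weight. -/
noncomputable def hermTwo (z : ℝ) : ℝ := (z ^ 2 - 1) * stdDensity z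

@[fun_prop]
theorem continuous_hermOne : Continuous hermOne := by unfold hermOne; fun_prop

@[fun_prop]
theorem continuous_hermTwo : Continuous hermTwo := by unfold hermTwo; fun_prop

@[fun_prop]
theorem measurable_hermOne : Measurable hermOne := continuous_hermOne.measurable

@[fun_prop]
theorem measurable_hermTwo : Measurable hermTwo := continuous_hermTwo.measurable

theorem abs_hermOne_le (z : ℝ) : |hermOne z| ≤ 1 := by
  rw [hermOne, stdDensity_eq]
  have h1 : (√(2 * Real.pi))⁻¹ ≤ 1 := by
    apply inv_le_one_of_one_le₀
    rw [Real.one_le_sqrt]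
    have := Real.pi_gt_three
    linarith
  have h0 : 0 ≤ (√(2 * Real.pi))⁻¹ := by positivity
  have h2 : |z| * Real.exp (-z ^ 2 / 2) ≤ 1 := by
    have h3 := Real.add_one_le_exp (z ^ 2 / 2)
    have h4 : |z| ≤ Real.exp (z ^ 2 / 2) := by nlinarith [sq_abs z, sq_nonneg (|z| - 1)]
    have h5 : Real.exp (z ^ 2 / 2) * Real.exp (-z ^ 2 / 2) = 1 := by
      rw [← Real.exp_add]; ring_nf; simp
    rw [← h5]; gcongr
  rw [abs_mul, abs_mul, abs_of_nonneg h0, abs_of_pos (Real.exp_pos _)]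
  calc _ = (√(2 * Real.pi))⁻¹ * (|z| * Real.exp (-z ^ 2 / 2)) := by ring
    _ ≤ 1 * 1 := by gcongr
    _ = 1 := by norm_num

theorem gaussNormSq_stdDensity : gaussNormSq stdDensity = 1 := by
  have := gaussNormSq_quadratic 1 0 0
  simpa using this

theorem gaussNormSq_hermOne : gaussNormSq hermOne = 1 := by
  have := gaussNormSq_quadratic 0 1 0
  have e : hermOne = fun z => z * stdDensity z := rfl
  rw [e]; simpa using this

/-- The first order Taylor polynomial at `0` of `y ↦ φ(z - y)`. -/
noncomputable def taylorOne (y z : ℝ) : ℝ := stdDensity z + y * hermOne z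

/-- The second order Taylor polynomial at `0` of `y ↦ φ(z - y)`. -/
noncomputable def taylorTwo (y z : ℝ) : ℝ := taylorOne y z + y ^ 2 / 2 * hermTwo z

/-- Moderate values: density remainder. -/
noncomputable def remModerate (R t a z : ℝ) : ℝ :=
  (1 - bigInd R a) * a * ((1 - farInd t a) * stdDensity (z - t * a) - taylorTwo (t * a) z)

/-- Large values: density remainder. -/
noncomputable def remBig (R t a z : ℝ) : ℝ :=
  bigInd R a * a * ((1 - farInd t a) * (stdDensity (z - t * a) - taylorTwo (t * a) z)
    - farInd t a * taylorOne (t * a) z)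

/-- The remainder of the derivative of the density. -/
noncomputable def remDeriv (t a z : ℝ) : ℝ :=
  hermOne z + t * a * hermTwo z - (1 - farInd t a) * hermOne (z - t * a)

/-- Majorant of the norm of `remModerate`. -/
noncomputable def kappaModerate (y : ℝ) : ℝ :=
  if |y| ≤ 2 then |y| ^ 3 * (0.4083 + 0.0996 * y ^ 2)
  else 0.1415 * |y| ^ 3 + 0.884 * |y| + 0.778

/-- Majorant of the norm of `remBig`. -/
noncomputable def kappaBig (y : ℝ) : ℝ :=
  if |y| ≤ 2 then |y| ^ 3 * (0.4083 + 0.0996 * y ^ 2) else 1.1181 * |y|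

/-- Majorant of the norm of `remDeriv`. -/
noncomputable def kappaDeriv (y : ℝ) : ℝ :=
  if |y| ≤ 2 then y ^ 2 * (1.2248 + 0.35 * y ^ 2 + 0.09 * y ^ 4) else 1.5 * |y|

theorem gaussNormSq_const_mul (c : ℝ) {b : ℝ → ℝ} :
    gaussNormSq (fun z => c * b z) = ENNReal.ofReal (c ^ 2) * gaussNormSq b := by
  rw [gaussNormSq, gaussNormSq, ← lintegral_const_mul' _ _ ENNReal.ofReal_ne_top]
  refine lintegral_congr fun z => ?_
  rw [← ENNReal.ofReal_mul (sq_nonneg c)]; congr 1; ring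

theorem gaussNormSq_mul_le {c : ℝ} {b : ℝ → ℝ} {v k : ℝ} (hb : gaussNormSq b = ENNReal.ofReal v)
    (hk : 0 ≤ k) (hvk : v ≤ k ^ 2) :
    gaussNormSq (fun z => c * b z) ≤ ENNReal.ofReal (|c| * k) ^ 2 := by
  rw [gaussNormSq_const_mul, hb, ← ENNReal.ofReal_pow (by positivity),
    ← ENNReal.ofReal_mul (sq_nonneg c), mul_pow, sq_abs]
  exact ENNReal.ofReal_le_ofReal (by gcongr)

theorem gaussNormSq_remainder (y : ℝ) :
    gaussNormSq (fun z => stdDensity (z - y) - taylorTwo y z)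
      = ENNReal.ofReal (Real.exp (y ^ 2) - 1 - y ^ 2 - y ^ 4 / 2) := by
  rw [← gaussNormSq_taylor]; congr 1; ext z; simp only [taylorTwo, taylorOne, hermOne, hermTwo]; ring

theorem gaussNormSq_taylorTwo (y : ℝ) :
    gaussNormSq (fun z => taylorTwo y z) = ENNReal.ofReal (1 + y ^ 2 + y ^ 4 / 2) := by
  have h := gaussNormSq_quadratic 1 y (y ^ 2 / 2)
  have e : (1 : ℝ) + y ^ 2 + y ^ 4 / 2 = 1 ^ 2 + y ^ 2 + 2 * (y ^ 2 / 2) ^ 2 := by ring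
  rw [e, ← h]; congr 1; ext z; simp only [taylorTwo, taylorOne, hermOne, hermTwo]; ring

theorem gaussNormSq_taylorOne (y : ℝ) :
    gaussNormSq (fun z => taylorOne y z) = ENNReal.ofReal (1 + y ^ 2) := by
  have h := gaussNormSq_quadratic 1 y 0
  have e : (1 : ℝ) + y ^ 2 = 1 ^ 2 + y ^ 2 + 2 * 0 ^ 2 := by ring
  rw [e, ← h]; congr 1; ext z; simp only [taylorOne, hermOne]; ring

theorem kappaModerate_nonneg (y : ℝ) : 0 ≤ kappaModerate y := by
  unfold kappaModerate; split_ifs <;> positivity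

theorem kappaBig_nonneg (y : ℝ) : 0 ≤ kappaBig y := by
  unfold kappaBig; split_ifs <;> positivity

theorem kappaDeriv_nonneg (y : ℝ) : 0 ≤ kappaDeriv y := by
  unfold kappaDeriv; split_ifs <;> positivity

/-- If |ta| ≤ 2 this is a Taylor remainder. Otherwise the translate has been moved to the total sum
and only the Taylor polynomial is left. -/
theorem gaussNormSq_remModerate_le (R t a : ℝ) :
    gaussNormSq (remModerate R t a)
      ≤ ENNReal.ofReal ((1 - bigInd R a) * (|a| * kappaModerate (t * a))) ^ 2 := by
  rcases bigInd_cases R a with ⟨hB, -⟩ | ⟨hB, -⟩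
  swap
  · have : remModerate R t a = fun z => 0 * stdDensity z := by ext z; simp [remModerate, hB]
    rw [this, gaussNormSq_const_mul]; simp
  rw [hB, sub_zero, one_mul]
  rcases farInd_cases t a with ⟨hA, hy⟩ | ⟨hA, hy⟩
  · have e : remModerate R t a = fun z => a * (stdDensity (z - t * a) - taylorTwo (t * a) z) := by
      ext z; simp [remModerate, hA, hB]
    rw [e]
    refine gaussNormSq_mul_le (gaussNormSq_remainder _) (kappaModerate_nonneg _) ?_
    rw [kappaModerate, if_pos hy]
    exact exp_taylor_le hy
  · have e : remModerate R t a = fun z => (-a) * taylorTwo (t * a) z := by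
      ext z; simp [remModerate, hA, hB]
    rw [e, ← abs_neg a]
    refine gaussNormSq_mul_le (gaussNormSq_taylorTwo _) (kappaModerate_nonneg _) ?_
    rw [kappaModerate, if_neg (not_le.2 hy)]
    have e4 : (t * a) ^ 4 = |t * a| ^ 4 := by rw [← Even.pow_abs (by decide)]
    rw [e4, ← sq_abs (t * a)]
    set y := |t * a|
    -- Arithmetic-geometric mean, with near equality at y = 2.5. Trading y² for y³ and y avoids a
    -- logarithm when the bound is integrated against t⁻³; 0.7072 lies just above 1/√2.
    have h1 : 0.7072 * y ^ 2 ≤ 0.1415 * y ^ 3 + 0.884 * y := by nlinarith [sq_nonneg (y - 2.5)]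
    calc 1 + y ^ 2 + y ^ 4 / 2 ≤ (0.7072 * y ^ 2 + 0.778) ^ 2 := by nlinarith [sq_nonneg y]
      _ ≤ _ := by gcongr

theorem gaussNormSq_remBig_le (R t a : ℝ) :
    gaussNormSq (remBig R t a)
      ≤ ENNReal.ofReal (bigInd R a * (|a| * kappaBig (t * a))) ^ 2 := by
  rcases bigInd_cases R a with ⟨hB, -⟩ | ⟨hB, -⟩
  · have : remBig R t a = fun z => 0 * stdDensity z := by ext z; simp [remBig, hB]
    rw [this, gaussNormSq_const_mul]; simp
  rw [hB, one_mul]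
  rcases farInd_cases t a with ⟨hA, hy⟩ | ⟨hA, hy⟩
  · have e : remBig R t a = fun z => a * (stdDensity (z - t * a) - taylorTwo (t * a) z) := by
      ext z; simp [remBig, hA, hB]
    rw [e]
    refine gaussNormSq_mul_le (gaussNormSq_remainder _) (kappaBig_nonneg _) ?_
    rw [kappaBig, if_pos hy]
    exact exp_taylor_le hy
  · have e : remBig R t a = fun z => (-a) * taylorOne (t * a) z := by
      ext z; simp [remBig, hA, hB]
    rw [e, ← abs_neg a]
    refine gaussNormSq_mul_le (gaussNormSq_taylorOne _) (kappaBig_nonneg _) ?_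
    rw [kappaBig, if_neg (not_le.2 hy), ← sq_abs (t * a)]
    -- For |y| > 2 one has 1 + y² ≤ 1.25 y², and 1.1181² ≥ 1.25. Leaving the quadratic Taylor term
    -- out for large far values is what makes this bound linear in |y|.
    nlinarith

theorem gaussNormSq_remDeriv_le (t a : ℝ) :
    gaussNormSq (remDeriv t a) ≤ ENNReal.ofReal (kappaDeriv (t * a)) ^ 2 := by
  rcases farInd_cases t a with ⟨hA, hy⟩ | ⟨hA, hy⟩
  · have e : remDeriv t a = fun z => (-1) * ((z - t * a) * stdDensity (z - t * a)
        - (z + t * a * (z ^ 2 - 1)) * stdDensity z) := by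
      ext z; simp [remDeriv, hA, hermOne, hermTwo]; ring
    have := gaussNormSq_mul_le (c := -1) (gaussNormSq_taylor_deriv (t * a))
      (kappaDeriv_nonneg (t * a)) (by rw [kappaDeriv, if_pos hy]; exact exp_taylor_deriv_le hy)
    rw [e]; simpa using this
  · have e : remDeriv t a = fun z => (0 + 1 * z + t * a * (z ^ 2 - 1)) * stdDensity z := by
      ext z; simp [remDeriv, hA, hermOne, hermTwo]; ring
    rw [e, gaussNormSq_quadratic, ← ENNReal.ofReal_pow (kappaDeriv_nonneg _)]
    apply ENNReal.ofReal_le_ofReal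
    rw [kappaDeriv, if_neg (not_le.2 hy), ← sq_abs (t * a)]
    -- Here 1 + 2y² ≤ (3|y|/2)², with equality at |y| = 2.
    nlinarith

theorem gaussNormSq_mul_remDeriv_le (c t a : ℝ) :
    gaussNormSq (fun z => c * remDeriv t a z) ≤ ENNReal.ofReal (|c| * kappaDeriv (t * a)) ^ 2 := by
  rw [gaussNormSq_const_mul, ENNReal.ofReal_mul (abs_nonneg c), mul_pow,
    ← ENNReal.ofReal_pow (abs_nonneg c), sq_abs]
  gcongr
  exact gaussNormSq_remDeriv_le t a

/-- Contribution of a coordinate through a function of its value and of the other coordinates. -/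
noncomputable def coordTerm (μ : Measure ℝ) {n : ℕ} (b : ℝ → ℝ → ℝ → ℝ) (i : Fin n) (t z : ℝ) :
    ℝ≥0∞ :=
  ∫⁻ a, ∫⁻ ω, ‖b t a (z - t * others i ω)‖ₑ ∂(iidLaw μ n) ∂μ

/-- Contribution of a function of all coordinates and a weight at the total sum. -/
noncomputable def totalTerm (μ : Measure ℝ) {n : ℕ} (Y : ℝ → (Fin n → ℝ) → ℝ) (p : ℝ → ℝ)
    (t z : ℝ) : ℝ≥0∞ :=
  ∫⁻ ω, ‖Y t ω‖ₑ * ‖p (z - t * total ω)‖ₑ ∂(iidLaw μ n)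

/-- Independence of one coordinate from the sum of the others, then Tonelli. With a integrated
outermost, Minkowski's inequality can be applied to the norms of b t a for fixed a. -/
theorem coordTerm_eq {b : ℝ → ℝ → ℝ → ℝ}
    (hb : Measurable fun p : ℝ × ℝ × ℝ => b p.1 p.2.1 p.2.2) (i : Fin n) (t z : ℝ) :
    ∫⁻ ω, ‖b t (ω i) (z - t * others i ω)‖ₑ ∂(iidLaw μ n) = coordTerm μ b i t z := by
  have h1 : Measurable (Function.uncurry fun a s : ℝ => ‖b t a (z - t * s)‖ₑ) :=
    (hb.comp (by fun_prop : Measurable fun p : ℝ × ℝ => (t, p.1, z - t * p.2))).enorm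
  rw [lintegral_coord_others i h1, coordTerm, lintegral_lintegral_swap]
  exact (h1.comp (by fun_prop : Measurable fun p : (Fin n → ℝ) × ℝ =>
    (p.2, others i p.1))).aemeasurable

theorem measurable_coordTerm {b : ℝ → ℝ → ℝ → ℝ}
    (hb : Measurable fun p : ℝ × ℝ × ℝ => b p.1 p.2.1 p.2.2) (i : Fin n) :
    Measurable fun p : ℝ × ℝ => coordTerm μ b i p.1 p.2 := by
  unfold coordTerm
  have h1 : Measurable fun x : ((ℝ × ℝ) × ℝ) × (Fin n → ℝ) =>
      ‖b x.1.1.1 x.1.2 (x.1.1.2 - x.1.1.1 * others i x.2)‖ₑ :=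
    (hb.comp (by fun_prop : Measurable fun x : ((ℝ × ℝ) × ℝ) × (Fin n → ℝ) =>
      (x.1.1.1, x.1.2, x.1.1.2 - x.1.1.1 * others i x.2))).enorm
  exact Measurable.lintegral_prod_right' (f := fun x : (ℝ × ℝ) × ℝ =>
    ∫⁻ ω, ‖b x.1.1 x.2 (x.1.2 - x.1.1 * others i ω)‖ₑ ∂(iidLaw μ n))
    (Measurable.lintegral_prod_right' h1)

theorem measurable_totalTerm {Y : ℝ → (Fin n → ℝ) → ℝ}
    (hY : Measurable fun p : ℝ × (Fin n → ℝ) => Y p.1 p.2) {p : ℝ → ℝ} (hp : Measurable p) :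
    Measurable fun x : ℝ × ℝ => totalTerm μ Y p x.1 x.2 := by
  unfold totalTerm
  refine Measurable.lintegral_prod_right' (f := fun x : (ℝ × ℝ) × (Fin n → ℝ) =>
    ‖Y x.1.1 x.2‖ₑ * ‖p (x.1.2 - x.1.1 * total x.2)‖ₑ) ?_
  exact (hY.comp (by fun_prop : Measurable fun x : (ℝ × ℝ) × (Fin n → ℝ) =>
    (x.1.1, x.2))).enorm.mul (by fun_prop)

end Decomposition


/-! ### Cancellation of the polynomial part and splitting of the velocity -/

section Velocity

variable {n : ℕ} {μ : Measure ℝ} [IsProbabilityMeasure μ]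

/-- A centered law on the line with unit variance and a finite third absolute moment. -/
structure IsStdLaw (μ : Measure ℝ) : Prop where
  integrable_id : Integrable (fun a => a) μ
  integrable_sq : Integrable (fun a => a ^ 2) μ
  integrable_cube : Integrable (fun a => |a| ^ 3) μ
  mean : ∫ a, a ∂μ = 0
  var : ∫ a, a ^ 2 ∂μ = 1

omit [IsProbabilityMeasure μ] in
theorem IsStdLaw.integrable_pow_three (h : IsStdLaw μ) : Integrable (fun a => a ^ 3) μ :=
  h.integrable_cube.mono' (by fun_prop) (ae_of_all _ fun a => by simp)

/-- The mean of the far part. -/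
noncomputable def farMean (μ : Measure ℝ) (t : ℝ) : ℝ := ∫ a, farInd t a * a ∂μ

/-- The mean of the moderate far part. -/
noncomputable def farMeanModerate (μ : Measure ℝ) (R t : ℝ) : ℝ :=
  ∫ a, (1 - bigInd R a) * (farInd t a * a) ∂μ

/-- The mean of the large far part. -/
noncomputable def farMeanBig (μ : Measure ℝ) (R t : ℝ) : ℝ :=
  ∫ a, bigInd R a * (farInd t a * a) ∂μ

/-- The third moment of the large far part. -/
noncomputable def farThird (μ : Measure ℝ) (R t : ℝ) : ℝ :=
  ∫ a, bigInd R a * farInd t a * a ^ 3 ∂μ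

/-- The centered near part. -/
noncomputable def carrier (μ : Measure ℝ) (t a : ℝ) : ℝ := (1 - farInd t a) * a + farMean μ t

/-- The unnormalized velocity of the flow between the law of the sum and the Gaussian law. -/
noncomputable def drift (μ : Measure ℝ) (n : ℕ) (t z : ℝ) : ℝ :=
  ∫ ω : Fin n → ℝ, (total ω * stdDensity (z - t * total ω)
    - n * t * hermOne (z - t * total ω)) ∂(iidLaw μ n)

/-- The part of the velocity which is controlled in quadratic mean. -/
noncomputable def driftMain (μ : Measure ℝ) (n : ℕ) (R t z : ℝ) : ℝ≥0∞ :=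
  (∑ i : Fin n, coordTerm μ (remModerate R) i t z)
  + totalTerm μ (fun t (ω : Fin n → ℝ) => ∑ i, (1 - bigInd R (ω i)) * (farInd t (ω i) * ω i))
      stdDensity t z
  + ‖t‖ₑ * ((∑ i : Fin n, coordTerm μ remDeriv i t z)
    + totalTerm μ (fun t (ω : Fin n → ℝ) => ∑ i, farInd t (ω i)) hermOne t z)
  + ‖(∫ a, a ^ 3 ∂μ) / 2 * t‖ₑ
    * (totalTerm μ (fun t (ω : Fin n → ℝ) => ∑ i, carrier μ t (ω i)) hermOne t z
      + (∑ i : Fin n, coordTerm μ (fun t a z => (1 - bigInd R a) * a * remDeriv t a z) i t z)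
      + totalTerm μ (fun t (_ : Fin n → ℝ) => n * farMeanModerate μ R t) hermOne t z)

/-- The part of the velocity which is controlled in mean. -/
noncomputable def driftRest (μ : Measure ℝ) (n : ℕ) (R t z : ℝ) : ℝ≥0∞ :=
  (∑ i : Fin n, coordTerm μ (remBig R) i t z)
  + totalTerm μ (fun t (ω : Fin n → ℝ) => ∑ i, bigInd R (ω i) * (farInd t (ω i) * ω i))
      stdDensity t z
  + ‖farThird μ R t / 2 * t‖ₑ
    * (totalTerm μ (fun t (ω : Fin n → ℝ) => ∑ i, carrier μ t (ω i)) hermOne t z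
      + (∑ i : Fin n, coordTerm μ (fun t a z => a * remDeriv t a z) i t z)
      + totalTerm μ (fun t (_ : Fin n → ℝ) => n * farMean μ t) hermOne t z)
  + ‖(∫ a, a ^ 3 ∂μ) / 2 * t‖ₑ
    * ((∑ i : Fin n, coordTerm μ (fun t a z => bigInd R a * a * remDeriv t a z) i t z)
      + totalTerm μ (fun t (_ : Fin n → ℝ) => n * farMeanBig μ R t) hermOne t z)

@[fun_prop]
theorem measurable_farMean : Measurable (farMean μ) := by
  unfold farMean
  exact (StronglyMeasurable.integral_prod_right'
    (f := fun p : ℝ × ℝ => farInd p.1 p.2 * p.2)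
    (Measurable.stronglyMeasurable (by fun_prop))).measurable

@[fun_prop]
theorem measurable_farMeanModerate (R : ℝ) : Measurable (farMeanModerate μ R) := by
  unfold farMeanModerate
  exact (StronglyMeasurable.integral_prod_right'
    (f := fun p : ℝ × ℝ => (1 - bigInd R p.2) * (farInd p.1 p.2 * p.2))
    (Measurable.stronglyMeasurable (by fun_prop))).measurable

@[fun_prop]
theorem measurable_farMeanBig (R : ℝ) : Measurable (farMeanBig μ R) := by
  unfold farMeanBig
  exact (StronglyMeasurable.integral_prod_right'
    (f := fun p : ℝ × ℝ => bigInd R p.2 * (farInd p.1 p.2 * p.2))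
    (Measurable.stronglyMeasurable (by fun_prop))).measurable

@[fun_prop]
theorem measurable_farThird (R : ℝ) : Measurable (farThird μ R) := by
  unfold farThird
  exact (StronglyMeasurable.integral_prod_right'
    (f := fun p : ℝ × ℝ => bigInd R p.2 * farInd p.1 p.2 * p.2 ^ 3)
    (Measurable.stronglyMeasurable (by fun_prop))).measurable

@[fun_prop]
theorem Measurable.carrier {α : Type*} [MeasurableSpace α] {f g : α → ℝ} (hf : Measurable f)
    (hg : Measurable g) : Measurable fun x => carrier μ (f x) (g x) := by
  unfold _root_.carrier; fun_prop

theorem measurable_remModerate (R : ℝ) :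
    Measurable fun p : ℝ × ℝ × ℝ => remModerate R p.1 p.2.1 p.2.2 := by
  unfold remModerate taylorTwo taylorOne; fun_prop

theorem measurable_remBig (R : ℝ) :
    Measurable fun p : ℝ × ℝ × ℝ => remBig R p.1 p.2.1 p.2.2 := by
  unfold remBig taylorTwo taylorOne; fun_prop

theorem measurable_remDeriv :
    Measurable fun p : ℝ × ℝ × ℝ => remDeriv p.1 p.2.1 p.2.2 := by
  unfold remDeriv; fun_prop

theorem measurable_mul_remDeriv {c : ℝ → ℝ} (hc : Measurable c) :
    Measurable fun p : ℝ × ℝ × ℝ => c p.2.1 * remDeriv p.1 p.2.1 p.2.2 :=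
  (by fun_prop : Measurable fun p : ℝ × ℝ × ℝ => c p.2.1).mul measurable_remDeriv

theorem measurable_driftMain (R : ℝ) :
    Measurable fun p : ℝ × ℝ => driftMain μ n R p.1 p.2 := by
  unfold driftMain
  have h1 := fun i : Fin n => measurable_coordTerm (μ := μ) (measurable_remModerate R) i
  have h2 := fun i : Fin n => measurable_coordTerm (μ := μ) measurable_remDeriv i
  have h3 := fun i : Fin n => measurable_coordTerm (μ := μ)
    (b := fun t a z => (1 - bigInd R a) * a * remDeriv t a z)
    (measurable_mul_remDeriv (c := fun a => (1 - bigInd R a) * a) (by fun_prop)) i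
  have t1 := measurable_totalTerm (μ := μ) (n := n) (Y := fun t ω =>
    ∑ i, (1 - bigInd R (ω i)) * (farInd t (ω i) * ω i)) (by fun_prop) measurable_stdDensity
  have t2 := measurable_totalTerm (μ := μ) (n := n) (Y := fun t ω =>
    ∑ i, farInd t (ω i)) (by fun_prop) measurable_hermOne
  have t3 := measurable_totalTerm (μ := μ) (n := n) (Y := fun t ω =>
    ∑ i, carrier μ t (ω i)) (by fun_prop) measurable_hermOne
  have t4 := measurable_totalTerm (μ := μ) (n := n) (Y := fun t _ =>
    n * farMeanModerate μ R t) (by fun_prop) measurable_hermOne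
  fun_prop

theorem measurable_driftRest (R : ℝ) :
    Measurable fun p : ℝ × ℝ => driftRest μ n R p.1 p.2 := by
  unfold driftRest
  have h1 := fun i : Fin n => measurable_coordTerm (μ := μ) (measurable_remBig R) i
  have h2 := fun i : Fin n => measurable_coordTerm (μ := μ)
    (b := fun t a z => a * remDeriv t a z)
    (measurable_mul_remDeriv (c := fun a => a) (by fun_prop)) i
  have h3 := fun i : Fin n => measurable_coordTerm (μ := μ)
    (b := fun t a z => bigInd R a * a * remDeriv t a z)
    (measurable_mul_remDeriv (c := fun a => bigInd R a * a) (by fun_prop)) i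
  have t1 := measurable_totalTerm (μ := μ) (n := n) (Y := fun t ω =>
    ∑ i, bigInd R (ω i) * (farInd t (ω i) * ω i)) (by fun_prop) measurable_stdDensity
  have t2 := measurable_totalTerm (μ := μ) (n := n) (Y := fun t _ =>
    n * farMean μ t) (by fun_prop) measurable_hermOne
  have t3 := measurable_totalTerm (μ := μ) (n := n) (Y := fun t ω =>
    ∑ i, carrier μ t (ω i)) (by fun_prop) measurable_hermOne
  have t4 := measurable_totalTerm (μ := μ) (n := n) (Y := fun t _ =>
    n * farMeanBig μ R t) (by fun_prop) measurable_hermOne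
  fun_prop

omit [IsProbabilityMeasure μ] in
theorem integrable_weight_mul (h : Integrable (fun a => a) μ) {w : ℝ → ℝ} (hw : Measurable w)
    (h0 : ∀ a, 0 ≤ w a) (h1 : ∀ a, w a ≤ 1) : Integrable (fun a => w a * a) μ := by
  refine h.mono (by fun_prop) (ae_of_all _ fun a => ?_)
  rw [norm_mul, Real.norm_of_nonneg (h0 a)]
  exact mul_le_of_le_one_left (norm_nonneg _) (h1 a)

omit [IsProbabilityMeasure μ] in
theorem integrable_farInd_mul (h : Integrable (fun a => a) μ) (t : ℝ) :
    Integrable (fun a => farInd t a * a) μ :=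
  integrable_weight_mul h (by fun_prop) (farInd_nonneg t) (farInd_le_one t)

omit [IsProbabilityMeasure μ] in
theorem farMean_eq (h : Integrable (fun a => a) μ) (R t : ℝ) :
    farMean μ t = farMeanModerate μ R t + farMeanBig μ R t := by
  have h1 : Integrable (fun a => bigInd R a * (farInd t a * a)) μ := by
    simp only [← mul_assoc]
    exact integrable_weight_mul h (by fun_prop)
      (fun a => mul_nonneg (bigInd_nonneg R a) (farInd_nonneg t a))
      (fun a => mul_le_one₀ (bigInd_le_one R a) (farInd_nonneg t a) (farInd_le_one t a))
  have h2 := integrable_farInd_mul h t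
  have h3 : farMeanModerate μ R t = farMean μ t - farMeanBig μ R t := by
    rw [farMeanModerate, farMean, farMeanBig, ← integral_sub h2 h1]
    congr 1; ext a; ring
  rw [h3]; ring

/-- The polynomial part of the local expansion. -/
noncomputable def polyPart (R t β a z : ℝ) : ℝ :=
  a * (taylorOne (t * a) z + (1 - bigInd R a * farInd t a) * ((t * a) ^ 2 / 2 * hermTwo z))
    - t * (1 + β * a) * (hermOne z + t * a * hermTwo z)

/-- Collected by powers of a: the linear term vanishes by centring, and t H₁ a² cancels the constant
-t H₁ by unit variance. The coefficient of t² H₂ is half of the third moment, without its large far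
part, minus β; the value of β makes it zero. -/
theorem integral_polyPart (h : IsStdLaw μ) (R t z : ℝ) :
    Integrable (fun a => polyPart R t (((∫ a, a ^ 3 ∂μ) - farThird μ R t) / 2) a z) μ ∧
    ∫ a, polyPart R t (((∫ a, a ^ 3 ∂μ) - farThird μ R t) / 2) a z ∂μ = 0 := by
  set β := ((∫ a, a ^ 3 ∂μ) - farThird μ R t) / 2 with hβ
  have i1 := h.integrable_id
  have i2 := h.integrable_sq
  have i3 := h.integrable_pow_three
  have i4 : Integrable (fun a => bigInd R a * farInd t a * a ^ 3) μ := by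
    refine i3.mono (by fun_prop) (ae_of_all _ fun a => ?_)
    rw [norm_mul, Real.norm_of_nonneg (mul_nonneg (bigInd_nonneg R a) (farInd_nonneg t a))]
    exact mul_le_of_le_one_left (norm_nonneg _)
      (mul_le_one₀ (bigInd_le_one R a) (farInd_nonneg t a) (farInd_le_one t a))
  have e : (fun a => polyPart R t β a z) = fun a =>
      (((stdDensity z - t ^ 2 * hermTwo z - β * t * hermOne z) * a
      + (t * hermOne z - β * t ^ 2 * hermTwo z) * a ^ 2)
      + ((t ^ 2 / 2 * hermTwo z) * a ^ 3 - (t ^ 2 / 2 * hermTwo z)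
        * (bigInd R a * farInd t a * a ^ 3))) + (-(t * hermOne z)) := by
    ext a; simp only [polyPart, taylorOne]; ring
  have j1 := i1.const_mul (stdDensity z - t ^ 2 * hermTwo z - β * t * hermOne z)
  have j2 := i2.const_mul (t * hermOne z - β * t ^ 2 * hermTwo z)
  have j3 := i3.const_mul (t ^ 2 / 2 * hermTwo z)
  have j4 := i4.const_mul (t ^ 2 / 2 * hermTwo z)
  have j34 : Integrable (fun a => t ^ 2 / 2 * hermTwo z * a ^ 3 - t ^ 2 / 2 * hermTwo z
      * (bigInd R a * farInd t a * a ^ 3)) μ := j3.sub j4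
  have jc : Integrable (fun _ : ℝ => -(t * hermOne z)) μ := integrable_const _
  rw [e]
  refine ⟨((j1.fun_add j2).fun_add j34).fun_add jc, ?_⟩
  rw [integral_add ((j1.fun_add j2).fun_add j34) jc,
    integral_add (j1.fun_add j2) j34, integral_add j1 j2, integral_sub j3 j4]
  have k1 := integral_const_mul (μ := μ)
    (stdDensity z - t ^ 2 * hermTwo z - β * t * hermOne z) (fun a => a)
  rw [k1]
  simp only [integral_const_mul, h.mean, h.var, integral_const, probReal_univ, smul_eq_mul]
  have e2 : farThird μ R t = (∫ a, a ^ 3 ∂μ) - 2 * β := by rw [hβ]; ring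
  rw [← farThird, e2]; ring

theorem abs_hermTwo_le (z : ℝ) : |hermTwo z| ≤ 2 := by
  have h0 : 0 ≤ (√(2 * Real.pi))⁻¹ := by positivity
  have h1 : (√(2 * Real.pi))⁻¹ ≤ 1 := by
    apply inv_le_one_of_one_le₀
    rw [Real.one_le_sqrt]
    have := Real.pi_gt_three
    linarith
  have h2 : |z ^ 2 - 1| * Real.exp (-z ^ 2 / 2) ≤ 2 := by
    have h3 := Real.add_one_le_exp (z ^ 2 / 2)
    have h4 : |z ^ 2 - 1| ≤ 2 * Real.exp (z ^ 2 / 2) := by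
      rw [abs_le]; constructor <;> nlinarith [sq_nonneg z]
    have h5 : Real.exp (z ^ 2 / 2) * Real.exp (-z ^ 2 / 2) = 1 := by
      rw [← Real.exp_add]; ring_nf; simp
    calc _ ≤ 2 * Real.exp (z ^ 2 / 2) * Real.exp (-z ^ 2 / 2) := by gcongr
      _ = 2 := by rw [mul_assoc, h5, mul_one]
  rw [hermTwo, stdDensity_eq, abs_mul, abs_mul, abs_of_nonneg h0, abs_of_pos (Real.exp_pos _)]
  calc _ = (√(2 * Real.pi))⁻¹ * (|z ^ 2 - 1| * Real.exp (-z ^ 2 / 2)) := by ring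
    _ ≤ 1 * 2 := by gcongr
    _ = 2 := by norm_num

theorem measurable_polyPart (R t β : ℝ) : Measurable fun p : ℝ × ℝ => polyPart R t β p.1 p.2 := by
  unfold polyPart taylorOne; fun_prop

theorem integrable_coord {g : ℝ → ℝ} (hg : Integrable g μ) (i : Fin n) :
    Integrable (fun ω => g (ω i)) (iidLaw μ n) := by
  have := map_coord (μ := μ) i
  exact (integrable_map_measure (by rw [this]; exact hg.aestronglyMeasurable)
    (measurable_pi_apply i).aemeasurable).1 (by rwa [this])

theorem integral_coord {g : ℝ → ℝ} (hg : AEStronglyMeasurable g μ) (i : Fin n) :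
    ∫ ω, g (ω i) ∂(iidLaw μ n) = ∫ a, g a ∂μ := by
  have := map_coord (μ := μ) i
  conv_rhs => rw [← this]
  rw [integral_map (measurable_pi_apply i).aemeasurable (by rwa [this])]

/-- Condition on the other coordinates, which only shift z. Integrability holds because φ, H₁ and H₂
are bounded, so that the integrand is at most a cubic polynomial in |a|. -/
theorem integral_polyPart_coord (h : IsStdLaw μ) (R t z : ℝ) (i : Fin n) :
    Integrable (fun ω => polyPart R t (((∫ a, a ^ 3 ∂μ) - farThird μ R t) / 2) (ω i)
      (z - t * others i ω)) (iidLaw μ n) ∧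
    ∫ ω, polyPart R t (((∫ a, a ^ 3 ∂μ) - farThird μ R t) / 2) (ω i)
      (z - t * others i ω) ∂(iidLaw μ n) = 0 := by
  have hi : Integrable (fun ω => polyPart R t (((∫ a, a ^ 3 ∂μ) - farThird μ R t) / 2) (ω i)
      (z - t * others i ω)) (iidLaw μ n) := by
    set β := ((∫ a, a ^ 3 ∂μ) - farThird μ R t) / 2
    have hb : Integrable (fun a => |a| * (1 + |t * a| + (t * a) ^ 2)
        + |t| * (1 + |β * a|) * (1 + |t * a| * 2)) μ := by
      have e : (fun a : ℝ => |a| * (1 + |t * a| + (t * a) ^ 2)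
        + |t| * (1 + |β * a|) * (1 + |t * a| * 2)) = fun a => |t| +
          ((1 + |t| * |β| + 2 * |t| ^ 2) * |a| + ((|t| + 2 * |t| ^ 2 * |β|) * a ^ 2
          + t ^ 2 * |a| ^ 3)) := by
        ext a
        have e3 : |a| ^ 3 = |a| * a ^ 2 := by rw [← sq_abs a]; ring
        have e2 : a ^ 2 = |a| * |a| := by rw [← sq_abs a]; ring
        have et : t ^ 2 = |t| * |t| := by rw [← sq_abs t]; ring
        rw [abs_mul, abs_mul, mul_pow, e3, e2, et]; ring
      rw [e]
      exact (integrable_const _).fun_add ((h.integrable_id.abs.const_mul _).fun_add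
        ((h.integrable_sq.const_mul _).fun_add (h.integrable_cube.const_mul _)))
    refine (integrable_coord hb i).mono' ?_ (ae_of_all _ fun ω => ?_)
    · exact ((measurable_polyPart R t β).comp (by fun_prop : Measurable fun ω : Fin n → ℝ =>
        (ω i, z - t * others i ω))).aestronglyMeasurable
    · generalize ω i = a
      generalize z - t * others i ω = u
      have b0 : |stdDensity u| ≤ 1 := by
        rw [abs_of_pos (stdDensity_pos u)]; exact stdDensity_le_one u
      have b1 := abs_hermOne_le u
      have b2 := abs_hermTwo_le u
      have b3 : |1 - bigInd R a * farInd t a| ≤ 1 := by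
        rcases bigInd_cases R a with ⟨h, -⟩ | ⟨h, -⟩ <;>
          rcases farInd_cases t a with ⟨h', -⟩ | ⟨h', -⟩ <;> simp [h, h']
      rw [polyPart, taylorOne, Real.norm_eq_abs]
      have c1 : |stdDensity u + t * a * hermOne u
          + (1 - bigInd R a * farInd t a) * ((t * a) ^ 2 / 2 * hermTwo u)|
          ≤ 1 + |t * a| * 1 + 1 * ((t * a) ^ 2 / 2 * 2) := by
        refine (abs_add_le _ _).trans (add_le_add ((abs_add_le _ _).trans ?_) ?_)
        · rw [abs_mul]; gcongr
        · rw [abs_mul, abs_mul, abs_of_nonneg (by positivity : 0 ≤ (t * a) ^ 2 / 2)]; gcongr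
      have c2 : |hermOne u + t * a * hermTwo u| ≤ 1 + |t * a| * 2 := by
        refine (abs_add_le _ _).trans ?_
        rw [abs_mul]; gcongr
      have c3 : |1 + β * a| ≤ 1 + |β * a| := (abs_add_le _ _).trans (by simp)
      refine (abs_sub _ _).trans (add_le_add ?_ ?_)
      · rw [abs_mul]
        refine mul_le_mul_of_nonneg_left (c1.trans_eq (by ring)) (abs_nonneg _)
      · rw [abs_mul, abs_mul]; gcongr
  refine ⟨hi, ?_⟩
  have hm : Measurable (Function.uncurry fun a b : ℝ => polyPart R t
      (((∫ a, a ^ 3 ∂μ) - farThird μ R t) / 2) a (z - t * b)) :=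
    (measurable_polyPart R t (((∫ a, a ^ 3 ∂μ) - farThird μ R t) / 2)).comp
      (by fun_prop : Measurable fun p : ℝ × ℝ => (p.1, z - t * p.2))
  have := (integral_coord_others (μ := μ) i hm hi).2
  rw [this]
  simp [(integral_polyPart h R t _).2]

theorem integrable_drift (h : IsStdLaw μ) (t z : ℝ) :
    Integrable (fun ω : Fin n → ℝ => total ω * stdDensity (z - t * total ω)
      - n * t * hermOne (z - t * total ω)) (iidLaw μ n) := by
  have h1 : Integrable (total (n := n)) (iidLaw μ n) := by
    unfold total
    exact integrable_finsetSum _ fun i _ => integrable_coord h.integrable_id i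
  refine Integrable.sub ?_ ?_
  · refine h1.mono (by fun_prop) (ae_of_all _ fun ω => ?_)
    rw [norm_mul]
    refine mul_le_of_le_one_right (norm_nonneg _) ?_
    rw [Real.norm_eq_abs, abs_of_pos (stdDensity_pos _)]; exact stdDensity_le_one _
  · refine Integrable.const_mul (Integrable.of_bound (C := 1) (by fun_prop)
      (ae_of_all _ fun ω => abs_hermOne_le _)) _

-- Pure algebra, coordinate by coordinate. Far translates and the corrector are rewritten at the
-- total sum. The corrector uses β a = μ₃ a / 2 - `farThird` a / 2; in each half, adding and
-- subtracting `farMean` centres the near part of a. The last two groups are the main and the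
-- remaining part.
omit [IsProbabilityMeasure μ] in
theorem drift_integrand_eq (R t z : ℝ) (ω : Fin n → ℝ) :
    total ω * stdDensity (z - t * total ω) - n * t * hermOne (z - t * total ω)
      - ∑ i, polyPart R t (((∫ a, a ^ 3 ∂μ) - farThird μ R t) / 2) (ω i) (z - t * others i ω)
    = ((∑ i, remModerate R t (ω i) (z - t * others i ω))
        + (∑ i, (1 - bigInd R (ω i)) * (farInd t (ω i) * ω i)) * stdDensity (z - t * total ω)
        + t * ((∑ i, remDeriv t (ω i) (z - t * others i ω))
          - (∑ i, farInd t (ω i)) * hermOne (z - t * total ω))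
        + (∫ a, a ^ 3 ∂μ) / 2 * t * ((∑ i, carrier μ t (ω i)) * hermOne (z - t * total ω)
          + (∑ i, (1 - bigInd R (ω i)) * ω i * remDeriv t (ω i) (z - t * others i ω))
          - (n * farMeanModerate μ R t) * hermOne (z - t * total ω)))
      + ((∑ i, remBig R t (ω i) (z - t * others i ω))
        + (∑ i, bigInd R (ω i) * (farInd t (ω i) * ω i)) * stdDensity (z - t * total ω)
        - farThird μ R t / 2 * t * ((∑ i, carrier μ t (ω i)) * hermOne (z - t * total ω)
          + (∑ i, ω i * remDeriv t (ω i) (z - t * others i ω))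
          - (n * farMean μ t) * hermOne (z - t * total ω))
        + (∫ a, a ^ 3 ∂μ) / 2 * t * ((∑ i, bigInd R (ω i) * ω i
          * remDeriv t (ω i) (z - t * others i ω))
          - (n * (farMean μ t - farMeanModerate μ R t)) * hermOne (z - t * total ω))) := by
  set m3 := ∫ a, a ^ 3 ∂μ
  have hn : (n : ℝ) = ∑ _i : Fin n, (1 : ℝ) := by simp
  have ht : total ω = ∑ i, ω i := rfl
  generalize hL : stdDensity (z - t * total ω) = L
  generalize hH : hermOne (z - t * total ω) = H
  rw [hn, ht]
  simp only [Finset.sum_mul, Finset.mul_sum, ← Finset.sum_add_distrib, ← Finset.sum_sub_distrib]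
  refine Finset.sum_congr rfl fun i _ => ?_
  -- A translate by one coordinate about the others is a function of the total sum, hence common to
  -- all i.
  have e : z - t * others i ω - t * ω i = z - t * total ω := by rw [total_eq i]; ring
  simp only [polyPart, remModerate, remBig, remDeriv, taylorTwo, carrier, e, hL, hH]
  ring

theorem lintegral_sum_coordTerm {b : ℝ → ℝ → ℝ → ℝ}
    (hb : Measurable fun p : ℝ × ℝ × ℝ => b p.1 p.2.1 p.2.2) (t z : ℝ) :
    ∫⁻ ω, ∑ i : Fin n, ‖b t (ω i) (z - t * others i ω)‖ₑ ∂(iidLaw μ n)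
      = ∑ i : Fin n, coordTerm μ b i t z := by
  rw [lintegral_finsetSum]
  · exact Finset.sum_congr rfl fun i _ => coordTerm_eq hb i t z
  · exact fun i _ => (hb.comp (by fun_prop : Measurable fun ω : Fin n → ℝ =>
      (t, ω i, z - t * others i ω))).enorm

theorem enorm_sub_le_add (a b : ℝ) : ‖a - b‖ₑ ≤ ‖a‖ₑ + ‖b‖ₑ := enorm_sub_le

theorem measurable_coordSum {b : ℝ → ℝ → ℝ → ℝ}
    (hb : Measurable fun p : ℝ × ℝ × ℝ => b p.1 p.2.1 p.2.2) (t z : ℝ) :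
    Measurable fun ω : Fin n → ℝ => ∑ i, ‖b t (ω i) (z - t * others i ω)‖ₑ :=
  Finset.measurable_fun_sum _ fun i _ =>
    (hb.comp (by fun_prop : Measurable fun ω : Fin n → ℝ => (t, ω i, z - t * others i ω))).enorm

/-- The velocity is dominated by the sum of the two controlled parts. -/
theorem enorm_drift_le (h : IsStdLaw μ) (R t z : ℝ) :
    ‖drift μ n t z‖ₑ ≤ driftMain μ n R t z + driftRest μ n R t z := by
  have hp := fun i : Fin n => integral_polyPart_coord h R t z i
  have hsum : Integrable (fun ω => ∑ i, polyPart R t (((∫ a, a ^ 3 ∂μ) - farThird μ R t) / 2) (ω i)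
      (z - t * others i ω)) (iidLaw μ n) := integrable_finsetSum _ fun i _ => (hp i).1
  have e : drift μ n t z = ∫ ω, (total ω * stdDensity (z - t * total ω)
      - n * t * hermOne (z - t * total ω)
      - ∑ i, polyPart R t (((∫ a, a ^ 3 ∂μ) - farThird μ R t) / 2) (ω i) (z - t * others i ω))
      ∂(iidLaw μ n) := by
    rw [integral_sub (integrable_drift h t z) hsum, integral_finsetSum _ fun i _ => (hp i).1]
    simp [(hp _).2, drift]
  have hbig : farMean μ t - farMeanModerate μ R t = farMeanBig μ R t := by
    rw [farMean_eq h.integrable_id R]; ring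
  simp only [drift_integrand_eq, hbig] at e
  rw [e]
  have m1 := measurable_remModerate R
  have m2 := measurable_remDeriv
  have m3 : Measurable fun p : ℝ × ℝ × ℝ => (1 - bigInd R p.2.1) * p.2.1
    * remDeriv p.1 p.2.1 p.2.2 :=
    measurable_mul_remDeriv (c := fun a => (1 - bigInd R a) * a) (by fun_prop)
  have m4 := measurable_remBig R
  have m5 : Measurable fun p : ℝ × ℝ × ℝ => p.2.1 * remDeriv p.1 p.2.1 p.2.2 :=
    measurable_mul_remDeriv (c := fun a => a) (by fun_prop)
  have m6 : Measurable fun p : ℝ × ℝ × ℝ => bigInd R p.2.1 * p.2.1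
    * remDeriv p.1 p.2.1 p.2.2 :=
    measurable_mul_remDeriv (c := fun a => bigInd R a * a) (by fun_prop)
  have s1 := measurable_coordSum (n := n) m1 t z
  have s2 := measurable_coordSum (n := n) m2 t z
  have s3 := measurable_coordSum (n := n) (b := fun t a z => (1 - bigInd R a) * a
    * remDeriv t a z) m3 t z
  have s4 := measurable_coordSum (n := n) m4 t z
  have s5 := measurable_coordSum (n := n) (b := fun t a z => a * remDeriv t a z) m5 t z
  have s6 := measurable_coordSum (n := n) (b := fun t a z => bigInd R a * a
    * remDeriv t a z) m6 t z
  refine (enorm_integral_le_lintegral_enorm _).trans ?_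
  have hM : driftMain μ n R t z = ∫⁻ ω,
      ((∑ i, ‖remModerate R t (ω i) (z - t * others i ω)‖ₑ)
        + ‖∑ i, (1 - bigInd R (ω i)) * (farInd t (ω i) * ω i)‖ₑ * ‖stdDensity (z - t * total ω)‖ₑ
        + ‖t‖ₑ * ((∑ i, ‖remDeriv t (ω i) (z - t * others i ω)‖ₑ)
          + ‖∑ i, farInd t (ω i)‖ₑ * ‖hermOne (z - t * total ω)‖ₑ)
        + ‖(∫ a, a ^ 3 ∂μ) / 2 * t‖ₑ * (‖∑ i, carrier μ t (ω i)‖ₑ * ‖hermOne (z - t * total ω)‖ₑ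
          + (∑ i, ‖(1 - bigInd R (ω i)) * ω i * remDeriv t (ω i) (z - t * others i ω)‖ₑ)
          + ‖n * farMeanModerate μ R t‖ₑ * ‖hermOne (z - t * total ω)‖ₑ)) ∂(iidLaw μ n) := by
    rw [lintegral_add_left (by fun_prop), lintegral_add_left (by fun_prop),
      lintegral_add_left (by fun_prop), lintegral_const_mul _ (by fun_prop),
      lintegral_const_mul _ (by fun_prop), lintegral_add_left (by fun_prop),
      lintegral_add_left (by fun_prop), lintegral_add_left (by fun_prop),
      lintegral_sum_coordTerm m1, lintegral_sum_coordTerm m2,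
      lintegral_sum_coordTerm (b := fun t a z => (1 - bigInd R a) * a * remDeriv t a z) m3]
    rfl
  have hR : driftRest μ n R t z = ∫⁻ ω,
      ((∑ i, ‖remBig R t (ω i) (z - t * others i ω)‖ₑ)
        + ‖∑ i, bigInd R (ω i) * (farInd t (ω i) * ω i)‖ₑ * ‖stdDensity (z - t * total ω)‖ₑ
        + ‖farThird μ R t / 2 * t‖ₑ
          * (‖∑ i, carrier μ t (ω i)‖ₑ * ‖hermOne (z - t * total ω)‖ₑ
          + (∑ i, ‖ω i * remDeriv t (ω i) (z - t * others i ω)‖ₑ)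
          + ‖n * farMean μ t‖ₑ * ‖hermOne (z - t * total ω)‖ₑ)
        + ‖(∫ a, a ^ 3 ∂μ) / 2 * t‖ₑ
          * ((∑ i, ‖bigInd R (ω i) * ω i * remDeriv t (ω i) (z - t * others i ω)‖ₑ)
          + ‖n * farMeanBig μ R t‖ₑ * ‖hermOne (z - t * total ω)‖ₑ)) ∂(iidLaw μ n) := by
    rw [lintegral_add_left (by fun_prop), lintegral_add_left (by fun_prop),
      lintegral_add_left (by fun_prop), lintegral_const_mul _ (by fun_prop),
      lintegral_const_mul _ (by fun_prop), lintegral_add_left (by fun_prop),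
      lintegral_add_left (by fun_prop), lintegral_add_left (by fun_prop),
      lintegral_sum_coordTerm m4,
      lintegral_sum_coordTerm (b := fun t a z => a * remDeriv t a z) m5,
      lintegral_sum_coordTerm (b := fun t a z => bigInd R a * a * remDeriv t a z) m6]
    rfl
  rw [hM, hR, ← lintegral_add_left (by fun_prop)]
  refine lintegral_mono fun ω => ?_
  refine (enorm_add_le _ _).trans (add_le_add ?_ ?_)
  · refine (enorm_add_le _ _).trans (add_le_add ((enorm_add_le _ _).trans (add_le_add
      ((enorm_add_le _ _).trans (add_le_add ?_ ?_)) ?_)) ?_)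
    · exact enorm_sum_le _ _
    · rw [enorm_mul]
    · rw [enorm_mul]
      gcongr
      refine (enorm_sub_le_add _ _).trans (add_le_add (enorm_sum_le _ _) (by rw [enorm_mul]))
    · rw [enorm_mul]
      gcongr
      refine (enorm_sub_le_add _ _).trans (add_le_add ((enorm_add_le _ _).trans (add_le_add
        (by rw [enorm_mul]) (enorm_sum_le _ _))) (by rw [enorm_mul]))
  · refine (enorm_add_le _ _).trans (add_le_add ((enorm_sub_le_add _ _).trans (add_le_add
      ((enorm_add_le _ _).trans (add_le_add ?_ ?_)) ?_)) ?_)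
    · exact enorm_sum_le _ _
    · rw [enorm_mul]
    · rw [enorm_mul]
      gcongr
      refine (enorm_sub_le_add _ _).trans (add_le_add ((enorm_add_le _ _).trans (add_le_add
        (by rw [enorm_mul]) (enorm_sum_le _ _))) (by rw [enorm_mul]))
    · rw [enorm_mul]
      gcongr
      refine (enorm_sub_le_add _ _).trans (add_le_add (enorm_sum_le _ _) (by rw [enorm_mul]))

end Velocity


/-! ### Norms of the velocity at a fixed time -/

section StaticBounds

variable {n : ℕ} {μ : Measure ℝ} [IsProbabilityMeasure μ]

/-- Variances of independent terms add, and each is at most the second moment: a centred sum is of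
order √n. -/
theorem l2norm_sum_sub_mean_le (n : ℕ) {c : ℝ → ℝ} (hc : Measurable c)
    (h2 : Integrable (fun a => c a ^ 2) μ) :
    l2norm (iidLaw μ n) (fun ω => ‖∑ i, c (ω i) - n * ∫ a, c a ∂μ‖ₑ)
      ≤ ENNReal.ofReal (√n) * (∫⁻ a, ENNReal.ofReal (c a ^ 2) ∂μ) ^ (1 / 2 : ℝ) := by
  have hL : MemLp c 2 μ := (memLp_two_iff_integrable_sq hc.aestronglyMeasurable).2 h2
  have hLi : ∀ i : Fin n, MemLp (fun ω : Fin n → ℝ => c (ω i)) 2 (iidLaw μ n) := fun i => by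
    refine (memLp_two_iff_integrable_sq
      (hc.comp (measurable_pi_apply i)).aestronglyMeasurable).2 ?_
    exact integrable_coord (g := fun a => c a ^ 2) h2 i
  have hsum : MemLp (fun ω : Fin n → ℝ => ∑ i, c (ω i)) 2 (iidLaw μ n) :=
    memLp_finsetSum _ fun i _ => hLi i
  have hmean : ∫ ω : Fin n → ℝ, ∑ i, c (ω i) ∂(iidLaw μ n) = n * ∫ a, c a ∂μ := by
    rw [integral_finsetSum _ fun i _ => (hLi i).integrable one_le_two]
    simp [integral_coord hc.aestronglyMeasurable]
  have hvar : Var[fun ω : Fin n → ℝ => ∑ i, c (ω i); iidLaw μ n] ≤ n * ∫ a, c a ^ 2 ∂μ := by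
    have e : (fun ω : Fin n → ℝ => ∑ i, c (ω i)) = ∑ i, fun ω : Fin n → ℝ => c (ω i) := by
      ext ω; simp
    rw [e, IndepFun.variance_sum (fun i _ => hLi i)]
    · calc _ ≤ ∑ i : Fin n, ∫ a, c a ^ 2 ∂μ := by
            refine Finset.sum_le_sum fun i _ => ?_
            rw [← integral_coord (g := fun a => c a ^ 2) h2.aestronglyMeasurable i]
            exact variance_le_expectation_sq (hc.comp (measurable_pi_apply i)).aestronglyMeasurable
        _ = _ := by simp
    · intro i _ j _ hij
      exact ((iIndepFun_coord (μ := μ) (n := n)).indepFun hij).comp hc hc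
  apply l2norm_le_of_sq_le
  have he : ∫⁻ ω : Fin n → ℝ, ‖∑ i, c (ω i) - n * ∫ a, c a ∂μ‖ₑ ^ 2 ∂(iidLaw μ n)
      = eVar[fun ω : Fin n → ℝ => ∑ i, c (ω i); iidLaw μ n] := by
    rw [evariance, hmean]
  rw [he, ← hsum.ofReal_variance_eq, mul_pow, ENNReal.rpow_half_sq,
    ← ENNReal.ofReal_pow (Real.sqrt_nonneg _), Real.sq_sqrt n.cast_nonneg,
    ← ofReal_integral_eq_lintegral_ofReal h2 (ae_of_all _ fun _ => sq_nonneg _),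
    ← ENNReal.ofReal_mul n.cast_nonneg]
  exact ENNReal.ofReal_le_ofReal hvar

theorem l2norm_const_prob {Ω : Type*} [MeasurableSpace Ω] (P : Measure Ω) [IsProbabilityMeasure P]
    (c : ℝ≥0∞) : l2norm P (fun _ => c) = c := by
  rw [l2norm, lintegral_const, measure_univ, mul_one, ENNReal.sq_rpow_half]

/-- Fluctuation of order √n plus a mean of order n. The two are kept apart because they meet the
time weight `speed` with different powers of n. -/
theorem l2norm_sum_coord_le (n : ℕ) {c : ℝ → ℝ} (hc : Measurable c)
    (h2 : Integrable (fun a => c a ^ 2) μ) :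
    l2norm (iidLaw μ n) (fun ω => ‖∑ i, c (ω i)‖ₑ)
      ≤ ENNReal.ofReal (√n) * (∫⁻ a, ENNReal.ofReal (c a ^ 2) ∂μ) ^ (1 / 2 : ℝ)
        + n * ∫⁻ a, ENNReal.ofReal |c a| ∂μ := by
  calc l2norm (iidLaw μ n) (fun ω => ‖∑ i, c (ω i)‖ₑ)
      ≤ l2norm (iidLaw μ n) (fun ω => ‖∑ i, c (ω i) - n * ∫ a, c a ∂μ‖ₑ
        + ‖(n : ℝ) * ∫ a, c a ∂μ‖ₑ) := by
        refine l2norm_mono fun ω => ?_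
        refine le_trans (le_of_eq ?_) (enorm_add_le _ _)
        congr 1; ring
    _ ≤ _ := by
        refine (l2norm_add_le (Measurable.aemeasurable (by fun_prop)) aemeasurable_const).trans
          (add_le_add (l2norm_sum_sub_mean_le n hc h2) ?_)
        rw [l2norm_const_prob, enorm_mul]
        gcongr
        · simp
        · refine (enorm_integral_le_lintegral_enorm _).trans_eq (lintegral_congr fun a => ?_)
          rw [← Real.norm_eq_abs, ofReal_norm]

theorem measurable_sum_coordTerm {b : ℝ → ℝ → ℝ → ℝ}
    (hb : Measurable fun p : ℝ × ℝ × ℝ => b p.1 p.2.1 p.2.2) (t : ℝ) :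
    Measurable fun z => ∑ i : Fin n, coordTerm μ b i t z := by
  have : ∀ i : Fin n, Measurable fun z => coordTerm μ b i t z := fun i =>
    (measurable_coordTerm hb i).comp (by fun_prop : Measurable fun z : ℝ => (t, z))
  fun_prop

theorem measurable_totalTerm_right {Y : ℝ → (Fin n → ℝ) → ℝ}
    (hY : Measurable fun p : ℝ × (Fin n → ℝ) => Y p.1 p.2) {p : ℝ → ℝ} (hp : Measurable p)
    (t : ℝ) : Measurable fun z => totalTerm μ Y p t z :=
  (measurable_totalTerm hY hp).comp (by fun_prop : Measurable fun z : ℝ => (t, z))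

theorem l2norm_totalTerm_le (t : ℝ) {Y : ℝ → (Fin n → ℝ) → ℝ}
    (hY : Measurable (Y t)) {p : ℝ → ℝ} (hp : Measurable p) (hp1 : gaussNormSq p ≤ 1) :
    l2norm (invWeight (smoothDensity μ n t)) (fun z => totalTerm μ Y p t z)
      ≤ l2norm (iidLaw μ n) fun ω => ‖Y t ω‖ₑ :=
  l2norm_total_le t hY.enorm hp hp1

theorem l2norm_coordTerm_le (h : IsStdLaw μ) (t : ℝ) {b : ℝ → ℝ → ℝ → ℝ}
    (hb : Measurable fun p : ℝ × ℝ × ℝ => b p.1 p.2.1 p.2.2) {k : ℝ → ℝ}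
    (hk : ∀ a, gaussNormSq (b t a) ≤ ENNReal.ofReal (k a) ^ 2) :
    l2norm (invWeight (smoothDensity μ n t)) (fun z => ∑ i : Fin n, coordTerm μ b i t z)
      ≤ n * (ENNReal.ofReal (Real.exp (t ^ 2 / 4)) * ∫⁻ a, ENNReal.ofReal (k a) ∂μ) := by
  have hm : ∀ i : Fin n, Measurable fun z => coordTerm μ b i t z := fun i =>
    (measurable_coordTerm hb i).comp (by fun_prop : Measurable fun z : ℝ => (t, z))
  refine (l2norm_sum_le _ fun i => (hm i).aemeasurable).trans ?_
  calc _ ≤ ∑ _i : Fin n, ENNReal.ofReal (Real.exp (t ^ 2 / 4)) * ∫⁻ a, ENNReal.ofReal (k a) ∂μ := by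
        refine Finset.sum_le_sum fun i _ => ?_
        exact l2norm_coord_le h.integrable_id h.integrable_sq h.mean h.var i t (b := b t)
          (hb.comp (by fun_prop : Measurable fun p : ℝ × ℝ => (t, p.1, p.2))) hk
    _ = _ := by simp

/-- As a has mean zero, `farMean` is minus the mean of the near part, so the carrier is centred and
no term of order n appears; truncation does not increase the second moment. -/
theorem l2norm_sum_carrier_le (h : IsStdLaw μ) (n : ℕ) (t : ℝ) :
    l2norm (iidLaw μ n) (fun ω => ‖∑ i, carrier μ t (ω i)‖ₑ) ≤ ENNReal.ofReal (√n) := by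
  have hi := integrable_farInd_mul h.integrable_id t
  have hle : ∀ a, ((1 - farInd t a) * a) ^ 2 ≤ a ^ 2 := fun a => by
    rcases farInd_cases t a with ⟨h', -⟩ | ⟨h', -⟩ <;> simp [h', sq_nonneg]
  have h2 : Integrable (fun a => ((1 - farInd t a) * a) ^ 2) μ :=
    h.integrable_sq.mono' (by fun_prop) (ae_of_all _ fun a => by
      rw [Real.norm_of_nonneg (sq_nonneg _)]; exact hle a)
  have hmean : ∫ a, (1 - farInd t a) * a ∂μ = - farMean μ t := by
    have e : (fun a => (1 - farInd t a) * a) = fun a => a - farInd t a * a := by ext a; ring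
    rw [e, integral_sub h.integrable_id hi, h.mean, farMean]; ring
  have hm := l2norm_sum_sub_mean_le n (c := fun a => (1 - farInd t a) * a) (by fun_prop) h2
  have e : (fun ω : Fin n → ℝ => ‖∑ i, carrier μ t (ω i)‖ₑ) = fun ω =>
      ‖∑ i, (1 - farInd t (ω i)) * ω i - n * ∫ a, (1 - farInd t a) * a ∂μ‖ₑ := by
    ext ω
    rw [hmean]; simp only [carrier, Finset.sum_add_distrib]; simp
  rw [e]
  refine hm.trans ?_
  calc _ ≤ ENNReal.ofReal (√n) * 1 := by
        gcongr
        apply ENNReal.rpow_half_le_of_le_sq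
        rw [← ofReal_integral_eq_lintegral_ofReal h2 (ae_of_all _ fun _ => sq_nonneg _), one_pow,
          ENNReal.ofReal_le_one]
        exact (integral_mono h2 h.integrable_sq hle).trans_eq h.var
    _ = _ := mul_one _

/-- Weight of a moderate value in the velocity. -/
noncomputable def weightModerate (R t a : ℝ) : ℝ :=
  (1 - bigInd R a) * (|a| * (kappaModerate (t * a) + farInd t a))

/-- Weight of a large value in the velocity. -/
noncomputable def weightBig (R t a : ℝ) : ℝ :=
  bigInd R a * (|a| * (kappaBig (t * a) + farInd t a))

/-- Weight of a value in the derivative part of the velocity. -/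
noncomputable def weightDeriv (t a : ℝ) : ℝ := kappaDeriv (t * a) + farInd t a

@[fun_prop]
theorem measurable_kappaModerate : Measurable kappaModerate := by
  unfold kappaModerate
  exact Measurable.ite (measurableSet_le (by fun_prop) measurable_const) (by fun_prop)
    (by fun_prop)

@[fun_prop]
theorem measurable_kappaBig : Measurable kappaBig := by
  unfold kappaBig
  exact Measurable.ite (measurableSet_le (by fun_prop) measurable_const) (by fun_prop)
    (by fun_prop)

@[fun_prop]
theorem measurable_kappaDeriv : Measurable kappaDeriv := by
  unfold kappaDeriv
  exact Measurable.ite (measurableSet_le (by fun_prop) measurable_const) (by fun_prop)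
    (by fun_prop)

@[fun_prop]
theorem Measurable.weightModerate {α : Type*} [MeasurableSpace α] (R : ℝ) {f g : α → ℝ}
    (hf : Measurable f) (hg : Measurable g) :
    Measurable fun x => weightModerate R (f x) (g x) := by
  unfold _root_.weightModerate; fun_prop

@[fun_prop]
theorem Measurable.weightDeriv {α : Type*} [MeasurableSpace α] {f g : α → ℝ}
    (hf : Measurable f) (hg : Measurable g) :
    Measurable fun x => weightDeriv (f x) (g x) := by
  unfold _root_.weightDeriv; fun_prop

theorem one_le_ofReal_exp (t : ℝ) : 1 ≤ ENNReal.ofReal (Real.exp (t ^ 2 / 4)) := by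
  rw [ENNReal.one_le_ofReal, Real.one_le_exp_iff]; positivity

-- Means of far values come without the factor exp(t²/4). As that factor is at least 1, they are
-- merged with the coordinate remainders under one integral.
omit [IsProbabilityMeasure μ] in
theorem absorb_mean {ε N : ℝ≥0∞} (hε : 1 ≤ ε) {f g : ℝ → ℝ} (hf : Measurable f)
    (hf0 : ∀ a, 0 ≤ f a) (hg0 : ∀ a, 0 ≤ g a) :
    N * (ε * ∫⁻ a, ENNReal.ofReal (f a) ∂μ) + N * ∫⁻ a, ENNReal.ofReal (g a) ∂μ
      ≤ N * (ε * ∫⁻ a, ENNReal.ofReal (f a + g a) ∂μ) := by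
  rw [← mul_add]
  gcongr
  simp only [fun a => ENNReal.ofReal_add (hf0 a) (hg0 a)]
  rw [lintegral_add_left (by fun_prop), mul_add]
  gcongr
  exact le_mul_of_one_le_left (by simp) hε

omit [IsProbabilityMeasure μ] in
theorem integrable_weight_mul_sq (h : IsStdLaw μ) {w : ℝ → ℝ} (hw : Measurable w)
    (h0 : ∀ a, 0 ≤ w a) (h1 : ∀ a, w a ≤ 1) : Integrable (fun a => (w a * a) ^ 2) μ := by
  refine h.integrable_sq.mono' (by fun_prop) (ae_of_all _ fun a => ?_)
  rw [Real.norm_of_nonneg (sq_nonneg _), mul_pow]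
  exact mul_le_of_le_one_left (sq_nonneg _) (pow_le_one₀ (h0 a) (h1 a))

omit [IsProbabilityMeasure μ] in
theorem enorm_farMeanModerate_le (R t : ℝ) :
    ‖farMeanModerate μ R t‖ₑ
      ≤ ∫⁻ a, ENNReal.ofReal ((1 - bigInd R a) * (|a| * farInd t a)) ∂μ := by
  refine (enorm_integral_le_lintegral_enorm _).trans_eq (lintegral_congr fun a => ?_)
  rw [← ofReal_norm, Real.norm_eq_abs, abs_mul, abs_mul, abs_of_nonneg (farInd_nonneg t a),
    abs_of_nonneg (sub_nonneg.2 (bigInd_le_one R a))]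
  congr 1; ring

omit [IsProbabilityMeasure μ] in
theorem enorm_farMeanBig_le (R t : ℝ) :
    ‖farMeanBig μ R t‖ₑ ≤ ∫⁻ a, ENNReal.ofReal (bigInd R a * (|a| * farInd t a)) ∂μ := by
  refine (enorm_integral_le_lintegral_enorm _).trans_eq (lintegral_congr fun a => ?_)
  rw [← ofReal_norm, Real.norm_eq_abs, abs_mul, abs_mul, abs_of_nonneg (farInd_nonneg t a),
    abs_of_nonneg (bigInd_nonneg R a)]
  congr 1; ring

omit [IsProbabilityMeasure μ] in
theorem enorm_farMean_le (t : ℝ) :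
    ‖farMean μ t‖ₑ ≤ ∫⁻ a, ENNReal.ofReal (|a| * farInd t a) ∂μ := by
  refine (enorm_integral_le_lintegral_enorm _).trans_eq (lintegral_congr fun a => ?_)
  rw [← ofReal_norm, Real.norm_eq_abs, abs_mul, abs_of_nonneg (farInd_nonneg t a), mul_comm]

theorem l2norm_totalTerm_const_le (n : ℕ) (t : ℝ) (m : ℝ → ℝ) :
    l2norm (invWeight (smoothDensity μ n t))
      (fun z => totalTerm μ (fun t (_ : Fin n → ℝ) => n * m t) hermOne t z) ≤ n * ‖m t‖ₑ := by
  refine (l2norm_totalTerm_le t (Y := fun t (_ : Fin n → ℝ) => n * m t) measurable_const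
    measurable_hermOne gaussNormSq_hermOne.le).trans ?_
  rw [l2norm_const_prob, enorm_mul]; simp

/-- Bound in quadratic mean for the main part of the velocity. -/
theorem l2norm_driftMain_le (h : IsStdLaw μ) (n : ℕ) (R : ℝ) {t : ℝ} (ht : 0 ≤ t) :
    l2norm (invWeight (smoothDensity μ n t)) (driftMain μ n R t)
      ≤ n * (ENNReal.ofReal (Real.exp (t ^ 2 / 4))
          * ∫⁻ a, ENNReal.ofReal (weightModerate R t a) ∂μ)
        + ENNReal.ofReal (√n) * (∫⁻ a, ENNReal.ofReal ((1 - bigInd R a) * (farInd t a * a ^ 2)) ∂μ)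
          ^ (1 / 2 : ℝ)
        + ENNReal.ofReal t * (n * (ENNReal.ofReal (Real.exp (t ^ 2 / 4))
          * ∫⁻ a, ENNReal.ofReal (weightDeriv t a) ∂μ)
          + ENNReal.ofReal (√n) * (∫⁻ a, ENNReal.ofReal (farInd t a) ∂μ) ^ (1 / 2 : ℝ))
        + ENNReal.ofReal (|∫ a, a ^ 3 ∂μ| / 2 * t) * (ENNReal.ofReal (√n)
          + n * (ENNReal.ofReal (Real.exp (t ^ 2 / 4))
            * ∫⁻ a, ENNReal.ofReal ((1 - bigInd R a) * (|a| * weightDeriv t a)) ∂μ)) := by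
  have hε := one_le_ofReal_exp t
  set ε := ENNReal.ofReal (Real.exp (t ^ 2 / 4))
  set Q := invWeight (smoothDensity μ n t)
  have ms := measurable_mul_remDeriv (c := fun a => (1 - bigInd R a) * a) (by fun_prop)
  have q1 : Measurable fun z => ∑ i : Fin n, coordTerm μ (remModerate R) i t z :=
    measurable_sum_coordTerm (measurable_remModerate R) t
  have q2 : Measurable fun z => totalTerm μ (fun t (ω : Fin n → ℝ) =>
      ∑ i, (1 - bigInd R (ω i)) * (farInd t (ω i) * ω i)) stdDensity t z :=
    measurable_totalTerm_right (Y := fun t (ω : Fin n → ℝ) =>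
      ∑ i, (1 - bigInd R (ω i)) * (farInd t (ω i) * ω i)) (by fun_prop)
      measurable_stdDensity t
  have q3 : Measurable fun z => ∑ i : Fin n, coordTerm μ remDeriv i t z :=
    measurable_sum_coordTerm measurable_remDeriv t
  have q4 : Measurable fun z => totalTerm μ (fun t (ω : Fin n → ℝ) =>
      ∑ i, farInd t (ω i)) hermOne t z :=
    measurable_totalTerm_right (Y := fun t (ω : Fin n → ℝ) => ∑ i, farInd t (ω i)) (by fun_prop)
      measurable_hermOne t
  have q5 : Measurable fun z => totalTerm μ (fun t (ω : Fin n → ℝ) =>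
      ∑ i, carrier μ t (ω i)) hermOne t z :=
    measurable_totalTerm_right (Y := fun t (ω : Fin n → ℝ) => ∑ i, carrier μ t (ω i)) (by fun_prop)
      measurable_hermOne t
  have q6 : Measurable fun z => ∑ i : Fin n, coordTerm μ (fun t a z => (1 - bigInd R a) * a
      * remDeriv t a z) i t z :=
    measurable_sum_coordTerm (b := fun t a z => (1 - bigInd R a) * a * remDeriv t a z) ms t
  have q7 : Measurable fun z => totalTerm μ (fun t (_ : Fin n → ℝ) =>
      n * farMeanModerate μ R t) hermOne t z :=
    measurable_totalTerm_right (Y := fun t (_ : Fin n → ℝ) => n * farMeanModerate μ R t) (by fun_prop)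
      measurable_hermOne t
  have hB0 : ∀ a, 0 ≤ 1 - bigInd R a := fun a => sub_nonneg.2 (bigInd_le_one R a)
  have b1 : l2norm Q (fun z => ∑ i : Fin n, coordTerm μ (remModerate R) i t z)
      ≤ n * (ε * ∫⁻ a, ENNReal.ofReal ((1 - bigInd R a) * (|a| * kappaModerate (t * a))) ∂μ) :=
    l2norm_coordTerm_le h t (measurable_remModerate R) (gaussNormSq_remModerate_le R t)
  have b2 : l2norm Q (fun z => totalTerm μ (fun t (ω : Fin n → ℝ) =>
      ∑ i, (1 - bigInd R (ω i)) * (farInd t (ω i) * ω i)) stdDensity t z)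
      ≤ ENNReal.ofReal (√n) * (∫⁻ a, ENNReal.ofReal ((1 - bigInd R a) * (farInd t a * a ^ 2)) ∂μ)
          ^ (1 / 2 : ℝ)
        + n * ∫⁻ a, ENNReal.ofReal ((1 - bigInd R a) * (|a| * farInd t a)) ∂μ := by
    refine (l2norm_totalTerm_le t (Y := fun t (ω : Fin n → ℝ) =>
      ∑ i, (1 - bigInd R (ω i)) * (farInd t (ω i) * ω i)) (by fun_prop)
      measurable_stdDensity gaussNormSq_stdDensity.le).trans ?_
    refine (l2norm_sum_coord_le n (c := fun a => (1 - bigInd R a) * (farInd t a * a))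
      (by fun_prop) ?_).trans (le_of_eq ?_)
    · have := integrable_weight_mul_sq h (w := fun a => (1 - bigInd R a) * farInd t a) (by fun_prop)
        (fun a => mul_nonneg (hB0 a) (farInd_nonneg t a))
        (fun a => mul_le_one₀ (by linarith [bigInd_nonneg R a]) (farInd_nonneg t a)
          (farInd_le_one t a))
      simpa only [mul_assoc] using this
    · congr 5
      · ext a; congr 1
        rcases farInd_cases t a with ⟨h1, -⟩ | ⟨h1, -⟩ <;>
          rcases bigInd_cases R a with ⟨h2, -⟩ | ⟨h2, -⟩ <;> simp [h1, h2]
      · ext a; congr 1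
        rw [abs_mul, abs_mul, abs_of_nonneg (farInd_nonneg t a), abs_of_nonneg (hB0 a)]; ring
  have b3 : l2norm Q (fun z => ∑ i : Fin n, coordTerm μ remDeriv i t z)
      ≤ n * (ε * ∫⁻ a, ENNReal.ofReal (kappaDeriv (t * a)) ∂μ) :=
    l2norm_coordTerm_le h t measurable_remDeriv (gaussNormSq_remDeriv_le t)
  have b4 : l2norm Q (fun z => totalTerm μ (fun t (ω : Fin n → ℝ) => ∑ i, farInd t (ω i))
      hermOne t z) ≤ ENNReal.ofReal (√n) * (∫⁻ a, ENNReal.ofReal (farInd t a) ∂μ) ^ (1 / 2 : ℝ)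
        + n * ∫⁻ a, ENNReal.ofReal (farInd t a) ∂μ := by
    refine (l2norm_totalTerm_le t (Y := fun t (ω : Fin n → ℝ) => ∑ i, farInd t (ω i))
      (by fun_prop) measurable_hermOne gaussNormSq_hermOne.le).trans ?_
    have e2 : ∀ a, farInd t a ^ 2 = farInd t a := fun a => by
      rcases farInd_cases t a with ⟨h1, -⟩ | ⟨h1, -⟩ <;> simp [h1]
    refine (l2norm_sum_coord_le n (c := farInd t) (by fun_prop) ?_).trans (le_of_eq ?_)
    · exact Integrable.of_bound (C := 1) (by fun_prop) (ae_of_all _ fun a => by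
        rw [e2, Real.norm_of_nonneg (farInd_nonneg t a)]; exact farInd_le_one t a)
    · simp only [e2, abs_of_nonneg (farInd_nonneg t _)]
  have b5 : l2norm Q (fun z => totalTerm μ (fun t (ω : Fin n → ℝ) => ∑ i, carrier μ t (ω i))
      hermOne t z) ≤ ENNReal.ofReal (√n) :=
    (l2norm_totalTerm_le t (Y := fun t (ω : Fin n → ℝ) => ∑ i, carrier μ t (ω i))
      (by fun_prop) measurable_hermOne gaussNormSq_hermOne.le).trans
      (l2norm_sum_carrier_le h n t)
  have b6 : l2norm Q (fun z => ∑ i : Fin n, coordTerm μ (fun t a z => (1 - bigInd R a) * a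
      * remDeriv t a z) i t z)
      ≤ n * (ε * ∫⁻ a, ENNReal.ofReal ((1 - bigInd R a) * (|a| * kappaDeriv (t * a))) ∂μ) := by
    refine l2norm_coordTerm_le h t ms fun a => ?_
    refine (gaussNormSq_mul_remDeriv_le _ t a).trans_eq ?_
    rw [abs_mul, abs_of_nonneg (hB0 a), mul_assoc]
  have b7 := (l2norm_totalTerm_const_le (μ := μ) n t (farMeanModerate μ R)).trans
    (mul_le_mul_right (enorm_farMeanModerate_le R t) (n : ℝ≥0∞))
  have hm3 : ‖(∫ a, a ^ 3 ∂μ) / 2 * t‖ₑ = ENNReal.ofReal (|∫ a, a ^ 3 ∂μ| / 2 * t) := by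
    rw [← ofReal_norm, Real.norm_eq_abs, abs_mul, abs_div, abs_of_nonneg ht, abs_two]
  have ht' : ‖t‖ₑ = ENNReal.ofReal t := by rw [← ofReal_norm, Real.norm_of_nonneg ht]
  unfold driftMain
  rw [hm3, ht']
  refine (l2norm_add_le (Measurable.aemeasurable (by fun_prop))
    (Measurable.aemeasurable (by fun_prop))).trans (add_le_add ?_ ?_)
  · refine (l2norm_add_le (Measurable.aemeasurable (by fun_prop))
      (Measurable.aemeasurable (by fun_prop))).trans (add_le_add ?_ ?_)
    · refine (l2norm_add_le q1.aemeasurable q2.aemeasurable).trans ((add_le_add b1 b2).trans ?_)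
      rw [add_comm (ENNReal.ofReal (√n) * _), ← add_assoc]
      gcongr
      refine (absorb_mean hε (by fun_prop) (fun a => mul_nonneg (hB0 a) (mul_nonneg (abs_nonneg a)
        (kappaModerate_nonneg _))) (fun a => mul_nonneg (hB0 a) (mul_nonneg (abs_nonneg a)
        (farInd_nonneg _ _)))).trans_eq ?_
      simp only [weightModerate, mul_add]
    · rw [l2norm_const_mul (Measurable.aemeasurable (by fun_prop))]
      gcongr
      refine (l2norm_add_le q3.aemeasurable q4.aemeasurable).trans ((add_le_add b3 b4).trans ?_)
      rw [add_comm (ENNReal.ofReal (√n) * _), ← add_assoc]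
      gcongr
      exact absorb_mean hε (by fun_prop) (fun a => kappaDeriv_nonneg _) (fun a => farInd_nonneg _ _)
  · rw [l2norm_const_mul (Measurable.aemeasurable (by fun_prop))]
    gcongr
    refine (l2norm_add_le (Measurable.aemeasurable (by fun_prop)) q7.aemeasurable).trans ?_
    refine (add_le_add ((l2norm_add_le q5.aemeasurable q6.aemeasurable).trans
      (add_le_add b5 b6)) b7).trans ?_
    rw [add_assoc]
    gcongr
    refine (absorb_mean hε (by fun_prop) (fun a => mul_nonneg (hB0 a) (mul_nonneg (abs_nonneg a)
        (kappaDeriv_nonneg _))) (fun a => mul_nonneg (hB0 a) (mul_nonneg (abs_nonneg a)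
        (farInd_nonneg _ _)))).trans_eq ?_
    simp only [weightDeriv, mul_add]

/-- Translates of φ have mass one, so in mean this term costs a first moment only. -/
theorem lintegral_totalTerm_stdDensity (t : ℝ) {Y : ℝ → (Fin n → ℝ) → ℝ}
    (hY : Measurable (Y t)) :
    ∫⁻ z, totalTerm μ Y stdDensity t z = ∫⁻ ω, ‖Y t ω‖ₑ ∂(iidLaw μ n) := by
  unfold totalTerm
  rw [lintegral_lintegral_swap (Measurable.aemeasurable (by fun_prop))]
  refine lintegral_congr fun ω => ?_
  rw [lintegral_const_mul _ (by fun_prop), lintegral_sub_right_eq_self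
    (fun z => ‖stdDensity z‖ₑ) (t * total ω)]
  have : ∀ z, ‖stdDensity z‖ₑ = ENNReal.ofReal (stdDensity z) := fun z => by
    rw [← ofReal_norm, Real.norm_of_nonneg (stdDensity_pos z).le]
  simp only [this, lintegral_stdDensity, mul_one]

/-- Bound in mean for the remaining part of the velocity. -/
theorem lintegral_driftRest_le (h : IsStdLaw μ) (n : ℕ) (R : ℝ) {t : ℝ} (ht : 0 ≤ t) :
    ∫⁻ z, driftRest μ n R t z
      ≤ n * (ENNReal.ofReal (Real.exp (t ^ 2 / 4)) * ∫⁻ a, ENNReal.ofReal (weightBig R t a) ∂μ)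
        + ENNReal.ofReal (|farThird μ R t| / 2 * t) * (ENNReal.ofReal (√n)
          + n * (ENNReal.ofReal (Real.exp (t ^ 2 / 4))
            * ∫⁻ a, ENNReal.ofReal (|a| * weightDeriv t a) ∂μ))
        + ENNReal.ofReal (|∫ a, a ^ 3 ∂μ| / 2 * t) * (n * (ENNReal.ofReal (Real.exp (t ^ 2 / 4))
            * ∫⁻ a, ENNReal.ofReal (bigInd R a * (|a| * weightDeriv t a)) ∂μ)) := by
  have hε := one_le_ofReal_exp t
  set ε := ENNReal.ofReal (Real.exp (t ^ 2 / 4))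
  have m2 := measurable_mul_remDeriv (c := fun a => a) (by fun_prop)
  have m3 := measurable_mul_remDeriv (c := fun a => bigInd R a * a) (by fun_prop)
  have q1 : Measurable fun z => ∑ i : Fin n, coordTerm μ (remBig R) i t z :=
    measurable_sum_coordTerm (measurable_remBig R) t
  have q2 : Measurable fun z => totalTerm μ (fun t (ω : Fin n → ℝ) =>
      ∑ i, bigInd R (ω i) * (farInd t (ω i) * ω i)) stdDensity t z :=
    measurable_totalTerm_right (Y := fun t (ω : Fin n → ℝ) =>
      ∑ i, bigInd R (ω i) * (farInd t (ω i) * ω i)) (by fun_prop)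
      measurable_stdDensity t
  have q3 : Measurable fun z => totalTerm μ (fun t (ω : Fin n → ℝ) =>
      ∑ i, carrier μ t (ω i)) hermOne t z :=
    measurable_totalTerm_right (Y := fun t (ω : Fin n → ℝ) => ∑ i, carrier μ t (ω i)) (by fun_prop)
      measurable_hermOne t
  have q4 : Measurable fun z => ∑ i : Fin n, coordTerm μ (fun t a z => a * remDeriv t a z) i t z :=
    measurable_sum_coordTerm (b := fun t a z => a * remDeriv t a z) m2 t
  have q5 : Measurable fun z => totalTerm μ (fun t (_ : Fin n → ℝ) =>
      n * farMean μ t) hermOne t z :=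
    measurable_totalTerm_right (Y := fun t (_ : Fin n → ℝ) => n * farMean μ t) (by fun_prop)
      measurable_hermOne t
  have q6 : Measurable fun z => ∑ i : Fin n, coordTerm μ (fun t a z => bigInd R a * a
      * remDeriv t a z) i t z :=
    measurable_sum_coordTerm (b := fun t a z => bigInd R a * a * remDeriv t a z) m3 t
  have q7 : Measurable fun z => totalTerm μ (fun t (_ : Fin n → ℝ) =>
      n * farMeanBig μ R t) hermOne t z :=
    measurable_totalTerm_right (Y := fun t (_ : Fin n → ℝ) => n * farMeanBig μ R t) (by fun_prop)
      measurable_hermOne t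
  -- f_t is a probability density, so any bound in L²(1/f_t) is also a bound in L¹.
  have l1 : ∀ {q : ℝ → ℝ≥0∞} {c : ℝ≥0∞}, Measurable q →
      l2norm (invWeight (smoothDensity μ n t)) q ≤ c → ∫⁻ z, q z ≤ c := fun hq hc =>
    (lintegral_le_l2norm_invWeight (measurable_smoothDensity t) (smoothDensity_pos t)
      (lintegral_smoothDensity t).le hq).trans hc
  have b1 := l1 q1 (l2norm_coordTerm_le h t (measurable_remBig R) (gaussNormSq_remBig_le R t))
  -- The gain of working in mean: the triangle inequality replaces the variance bound, and no second
  -- moment of the large far values is needed.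
  have b2 : ∫⁻ z, totalTerm μ (fun t (ω : Fin n → ℝ) =>
      ∑ i, bigInd R (ω i) * (farInd t (ω i) * ω i)) stdDensity t z
      ≤ n * ∫⁻ a, ENNReal.ofReal (bigInd R a * (|a| * farInd t a)) ∂μ := by
    rw [lintegral_totalTerm_stdDensity t (by fun_prop)]
    calc _ ≤ ∫⁻ ω : Fin n → ℝ, ∑ i, ENNReal.ofReal (bigInd R (ω i) * (|ω i| * farInd t (ω i)))
          ∂(iidLaw μ n) := by
          refine lintegral_mono fun ω => (enorm_sum_le _ _).trans_eq
            (Finset.sum_congr rfl fun i _ => ?_)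
          rw [← ofReal_norm, Real.norm_eq_abs, abs_mul, abs_mul,
            abs_of_nonneg (farInd_nonneg t _), abs_of_nonneg (bigInd_nonneg R _)]
          congr 1; ring
      _ = _ := by
          rw [lintegral_finsetSum _ fun i _ => by fun_prop]
          simp only [lintegral_coord (μ := μ) _ (by fun_prop : Measurable fun a =>
            ENNReal.ofReal (bigInd R a * (|a| * farInd t a)))]
          simp
  have b3 := l1 q3 ((l2norm_totalTerm_le t (Y := fun t (ω : Fin n → ℝ) => ∑ i, carrier μ t (ω i))
      (by fun_prop) measurable_hermOne gaussNormSq_hermOne.le).trans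
      (l2norm_sum_carrier_le h n t))
  have b4 := l1 q4 (l2norm_coordTerm_le h t m2 (fun a => gaussNormSq_mul_remDeriv_le a t a))
  have b5 := l1 q5 ((l2norm_totalTerm_const_le (μ := μ) n t (farMean μ)).trans
    (mul_le_mul_right (enorm_farMean_le t) (n : ℝ≥0∞)))
  have b6 : ∫⁻ z, ∑ i : Fin n, coordTerm μ (fun t a z => bigInd R a * a * remDeriv t a z) i t z
      ≤ n * (ε * ∫⁻ a, ENNReal.ofReal (bigInd R a * (|a| * kappaDeriv (t * a))) ∂μ) := by
    refine l1 q6 (l2norm_coordTerm_le h t m3 fun a => ?_)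
    refine (gaussNormSq_mul_remDeriv_le _ t a).trans_eq ?_
    rw [abs_mul, abs_of_nonneg (bigInd_nonneg R a), mul_assoc]
  have b7 := l1 q7 ((l2norm_totalTerm_const_le (μ := μ) n t (farMeanBig μ R)).trans
    (mul_le_mul_right (enorm_farMeanBig_le R t) (n : ℝ≥0∞)))
  have hm3 : ∀ c : ℝ, ‖c / 2 * t‖ₑ = ENNReal.ofReal (|c| / 2 * t) := fun c => by
    rw [← ofReal_norm, Real.norm_eq_abs, abs_mul, abs_div, abs_of_nonneg ht, abs_two]
  unfold driftRest
  rw [hm3, hm3, lintegral_add_left (by fun_prop), lintegral_add_left (by fun_prop),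
    lintegral_add_left q1, lintegral_const_mul _ (by fun_prop), lintegral_const_mul _ (by fun_prop),
    lintegral_add_left (by fun_prop), lintegral_add_left q3, lintegral_add_left q6]
  refine add_le_add (add_le_add ?_ ?_) ?_
  · refine (add_le_add b1 b2).trans ((absorb_mean hε (by fun_prop)
      (fun a => mul_nonneg (bigInd_nonneg R a) (mul_nonneg (abs_nonneg a) (kappaBig_nonneg _)))
      (fun a => mul_nonneg (bigInd_nonneg R a) (mul_nonneg (abs_nonneg a)
        (farInd_nonneg _ _)))).trans_eq ?_)
    simp only [weightBig, mul_add]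
  · refine mul_le_mul_right ?_ _
    refine (add_le_add (add_le_add b3 b4) b5).trans ?_
    rw [add_assoc]
    gcongr
    refine (absorb_mean hε (by fun_prop) (fun a => mul_nonneg (abs_nonneg a)
      (kappaDeriv_nonneg _)) (fun a => mul_nonneg (abs_nonneg a) (farInd_nonneg _ _))).trans_eq ?_
    simp only [weightDeriv, mul_add]
  · gcongr
    refine (add_le_add b6 b7).trans ((absorb_mean hε (by fun_prop)
      (fun a => mul_nonneg (bigInd_nonneg R a) (mul_nonneg (abs_nonneg a) (kappaDeriv_nonneg _)))
      (fun a => mul_nonneg (bigInd_nonneg R a) (mul_nonneg (abs_nonneg a)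
        (farInd_nonneg _ _)))).trans_eq ?_)
    simp only [weightDeriv, mul_add]

end StaticBounds


/-! ### Time integrals of the weights of a single value -/

section TimeIntegrals

theorem setLIntegral_le_of_hasDerivAt {f h H : ℝ → ℝ} {α β : ℝ} (hab : α ≤ β)
    (hf : ∀ t ∈ Set.Ioc α β, f t ≤ h t) (h0 : ∀ t ∈ Set.Ioc α β, 0 ≤ h t)
    (hc : ContinuousOn h (Set.Icc α β)) (hH : ∀ t ∈ Set.Icc α β, HasDerivAt H (h t) t) :
    ∫⁻ t in Set.Ioc α β, ENNReal.ofReal (f t) ≤ ENNReal.ofReal (H β - H α) := by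
  have hi : IntervalIntegrable h volume α β := by
    apply ContinuousOn.intervalIntegrable; rwa [Set.uIcc_of_le hab]
  have hI := intervalIntegral.integral_eq_sub_of_hasDerivAt
    (fun t ht => hH t (by rwa [Set.uIcc_of_le hab] at ht)) hi
  rw [← hI, intervalIntegral.integral_of_le hab,
    ofReal_integral_eq_lintegral_ofReal ((intervalIntegrable_iff_integrableOn_Ioc_of_le hab).1 hi)
      ((ae_restrict_iff' measurableSet_Ioc).2 (ae_of_all _ h0))]
  exact setLIntegral_mono' measurableSet_Ioc fun t ht => ENNReal.ofReal_le_ofReal (hf t ht)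

theorem setLIntegral_Ioc_split (f : ℝ → ℝ≥0∞) {α c β : ℝ} (h1 : α ≤ c) (h2 : c ≤ β) :
    ∫⁻ t in Set.Ioc α β, f t = (∫⁻ t in Set.Ioc α c, f t) + ∫⁻ t in Set.Ioc c β, f t := by
  rw [← Set.Ioc_union_Ioc_eq_Ioc h1 h2, lintegral_union measurableSet_Ioc]
  exact Set.disjoint_left.2 fun x hx hx' => not_lt.2 hx.2 hx'.1

theorem hasDerivAt_inv_const_mul {c t : ℝ} (ht : t ≠ 0) :
    HasDerivAt (fun t : ℝ => -(c / t)) (c / t ^ 2) t := by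
  have := ((hasDerivAt_inv ht).const_mul c).neg
  simpa [div_eq_mul_inv, Pi.neg_def] using this

theorem hasDerivAt_inv_sq_const_mul {c t : ℝ} (ht : t ≠ 0) :
    HasDerivAt (fun t : ℝ => -(c / (2 * t ^ 2))) (c / t ^ 3) t := by
  have h := ((hasDerivAt_pow 2 t).fun_inv (pow_ne_zero 2 ht)).const_mul (-(c / 2))
  have e : (fun t : ℝ => -(c / (2 * t ^ 2))) = fun t => -(c / 2) * (t ^ 2)⁻¹ := by
    ext t; ring
  rw [e]
  refine h.congr_deriv ?_
  field_simp
  norm_num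

theorem le_two_of_mem {b t : ℝ} (hb : 0 < b) (h0 : 0 ≤ t) (ht : t ≤ 2 / b) : |t * b| ≤ 2 := by
  rw [abs_of_nonneg (by positivity)]; exact (le_div_iff₀ hb).1 ht

theorem two_lt_of_mem {b t : ℝ} (hb : 0 < b) (ht : 2 / b < t) : 2 < |t * b| := by
  have h0 : 0 < t := (by positivity : 0 < 2 / b).trans ht
  rw [abs_of_nonneg (by positivity)]; exact (div_lt_iff₀ hb).1 ht

/-- Cut at t = 2/b. Before it, the average over (0, S] is at most b² (1.2248 + 4 · 0.35/3 + 16 ·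
0.018) < 1.98 b². After it, y = tb > 2 gives 1.5 y + 1 ≤ y², so the integrand is at most b². -/
theorem setLIntegral_weightDeriv_pos {b T : ℝ} (hb : 0 < b) (hT : 0 < T) :
    ∫⁻ t in Set.Ioc 0 T, ENNReal.ofReal ((t ^ 2)⁻¹ * weightDeriv t b)
      ≤ ENNReal.ofReal (1.98 * b ^ 2 * T) := by
  have near : ∀ S, 0 ≤ S → S ≤ 2 / b →
      ∫⁻ t in Set.Ioc 0 S, ENNReal.ofReal ((t ^ 2)⁻¹ * weightDeriv t b)
      ≤ ENNReal.ofReal (b ^ 2 * (1.2248 * S + 0.35 / 3 * b ^ 2 * S ^ 3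
        + 0.018 * b ^ 4 * S ^ 5)) := fun S hS hS2 => by
    have := setLIntegral_le_of_hasDerivAt hS (f := fun t => (t ^ 2)⁻¹ * weightDeriv t b)
      (h := fun t => b ^ 2 * (1.2248 + 0.35 * b ^ 2 * t ^ 2 + 0.09 * b ^ 4 * t ^ 4))
      (H := fun t => b ^ 2 * (1.2248 * t + 0.35 / 3 * b ^ 2 * t ^ 3
        + 0.018 * b ^ 4 * t ^ 5)) ?_ (fun t _ => by positivity) (by fun_prop) ?_
    · simpa using this
    · intro t ht
      have h2 := le_two_of_mem hb ht.1.le (ht.2.trans hS2)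
      have ht0 := ht.1
      simp only [weightDeriv, kappaDeriv, farInd, if_pos h2, if_neg (not_lt.2 h2)]
      apply le_of_eq
      field_simp
      ring
    · intro t _
      have h1 := ((((hasDerivAt_id t).const_mul 1.2248).add
        ((hasDerivAt_pow 3 t).const_mul (0.35 / 3 * b ^ 2))).add
        ((hasDerivAt_pow 5 t).const_mul (0.018 * b ^ 4))).const_mul (b ^ 2)
      refine h1.congr_deriv ?_
      simp only [Nat.reduceSub, Nat.cast_ofNat]; ring
  rcases le_or_gt T (2 / b) with hTb | hTb
  · refine (near T hT.le hTb).trans (ENNReal.ofReal_le_ofReal ?_)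
    have hy : T * b ≤ 2 := (le_div_iff₀ hb).1 hTb
    have h1 : (T * b) ^ 2 ≤ 4 := by nlinarith [mul_pos hT hb]
    have h2 : (T * b) ^ 4 ≤ 16 := by nlinarith [sq_nonneg (T * b)]
    calc _ = b ^ 2 * T * (1.2248 + 0.35 / 3 * (T * b) ^ 2 + 0.018 * (T * b) ^ 4) := by ring
      _ ≤ b ^ 2 * T * 1.98 := by gcongr; linarith
      _ = _ := by ring
  · have hc : 0 < 2 / b := by positivity
    rw [setLIntegral_Ioc_split _ hc.le hTb.le]
    have far : ∫⁻ t in Set.Ioc (2 / b) T, ENNReal.ofReal ((t ^ 2)⁻¹ * weightDeriv t b)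
        ≤ ENNReal.ofReal (b ^ 2 * T - b ^ 2 * (2 / b)) := by
      refine setLIntegral_le_of_hasDerivAt hTb.le (h := fun _ => b ^ 2) ?_
        (fun t _ => by positivity) (by fun_prop) (H := fun t => b ^ 2 * t) ?_
      · intro t ht
        have h2 := two_lt_of_mem hb ht.1
        have ht0 : 0 < t := hc.trans ht.1
        simp only [weightDeriv, kappaDeriv, farInd, if_neg (not_le.2 h2), if_pos h2]
        rw [inv_mul_le_iff₀ (by positivity), ← mul_pow, ← sq_abs (t * b)]
        nlinarith
      · intro t _
        simpa using (hasDerivAt_id t).const_mul (b ^ 2)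
    refine (add_le_add (near _ hc.le le_rfl) far).trans ?_
    rw [← ENNReal.ofReal_add (by positivity)
      (by rw [← mul_sub]; exact mul_nonneg (by positivity) (by linarith))]
    apply ENNReal.ofReal_le_ofReal
    have hy : 2 < T * b := (div_lt_iff₀ hb).1 hTb
    have e : b ^ 2 * (1.2248 * (2 / b) + 0.35 / 3 * b ^ 2 * (2 / b) ^ 3
        + 0.018 * b ^ 4 * (2 / b) ^ 5) + (b ^ 2 * T - b ^ 2 * (2 / b))
        = b * (1.2248 * 2 + 0.35 / 3 * 8 + 0.018 * 32 + T * b - 2) := by field_simp; ring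
    rw [e]
    calc _ ≤ b * (1.98 * (T * b)) := by gcongr; linarith
      _ = _ := by ring

/-- Here y = Tb: 1.0822 y³ comes from times before 2/b and the bracket from later times. After
division by y the inequality is the positivity of a cubic whose minimum on y > 2 is near 2.474,
where it is still positive. -/
theorem moderate_upper {y : ℝ} (hy : 2 < y) :
    1.0822 * y ^ 3 + (0.1415 * y ^ 4 - 0.884 * y ^ 2 - 0.889 * y - y ^ 2 / 2.24
      + y ^ 3 * (0.442 - 0.283 + 0.22225) + y ^ 4 / 8.96) ≤ 0.575 * y ^ 4 := by
  have key : 0 ≤ 0.32189 * y ^ 3 - 1.46345 * y ^ 2 + 1.33042 * y + 0.889 := by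
    nlinarith [mul_nonneg (by linarith : 0 ≤ y - 2) (sq_nonneg (y - 2.474)),
      sq_nonneg (y - 2.474)]
  have h1 : 0 ≤ y * (0.32189 * y ^ 3 - 1.46345 * y ^ 2 + 1.33042 * y + 0.889) :=
    mul_nonneg (by linarith) key
  have h2 := pow_pos (by linarith : 0 < y) 4
  have h3 := pow_pos (by linarith : 0 < y) 2
  ring_nf at h1 ⊢
  linarith

/-- The increment of the primitive vanishes when T = 2/b, which explains the factor y - 2. -/
theorem moderate_increment_nonneg {y : ℝ} (hy : 2 < y) :
    0 ≤ 0.1415 * y ^ 4 - 0.884 * y ^ 2 - 0.889 * y - y ^ 2 / 2.24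
      + y ^ 3 * (0.442 - 0.283 + 0.22225) + y ^ 4 / 8.96 := by
  have e : 0.1415 * y ^ 4 - 0.884 * y ^ 2 - 0.889 * y - y ^ 2 / 2.24
      + y ^ 3 * (0.442 - 0.283 + 0.22225) + y ^ 4 / 8.96
      = y * (y - 2) * ((0.1415 + 1 / 8.96) * y ^ 2 + (0.38125 + 2 * (0.1415 + 1 / 8.96)) * y
        + 0.4445) := by ring
  rw [e]
  have := mul_pos (by linarith : 0 < y) (by linarith : 0 < y - 2)
  positivity

/-- The summand with T / 1.12 comes from splitting the square root of the far second moment, and is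
integrated together with the remainder so that a single constant covers both. The bound is
proportional to b⁴ T, which is why only moderate values are treated in this way. -/
theorem setLIntegral_weightModerate_pos {b T : ℝ} (hb : 0 < b) (hT : 0 < T) :
    ∫⁻ t in Set.Ioc 0 T, ENNReal.ofReal ((t ^ 3)⁻¹ * (b * (kappaModerate (t * b) + farInd t b))
        + T / 1.12 * (t ^ 3)⁻¹ * (farInd t b * b ^ 2))
      ≤ ENNReal.ofReal (0.575 * b ^ 4 * T) := by
  have near : ∀ S, 0 ≤ S → S ≤ 2 / b →
      ∫⁻ t in Set.Ioc 0 S, ENNReal.ofReal ((t ^ 3)⁻¹ * (b * (kappaModerate (t * b) + farInd t b))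
        + T / 1.12 * (t ^ 3)⁻¹ * (farInd t b * b ^ 2))
      ≤ ENNReal.ofReal (b ^ 4 * (0.4083 * S + 0.0332 * b ^ 2 * S ^ 3)) := fun S hS hS2 => by
    have := setLIntegral_le_of_hasDerivAt hS
      (f := fun t => (t ^ 3)⁻¹ * (b * (kappaModerate (t * b) + farInd t b))
        + T / 1.12 * (t ^ 3)⁻¹ * (farInd t b * b ^ 2))
      (h := fun t => b ^ 4 * (0.4083 + 0.0996 * b ^ 2 * t ^ 2))
      (H := fun t => b ^ 4 * (0.4083 * t + 0.0332 * b ^ 2 * t ^ 3)) ?_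
      (fun t _ => by positivity) (by fun_prop) ?_
    · simpa using this
    · intro t ht
      have h2 := le_two_of_mem hb ht.1.le (ht.2.trans hS2)
      have ht0 := ht.1
      simp only [kappaModerate, farInd, if_pos h2, if_neg (not_lt.2 h2)]
      rw [abs_of_pos (mul_pos ht0 hb)]
      apply le_of_eq
      field_simp
      ring
    · intro t _
      have h1 := (((hasDerivAt_id t).const_mul 0.4083).add
        ((hasDerivAt_pow 3 t).const_mul (0.0332 * b ^ 2))).const_mul (b ^ 4)
      refine h1.congr_deriv ?_
      simp only [Nat.reduceSub, Nat.cast_ofNat]; ring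
  rcases le_or_gt T (2 / b) with hTb | hTb
  · refine (near T hT.le hTb).trans (ENNReal.ofReal_le_ofReal ?_)
    have hy : T * b ≤ 2 := (le_div_iff₀ hb).1 hTb
    have h1 : (T * b) ^ 2 ≤ 4 := by nlinarith [mul_pos hT hb]
    calc _ = b ^ 4 * T * (0.4083 + 0.0332 * (T * b) ^ 2) := by ring
      _ ≤ b ^ 4 * T * 0.575 := by gcongr; linarith
      _ = _ := by ring
  · have hc : 0 < 2 / b := by positivity
    rw [setLIntegral_Ioc_split _ hc.le hTb.le]
    set K : ℝ → ℝ := fun t => 0.1415 * b ^ 4 * t + -(0.884 * b ^ 2 / t)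
      + -((1.778 * b + T / 1.12 * b ^ 2) / (2 * t ^ 2)) with hK
    have far : ∫⁻ t in Set.Ioc (2 / b) T, ENNReal.ofReal
        ((t ^ 3)⁻¹ * (b * (kappaModerate (t * b) + farInd t b))
        + T / 1.12 * (t ^ 3)⁻¹ * (farInd t b * b ^ 2)) ≤ ENNReal.ofReal (K T - K (2 / b)) := by
      refine setLIntegral_le_of_hasDerivAt hTb.le (h := fun t => 0.1415 * b ^ 4
        + 0.884 * b ^ 2 / t ^ 2 + (1.778 * b + T / 1.12 * b ^ 2) / t ^ 3) ?_
        (fun t ht => ?_) ?_ ?_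
      · intro t ht
        have h2 := two_lt_of_mem hb ht.1
        have ht0 : 0 < t := hc.trans ht.1
        simp only [kappaModerate, farInd, if_neg (not_le.2 h2), if_pos h2]
        rw [abs_of_pos (mul_pos ht0 hb)]
        apply le_of_eq
        field_simp
        ring
      · have ht0 : 0 < t := hc.trans ht.1
        positivity
      · have : ∀ t ∈ Set.Icc (2 / b) T, t ≠ 0 := fun t ht => (hc.trans_le ht.1).ne'
        refine ContinuousOn.add (ContinuousOn.add continuousOn_const (ContinuousOn.div
          continuousOn_const (by fun_prop) ?_)) (ContinuousOn.div continuousOn_const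
          (by fun_prop) ?_)
        · exact fun t ht => pow_ne_zero _ (this t ht)
        · exact fun t ht => pow_ne_zero _ (this t ht)
      · intro t ht
        have ht0 : t ≠ 0 := (hc.trans_le ht.1).ne'
        have h1 := (((hasDerivAt_id t).const_mul (0.1415 * b ^ 4)).add
          (hasDerivAt_inv_const_mul (c := 0.884 * b ^ 2) ht0)).add
          (hasDerivAt_inv_sq_const_mul (c := 1.778 * b + T / 1.12 * b ^ 2) ht0)
        refine h1.congr_deriv ?_
        ring
    refine (add_le_add (near _ hc.le le_rfl) far).trans ?_
    have hy : 2 < T * b := (div_lt_iff₀ hb).1 hTb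
    -- Both sides are homogeneous, so after multiplication by T³ only y = Tb remains.
    obtain ⟨y, hyd⟩ : ∃ y, y = T * b := ⟨_, rfl⟩
    have hb' : b = y / T := by rw [hyd]; field_simp
    have hy2 : 2 < y := hyd ▸ hy
    have e1 : K T - K (2 / b) = (0.1415 * y ^ 4 - 0.884 * y ^ 2 - 0.889 * y - y ^ 2 / 2.24
        + y ^ 3 * (0.442 - 0.283 + 0.22225) + y ^ 4 / 8.96) / T ^ 3 := by
      simp only [hK, hb']
      field_simp
      ring
    have e2 : b ^ 4 * (0.4083 * (2 / b) + 0.0332 * b ^ 2 * (2 / b) ^ 3)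
        = 1.0822 * y ^ 3 / T ^ 3 := by
      rw [hb']; field_simp; ring
    have e3 : 0.575 * b ^ 4 * T = 0.575 * y ^ 4 / T ^ 3 := by
      rw [hb']; field_simp
    rw [e1, e2, e3, ← ENNReal.ofReal_add (by positivity), ← add_div]
    · apply ENNReal.ofReal_le_ofReal
      gcongr
      linarith [moderate_upper hy2]
    · exact div_nonneg (moderate_increment_nonneg hy2) (by positivity)

/-- After 2/b the integrand decays at least like t⁻², so the bound does not depend on T and is of
order b³. The constant is 1.0822 + 1.1181/2 + 1/8, rounded up. -/
theorem setLIntegral_weightBig_pos {b T : ℝ} (hb : 0 < b) (hT : 0 < T) :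
    ∫⁻ t in Set.Ioc 0 T, ENNReal.ofReal ((t ^ 3)⁻¹ * (b * (kappaBig (t * b) + farInd t b)))
      ≤ ENNReal.ofReal (1.7663 * b ^ 3) := by
  have near : ∀ S, 0 ≤ S → S ≤ 2 / b →
      ∫⁻ t in Set.Ioc 0 S, ENNReal.ofReal ((t ^ 3)⁻¹ * (b * (kappaBig (t * b) + farInd t b)))
      ≤ ENNReal.ofReal (b ^ 4 * (0.4083 * S + 0.0332 * b ^ 2 * S ^ 3)) := fun S hS hS2 => by
    have := setLIntegral_le_of_hasDerivAt hS
      (f := fun t => (t ^ 3)⁻¹ * (b * (kappaBig (t * b) + farInd t b)))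
      (h := fun t => b ^ 4 * (0.4083 + 0.0996 * b ^ 2 * t ^ 2))
      (H := fun t => b ^ 4 * (0.4083 * t + 0.0332 * b ^ 2 * t ^ 3)) ?_
      (fun t _ => by positivity) (by fun_prop) ?_
    · simpa using this
    · intro t ht
      have h2 := le_two_of_mem hb ht.1.le (ht.2.trans hS2)
      have ht0 := ht.1
      simp only [kappaBig, farInd, if_pos h2, if_neg (not_lt.2 h2)]
      rw [abs_of_pos (mul_pos ht0 hb)]
      apply le_of_eq
      field_simp
      ring
    · intro t _
      have h1 := (((hasDerivAt_id t).const_mul 0.4083).add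
        ((hasDerivAt_pow 3 t).const_mul (0.0332 * b ^ 2))).const_mul (b ^ 4)
      refine h1.congr_deriv ?_
      simp only [Nat.reduceSub, Nat.cast_ofNat]; ring
  have e2 : b ^ 4 * (0.4083 * (2 / b) + 0.0332 * b ^ 2 * (2 / b) ^ 3) = 1.0822 * b ^ 3 := by
    field_simp; ring
  rcases le_or_gt T (2 / b) with hTb | hTb
  · refine (near T hT.le hTb).trans (ENNReal.ofReal_le_ofReal ?_)
    calc _ ≤ b ^ 4 * (0.4083 * (2 / b) + 0.0332 * b ^ 2 * (2 / b) ^ 3) := by gcongr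
      _ = 1.0822 * b ^ 3 := e2
      _ ≤ _ := by gcongr; norm_num
  · have hc : 0 < 2 / b := by positivity
    rw [setLIntegral_Ioc_split _ hc.le hTb.le]
    set K : ℝ → ℝ := fun t => -(1.1181 * b ^ 2 / t) + -(b / (2 * t ^ 2)) with hK
    have far : ∫⁻ t in Set.Ioc (2 / b) T, ENNReal.ofReal
        ((t ^ 3)⁻¹ * (b * (kappaBig (t * b) + farInd t b))) ≤ ENNReal.ofReal (K T - K (2 / b)) := by
      refine setLIntegral_le_of_hasDerivAt hTb.le (h := fun t => 1.1181 * b ^ 2 / t ^ 2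
        + b / t ^ 3) ?_ (fun t ht => ?_) ?_ ?_
      · intro t ht
        have h2 := two_lt_of_mem hb ht.1
        have ht0 : 0 < t := hc.trans ht.1
        simp only [kappaBig, farInd, if_neg (not_le.2 h2), if_pos h2]
        rw [abs_of_pos (mul_pos ht0 hb)]
        apply le_of_eq
        field_simp
      · have ht0 : 0 < t := hc.trans ht.1
        positivity
      · have : ∀ t ∈ Set.Icc (2 / b) T, t ≠ 0 := fun t ht => (hc.trans_le ht.1).ne'
        refine ContinuousOn.add (ContinuousOn.div continuousOn_const (by fun_prop) ?_)
          (ContinuousOn.div continuousOn_const (by fun_prop) ?_)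
        · exact fun t ht => pow_ne_zero _ (this t ht)
        · exact fun t ht => pow_ne_zero _ (this t ht)
      · intro t ht
        have ht0 : t ≠ 0 := (hc.trans_le ht.1).ne'
        exact (hasDerivAt_inv_const_mul (c := 1.1181 * b ^ 2) ht0).add
          (hasDerivAt_inv_sq_const_mul (c := b) ht0)
    refine (add_le_add (near _ hc.le le_rfl) far).trans ?_
    have h1 : K T ≤ 0 := by
      have h1 : 0 ≤ 1.1181 * b ^ 2 / T := by positivity
      have h2 : 0 ≤ b / (2 * T ^ 2) := by positivity
      simp only [hK]; linarith
    have h2 : K (2 / b) = -(0.68405 * b ^ 3) := by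
      simp only [hK]; field_simp; ring
    rw [e2]
    refine (add_le_add_right (ENNReal.ofReal_le_ofReal (by linarith :
      K T - K (2 / b) ≤ 0.68405 * b ^ 3)) _).trans ?_
    rw [← ENNReal.ofReal_add (by positivity) (by positivity)]
    apply ENNReal.ofReal_le_ofReal
    have : 0 < b ^ 3 := by positivity
    linarith

end TimeIntegrals


/-! ### Integration of the velocity bounds in time, uniformly in n -/

section TimeAverage

variable {μ : Measure ℝ} [IsProbabilityMeasure μ]

theorem farInd_abs (t a : ℝ) : farInd t |a| = farInd t a := by simp [farInd, abs_mul]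

theorem kappaModerate_abs (t a : ℝ) : kappaModerate (t * |a|) = kappaModerate (t * a) := by
  simp [kappaModerate, abs_mul, mul_pow]

theorem kappaBig_abs (t a : ℝ) : kappaBig (t * |a|) = kappaBig (t * a) := by
  simp [kappaBig, abs_mul, mul_pow]

theorem kappaDeriv_abs (t a : ℝ) : kappaDeriv (t * |a|) = kappaDeriv (t * a) := by
  have h4 : |a| ^ 4 = a ^ 4 := Even.pow_abs (by decide) a
  simp [kappaDeriv, abs_mul, mul_pow, h4]

theorem setLIntegral_weightDeriv_le (a : ℝ) {T : ℝ} (hT : 0 < T) :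
    ∫⁻ t in Set.Ioc 0 T, ENNReal.ofReal ((t ^ 2)⁻¹ * weightDeriv t a)
      ≤ ENNReal.ofReal (1.98 * a ^ 2 * T) := by
  rcases eq_or_ne a 0 with rfl | ha
  · have h0 : ∀ t, weightDeriv t 0 = 0 := fun t => by simp [weightDeriv, kappaDeriv, farInd]
    simp [h0]
  · have := setLIntegral_weightDeriv_pos (abs_pos.2 ha) hT
    simpa only [weightDeriv, kappaDeriv_abs, farInd_abs, sq_abs] using this

theorem setLIntegral_weightModerate_le (a : ℝ) {T : ℝ} (hT : 0 < T) :
    ∫⁻ t in Set.Ioc 0 T, ENNReal.ofReal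
      ((t ^ 3)⁻¹ * (|a| * (kappaModerate (t * a) + farInd t a))
        + T / 1.12 * (t ^ 3)⁻¹ * (farInd t a * a ^ 2))
      ≤ ENNReal.ofReal (0.575 * a ^ 4 * T) := by
  rcases eq_or_ne a 0 with rfl | ha
  · simp
  · have := setLIntegral_weightModerate_pos (abs_pos.2 ha) hT
    have h4 : |a| ^ 4 = a ^ 4 := Even.pow_abs (by decide) a
    simpa only [kappaModerate_abs, farInd_abs, sq_abs, h4] using this

theorem setLIntegral_weightBig_le (a : ℝ) {T : ℝ} (hT : 0 < T) :
    ∫⁻ t in Set.Ioc 0 T, ENNReal.ofReal ((t ^ 3)⁻¹ * (|a| * (kappaBig (t * a) + farInd t a)))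
      ≤ ENNReal.ofReal (1.7663 * |a| ^ 3) := by
  rcases eq_or_ne a 0 with rfl | ha
  · simp
  · have := setLIntegral_weightBig_pos (abs_pos.2 ha) hT
    simpa only [kappaBig_abs, farInd_abs] using this

/-- The time weight of the flow. -/
noncomputable def speed (n : ℕ) (t : ℝ) : ℝ := √n / √(1 + n * t ^ 2) ^ 3

theorem speed_nonneg (n : ℕ) (t : ℝ) : 0 ≤ speed n t := by unfold speed; positivity

theorem one_le_sqrt_add (n : ℕ) (t : ℝ) : 1 ≤ √(1 + n * t ^ 2) := by
  rw [Real.one_le_sqrt]; have : 0 ≤ n * t ^ 2 := by positivity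
  linarith

/-- Cube √n t ≤ √(1 + n t²). This removes n from all contributions of order n. -/
theorem speed_mul_nat_le (n : ℕ) {t : ℝ} (ht : 0 < t) :
    ENNReal.ofReal (speed n t) * n ≤ ENNReal.ofReal ((t ^ 3)⁻¹) := by
  rw [← ENNReal.ofReal_natCast, ← ENNReal.ofReal_mul (speed_nonneg n t)]
  apply ENNReal.ofReal_le_ofReal
  have hr := one_le_sqrt_add n t
  have h1 : √n * t ≤ √(1 + n * t ^ 2) := by
    apply Real.le_sqrt_of_sq_le
    rw [mul_pow, Real.sq_sqrt n.cast_nonneg]; linarith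
  rw [speed, div_mul_eq_mul_div, div_le_iff₀ (by positivity), ← div_eq_inv_mul,
    le_div_iff₀ (by positivity)]
  calc √n * n * t ^ 3 = (√n * t) ^ 3 := by
        rw [mul_pow, pow_succ (√(n : ℝ)), Real.sq_sqrt n.cast_nonneg]; ring
    _ ≤ _ := by gcongr

theorem speed_mul_sqrt (n : ℕ) (t : ℝ) :
    ENNReal.ofReal (speed n t) * ENNReal.ofReal (√n)
      = ENNReal.ofReal (n / √(1 + n * t ^ 2) ^ 3) := by
  rw [← ENNReal.ofReal_mul (speed_nonneg n t), speed, div_mul_eq_mul_div,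
    Real.mul_self_sqrt n.cast_nonneg]

/-- Arithmetic-geometric mean: c √X ≤ p + q X when c² ≤ 4pq. It makes a square root of an
expectation linear, so that time and expectation can be exchanged. -/
theorem ofReal_mul_rpow_half_le {c p q : ℝ} (hc : 0 ≤ c) (hp : 0 ≤ p) (hq : 0 < q)
    (h : c ^ 2 ≤ 4 * p * q) (X : ℝ≥0∞) :
    ENNReal.ofReal c * X ^ (1 / 2 : ℝ) ≤ ENNReal.ofReal p + ENNReal.ofReal q * X := by
  rcases eq_or_ne X ⊤ with rfl | hX
  · rw [ENNReal.mul_top (by simpa using hq)]; simp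
  · obtain ⟨x, hx, rfl⟩ : ∃ x : ℝ, 0 ≤ x ∧ X = ENNReal.ofReal x :=
      ⟨X.toReal, ENNReal.toReal_nonneg, (ENNReal.ofReal_toReal hX).symm⟩
    rw [ENNReal.ofReal_rpow_of_nonneg hx (by norm_num), ← ENNReal.ofReal_mul hc,
      ← ENNReal.ofReal_mul hq.le, ← ENNReal.ofReal_add hp (by positivity), ← Real.sqrt_eq_rpow]
    apply ENNReal.ofReal_le_ofReal
    apply abs_le_of_sq_le_sq' _ (by positivity) |>.2
    rw [mul_pow, Real.sq_sqrt hx]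
    nlinarith [sq_nonneg (p - q * x), mul_le_mul_of_nonneg_right h hx]

omit [IsProbabilityMeasure μ] in
theorem lintegral_ofReal_const_mul {c : ℝ} (hc : 0 ≤ c) (f : ℝ → ℝ) :
    ENNReal.ofReal c * ∫⁻ a, ENNReal.ofReal (f a) ∂μ = ∫⁻ a, ENNReal.ofReal (c * f a) ∂μ := by
  rw [← lintegral_const_mul' _ _ ENNReal.ofReal_ne_top]
  simp only [ENNReal.ofReal_mul hc]

theorem ofReal_exp_mono {t T : ℝ} (ht : 0 < t) (htT : t ≤ T) :
    ENNReal.ofReal (Real.exp (t ^ 2 / 4)) ≤ ENNReal.ofReal (Real.exp (T ^ 2 / 4)) := by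
  apply ENNReal.ofReal_le_ofReal; gcongr

omit [IsProbabilityMeasure μ] in
theorem speed_mul_coord_le (n : ℕ) {t T : ℝ} (ht : 0 < t) (htT : t ≤ T) (f : ℝ → ℝ) :
    ENNReal.ofReal (speed n t) * (n * (ENNReal.ofReal (Real.exp (t ^ 2 / 4))
      * ∫⁻ a, ENNReal.ofReal (f a) ∂μ)) ≤ ENNReal.ofReal (Real.exp (T ^ 2 / 4))
      * ∫⁻ a, ENNReal.ofReal ((t ^ 3)⁻¹ * f a) ∂μ := by
  have hε := ofReal_exp_mono ht htT
  rw [← lintegral_ofReal_const_mul (by positivity)]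
  calc _ = (ENNReal.ofReal (speed n t) * n) * (ENNReal.ofReal (Real.exp (t ^ 2 / 4))
        * ∫⁻ a, ENNReal.ofReal (f a) ∂μ) := by ring
    _ ≤ ENNReal.ofReal ((t ^ 3)⁻¹) * (ENNReal.ofReal (Real.exp (T ^ 2 / 4))
        * ∫⁻ a, ENNReal.ofReal (f a) ∂μ) := by
        gcongr; exact speed_mul_nat_le n ht
    _ = _ := by ring

omit [IsProbabilityMeasure μ] in
theorem speed_mul_time_coord_le (n : ℕ) {t T : ℝ} (ht : 0 < t) (htT : t ≤ T) (f : ℝ → ℝ) :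
    ENNReal.ofReal (speed n t) * (ENNReal.ofReal t * (n * (ENNReal.ofReal (Real.exp (t ^ 2 / 4))
      * ∫⁻ a, ENNReal.ofReal (f a) ∂μ))) ≤ ENNReal.ofReal (Real.exp (T ^ 2 / 4))
      * ∫⁻ a, ENNReal.ofReal ((t ^ 2)⁻¹ * f a) ∂μ := by
  have h := mul_le_mul_right (speed_mul_coord_le (μ := μ) n ht htT f) (ENNReal.ofReal t)
  calc _ = ENNReal.ofReal t * (ENNReal.ofReal (speed n t) * (n * (ENNReal.ofReal
        (Real.exp (t ^ 2 / 4)) * ∫⁻ a, ENNReal.ofReal (f a) ∂μ))) := by ring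
    _ ≤ _ := h
    _ = ENNReal.ofReal (Real.exp (T ^ 2 / 4))
        * (ENNReal.ofReal t * ∫⁻ a, ENNReal.ofReal ((t ^ 3)⁻¹ * f a) ∂μ) := by ring
    _ = _ := by
        rw [lintegral_ofReal_const_mul ht.le]
        congr 3; ext a; congr 1; field_simp

-- Chebyshev's inequality with unit variance. Negative t are set aside because `ENNReal.ofReal (t /
-- 2)` would be 0 there.
omit [IsProbabilityMeasure μ] in
theorem lintegral_farInd_le (h : IsStdLaw μ) (t : ℝ) :
    ∫⁻ a, ENNReal.ofReal (farInd t a) ∂μ ≤ ENNReal.ofReal (t / 2) ^ 2 ∨ t < 0 := by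
  rcases lt_or_ge t 0 with ht | ht
  · exact Or.inr ht
  left
  calc _ ≤ ∫⁻ a, ENNReal.ofReal ((t / 2) ^ 2 * a ^ 2) ∂μ := by
        refine lintegral_mono fun a => ENNReal.ofReal_le_ofReal ?_
        rcases farInd_cases t a with ⟨h1, h2⟩ | ⟨h1, h2⟩
        · rw [h1]; positivity
        · rw [h1, ← mul_pow, div_mul_eq_mul_div, div_pow, ← sq_abs (t * a)]; nlinarith
    _ = _ := by
        rw [← lintegral_ofReal_const_mul (by positivity), ← ofReal_integral_eq_lintegral_ofReal
          h.integrable_sq (ae_of_all _ fun _ => sq_nonneg _), h.var, ENNReal.ofReal_one, mul_one,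
          ENNReal.ofReal_pow (by positivity)]

theorem speed_mul_l2norm_driftMain_le (h : IsStdLaw μ) (n : ℕ) (R : ℝ) {t T : ℝ}
    (ht : 0 < t) (htT : t ≤ T) :
    ENNReal.ofReal (speed n t) * l2norm (invWeight (smoothDensity μ n t)) (driftMain μ n R t)
      ≤ ENNReal.ofReal (Real.exp (T ^ 2 / 4)) * (∫⁻ a, ENNReal.ofReal ((1 - bigInd R a)
          * ((t ^ 3)⁻¹ * (|a| * (kappaModerate (t * a) + farInd t a))
          + T / 1.12 * (t ^ 3)⁻¹ * (farInd t a * a ^ 2))) ∂μ)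
        + ENNReal.ofReal (0.28 / T * (n ^ 2 * t ^ 3 / (1 + n * t ^ 2) ^ 3))
        + (ENNReal.ofReal (Real.exp (T ^ 2 / 4))
          * (∫⁻ a, ENNReal.ofReal ((t ^ 2)⁻¹ * weightDeriv t a) ∂μ) + ENNReal.ofReal (1 / 2))
        + ENNReal.ofReal (|∫ a, a ^ 3 ∂μ| / 2) * (ENNReal.ofReal (n * t / √(1 + n * t ^ 2) ^ 3)
          + ENNReal.ofReal (Real.exp (T ^ 2 / 4)) * ∫⁻ a, ENNReal.ofReal ((1 - bigInd R a)
            * (|a| * ((t ^ 2)⁻¹ * weightDeriv t a))) ∂μ) := by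
  have hT := ht.trans_le htT
  have hε : ENNReal.ofReal (Real.exp (t ^ 2 / 4)) ≤ ENNReal.ofReal (Real.exp (T ^ 2 / 4)) := by
    apply ENNReal.ofReal_le_ofReal; gcongr
  have hε1 := one_le_ofReal_exp T
  have hr := one_le_sqrt_add n t
  have hB0 : ∀ a, 0 ≤ 1 - bigInd R a := fun a => sub_nonneg.2 (bigInd_le_one R a)
  set σ := ENNReal.ofReal (speed n t)
  set ε := ENNReal.ofReal (Real.exp (t ^ 2 / 4))
  set ε' := ENNReal.ofReal (Real.exp (T ^ 2 / 4))
  have main := fun f => speed_mul_coord_le (μ := μ) n ht htT f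
  have main' := fun f => speed_mul_time_coord_le (μ := μ) n ht htT f
  refine (mul_le_mul_right (l2norm_driftMain_le h n R ht.le) σ).trans ?_
  rw [mul_add, mul_add, mul_add]
  refine add_le_add (add_le_add ?_ ?_) ?_
  · set X := ∫⁻ a, ENNReal.ofReal ((1 - bigInd R a) * (farInd t a * a ^ 2)) ∂μ
    have h1 := main (weightModerate R t)
    -- The weights satisfy 4 · (0.28/T) · (T/1.12) = 1, so the condition c² ≤ 4pq holds with
    -- equality. The first term has a time integral of order 1/T and the second joins the moderate
    -- weights.
    have h2 : σ * (ENNReal.ofReal (√n) * X ^ (1 / 2 : ℝ))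
        ≤ ENNReal.ofReal (0.28 / T * (n ^ 2 * t ^ 3 / (1 + n * t ^ 2) ^ 3))
          + ENNReal.ofReal (T / 1.12 * (t ^ 3)⁻¹) * X := by
      rw [← mul_assoc, speed_mul_sqrt]
      refine ofReal_mul_rpow_half_le (by positivity) (by positivity) (by positivity) ?_ X
      have h0 : 0 < 1 + n * t ^ 2 := by positivity
      rw [div_pow, ← pow_mul, show 3 * 2 = 2 * 3 from rfl, pow_mul, Real.sq_sqrt h0.le]
      apply le_of_eq
      field_simp
      ring
    refine (add_le_add h1 h2).trans ?_
    have e : ∫⁻ a, ENNReal.ofReal ((1 - bigInd R a)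
          * ((t ^ 3)⁻¹ * (|a| * (kappaModerate (t * a) + farInd t a))
          + T / 1.12 * (t ^ 3)⁻¹ * (farInd t a * a ^ 2))) ∂μ
        = (∫⁻ a, ENNReal.ofReal ((t ^ 3)⁻¹ * weightModerate R t a) ∂μ)
          + ENNReal.ofReal (T / 1.12 * (t ^ 3)⁻¹) * X := by
      rw [lintegral_ofReal_const_mul (by positivity), ← lintegral_add_left (by fun_prop)]
      refine lintegral_congr fun a => ?_
      have k0 := kappaModerate_nonneg (t * a)
      have f0 := farInd_nonneg t a
      have := hB0 a
      rw [weightModerate, ← ENNReal.ofReal_add (by positivity) (by positivity)]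
      congr 1; ring
    rw [e, mul_add, add_comm (ENNReal.ofReal (0.28 / T * _)), ← add_assoc]
    exact add_le_add (add_le_add le_rfl (le_mul_of_one_le_left (by simp) hε1)) le_rfl
  · rw [mul_add, mul_add]
    refine add_le_add (main' _) ?_
    have h1 : (∫⁻ a, ENNReal.ofReal (farInd t a) ∂μ) ^ (1 / 2 : ℝ) ≤ ENNReal.ofReal (t / 2) :=
      ENNReal.rpow_half_le_of_le_sq ((lintegral_farInd_le h t).resolve_right (not_lt.2 ht.le))
    calc _ ≤ σ * (ENNReal.ofReal t * (ENNReal.ofReal (√n) * ENNReal.ofReal (t / 2))) := by gcongr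
      _ = (σ * ENNReal.ofReal (√n)) * (ENNReal.ofReal t * ENNReal.ofReal (t / 2)) := by ring
      _ = ENNReal.ofReal (n / √(1 + n * t ^ 2) ^ 3 * (t * (t / 2))) := by
          rw [speed_mul_sqrt, ← ENNReal.ofReal_mul ht.le, ← ENNReal.ofReal_mul (by positivity)]
      _ ≤ _ := by
          apply ENNReal.ofReal_le_ofReal
          rw [div_mul_eq_mul_div, div_le_iff₀ (by positivity)]
          have h2 : √(1 + n * t ^ 2) ^ 2 = 1 + n * t ^ 2 := Real.sq_sqrt (by positivity)
          have h3 : √(1 + n * t ^ 2) ^ 2 ≤ √(1 + n * t ^ 2) ^ 3 :=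
            pow_le_pow_right₀ hr (by norm_num)
          nlinarith
  · rw [ENNReal.ofReal_mul (by positivity)]
    calc _ = ENNReal.ofReal (|∫ a, a ^ 3 ∂μ| / 2) * (ENNReal.ofReal t * (σ * ENNReal.ofReal (√n))
          + σ * (ENNReal.ofReal t * (n * (ε * ∫⁻ a, ENNReal.ofReal ((1 - bigInd R a)
            * (|a| * weightDeriv t a)) ∂μ)))) := by ring
      _ ≤ _ := by
          refine mul_le_mul_right (add_le_add ?_ ?_) _
          · rw [speed_mul_sqrt, ← ENNReal.ofReal_mul ht.le]
            apply ENNReal.ofReal_le_ofReal (le_of_eq _)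
            ring
          · refine (main' _).trans_eq ?_
            congr 3; ext a; congr 1; ring

theorem speed_mul_lintegral_driftRest_le (h : IsStdLaw μ) (n : ℕ) (R : ℝ) {t T : ℝ}
    (ht : 0 < t) (htT : t ≤ T) :
    ENNReal.ofReal (speed n t) * ∫⁻ z, driftRest μ n R t z
      ≤ ENNReal.ofReal (Real.exp (T ^ 2 / 4)) * (∫⁻ a, ENNReal.ofReal (bigInd R a
          * ((t ^ 3)⁻¹ * (|a| * (kappaBig (t * a) + farInd t a)))) ∂μ)
        + ENNReal.ofReal ((∫ a, bigInd R a * |a| ^ 3 ∂μ) / 2)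
          * (ENNReal.ofReal (n * t / √(1 + n * t ^ 2) ^ 3)
          + ENNReal.ofReal (Real.exp (T ^ 2 / 4)) * ∫⁻ a, ENNReal.ofReal
            (|a| * ((t ^ 2)⁻¹ * weightDeriv t a)) ∂μ)
        + ENNReal.ofReal (|∫ a, a ^ 3 ∂μ| / 2) * (ENNReal.ofReal (Real.exp (T ^ 2 / 4))
          * ∫⁻ a, ENNReal.ofReal (bigInd R a * (|a| * ((t ^ 2)⁻¹ * weightDeriv t a))) ∂μ) := by
  have hT := ht.trans_le htT
  have hε : ENNReal.ofReal (Real.exp (t ^ 2 / 4)) ≤ ENNReal.ofReal (Real.exp (T ^ 2 / 4)) := by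
    apply ENNReal.ofReal_le_ofReal; gcongr
  set σ := ENNReal.ofReal (speed n t)
  set ε := ENNReal.ofReal (Real.exp (t ^ 2 / 4))
  set ε' := ENNReal.ofReal (Real.exp (T ^ 2 / 4))
  have main := fun f => speed_mul_coord_le (μ := μ) n ht htT f
  have main' := fun f => speed_mul_time_coord_le (μ := μ) n ht htT f
  -- Dropping the far indicator makes the bound independent of t.
  have hfar : |farThird μ R t| ≤ ∫ a, bigInd R a * |a| ^ 3 ∂μ := by
    refine (abs_integral_le_integral_abs).trans (integral_mono_of_nonneg
      (ae_of_all _ fun a => abs_nonneg _) ?_ (ae_of_all _ fun a => ?_))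
    · refine h.integrable_cube.mono' (by fun_prop) (ae_of_all _ fun a => ?_)
      rw [Real.norm_of_nonneg (mul_nonneg (bigInd_nonneg R a) (by positivity))]
      exact mul_le_of_le_one_left (by positivity) (bigInd_le_one R a)
    · simp only
      rw [abs_mul, abs_mul, abs_of_nonneg (bigInd_nonneg R a), abs_of_nonneg (farInd_nonneg t a),
        abs_pow]
      gcongr
      exact mul_le_of_le_one_right (bigInd_nonneg R a) (farInd_le_one t a)
  refine (mul_le_mul_right (lintegral_driftRest_le h n R ht.le) σ).trans ?_
  rw [mul_add, mul_add]
  refine add_le_add (add_le_add ?_ ?_) ?_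
  · refine (main _).trans_eq ?_
    congr 3; ext a; congr 1; rw [weightBig]; ring
  · rw [ENNReal.ofReal_mul (by positivity)]
    calc _ = ENNReal.ofReal (|farThird μ R t| / 2) * (ENNReal.ofReal t * (σ * ENNReal.ofReal (√n))
          + σ * (ENNReal.ofReal t * (n * (ε * ∫⁻ a, ENNReal.ofReal
            (|a| * weightDeriv t a) ∂μ)))) := by ring
      _ ≤ _ := by
          refine mul_le_mul' (ENNReal.ofReal_le_ofReal (by linarith)) (add_le_add ?_ ?_)
          · rw [speed_mul_sqrt, ← ENNReal.ofReal_mul ht.le]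
            apply ENNReal.ofReal_le_ofReal (le_of_eq _)
            ring
          · refine (main' _).trans_eq ?_
            congr 3; ext a; congr 1; ring
  · rw [ENNReal.ofReal_mul (by positivity)]
    calc _ = ENNReal.ofReal (|∫ a, a ^ 3 ∂μ| / 2) * (σ * (ENNReal.ofReal t * (n * (ε
            * ∫⁻ a, ENNReal.ofReal (bigInd R a * (|a| * weightDeriv t a)) ∂μ)))) := by ring
      _ ≤ _ := by
          refine mul_le_mul_right ?_ _
          refine (main' _).trans_eq ?_
          congr 3; ext a; congr 1; ring

theorem setLIntegral_lintegral_weight_le {w c : ℝ → ℝ} {G : ℝ → ℝ → ℝ} {T : ℝ}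
    (hw : Measurable w) (hw0 : ∀ a, 0 ≤ w a) (hG : Measurable (Function.uncurry G))
    (hc : ∀ a, 0 ≤ c a) (hle : ∀ a, ∫⁻ t in Set.Ioc 0 T, ENNReal.ofReal (G t a)
      ≤ ENNReal.ofReal (c a)) (hi : Integrable (fun a => w a * c a) μ) :
    ∫⁻ t in Set.Ioc 0 T, ∫⁻ a, ENNReal.ofReal (w a * G t a) ∂μ
      ≤ ENNReal.ofReal (∫ a, w a * c a ∂μ) := by
  rw [lintegral_lintegral_swap (Measurable.aemeasurable (by fun_prop)),
    ofReal_integral_eq_lintegral_ofReal hi (ae_of_all _ fun a => mul_nonneg (hw0 a) (hc a))]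
  refine lintegral_mono fun a => ?_
  simp only [ENNReal.ofReal_mul (hw0 a)]
  rw [lintegral_const_mul' _ _ ENNReal.ofReal_ne_top]
  gcongr
  exact hle a

/-- The integrand is the derivative of 0.07/T · (n t² / (1 + n t²))², which never exceeds 0.07/T,
whatever n is. -/
theorem setLIntegral_quartic_weight_le (n : ℕ) {T : ℝ} (hT : 0 < T) :
    ∫⁻ t in Set.Ioc 0 T, ENNReal.ofReal (0.28 / T * (n ^ 2 * t ^ 3 / (1 + n * t ^ 2) ^ 3))
      ≤ ENNReal.ofReal (0.07 / T) := by
  have hpos : ∀ t : ℝ, 0 < 1 + n * t ^ 2 := fun t => by positivity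
  refine (setLIntegral_le_of_hasDerivAt hT.le (fun t _ => le_rfl) (fun t ht => ?_) ?_
    (H := fun t => 0.07 / T * (n * t ^ 2 / (1 + n * t ^ 2)) ^ 2) fun t _ => ?_).trans ?_
  · have := hpos t
    have := ht.1
    positivity
  · exact (Continuous.mul continuous_const (Continuous.div (by fun_prop) (by fun_prop)
      fun t => (pow_pos (hpos t) 3).ne')).continuousOn
  · have h1 := (hasDerivAt_pow 2 t).const_mul (n : ℝ)
    have h2 := (((h1.div (h1.const_add 1) (hpos t).ne').pow 2).const_mul (0.07 / T))
    refine h2.congr_deriv ?_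
    have := (hpos t).ne'
    simp only [Pi.div_apply, Nat.cast_ofNat, Nat.reduceSub, pow_one]
    field_simp
    ring
  · apply ENNReal.ofReal_le_ofReal
    have h1 : n * T ^ 2 / (1 + n * T ^ 2) ≤ 1 := by
      rw [div_le_one (hpos T)]; linarith
    have h2 : (n * T ^ 2 / (1 + n * T ^ 2)) ^ 2 ≤ 1 :=
      pow_le_one₀ (by positivity) h1
    have h3 : 0.07 / T * (n * T ^ 2 / (1 + n * T ^ 2)) ^ 2 ≤ 0.07 / T * 1 := by gcongr
    simpa using h3

/-- A primitive is -(1 + n t²)^(-1/2), so the mass is at most 1 uniformly in n. This is the time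
weight of the carrier term, the one of leading order in μ₃. -/
theorem setLIntegral_linear_weight_le (n : ℕ) {T : ℝ} (hT : 0 < T) :
    ∫⁻ t in Set.Ioc 0 T, ENNReal.ofReal (n * t / √(1 + n * t ^ 2) ^ 3) ≤ 1 := by
  have hpos : ∀ t : ℝ, 0 < 1 + n * t ^ 2 := fun t => by positivity
  refine (setLIntegral_le_of_hasDerivAt hT.le (fun t _ => le_rfl) (fun t ht => ?_) ?_
    (H := fun t => -(√(1 + n * t ^ 2))⁻¹) fun t _ => ?_).trans ?_
  · have := hpos t
    have := ht.1
    positivity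
  · exact (Continuous.div (by fun_prop) (by fun_prop)
      fun t => (pow_pos (Real.sqrt_pos.2 (hpos t)) 3).ne').continuousOn
  · have h1 := ((((hasDerivAt_pow 2 t).const_mul (n : ℝ)).const_add 1).sqrt (hpos t).ne').fun_inv
      (Real.sqrt_pos.2 (hpos t)).ne'
    refine h1.neg.congr_deriv ?_
    have := (Real.sqrt_pos.2 (hpos t)).ne'
    field_simp
    simp
  · rw [ENNReal.ofReal_le_one]
    have : 0 ≤ (√(1 + n * T ^ 2))⁻¹ := by positivity
    simp [this]

omit [IsProbabilityMeasure μ] in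
theorem integrable_moderate_pow_four (h : IsStdLaw μ) {R : ℝ} (hR : 0 ≤ R) :
    Integrable (fun a => (1 - bigInd R a) * a ^ 4) μ := by
  refine (h.integrable_cube.const_mul R).mono' (by fun_prop) (ae_of_all _ fun a => ?_)
  have h4 : |a| ^ 4 = a ^ 4 := Even.pow_abs (by decide) a
  rcases bigInd_cases R a with ⟨h1, h2⟩ | ⟨h1, h2⟩
  · rw [h1, Real.norm_of_nonneg (by positivity), ← h4]
    have : 0 ≤ |a| ^ 3 := by positivity
    nlinarith
  · rw [h1]; simp; positivity

omit [IsProbabilityMeasure μ] in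
theorem integrable_bigInd_cube (h : IsStdLaw μ) (R : ℝ) :
    Integrable (fun a => bigInd R a * |a| ^ 3) μ := by
  refine h.integrable_cube.mono' (by fun_prop) (ae_of_all _ fun a => ?_)
  rw [Real.norm_of_nonneg (mul_nonneg (bigInd_nonneg R a) (by positivity))]
  exact mul_le_of_le_one_left (by positivity) (bigInd_le_one R a)

omit [IsProbabilityMeasure μ] in
theorem integrable_moderate_cube (h : IsStdLaw μ) (R : ℝ) :
    Integrable (fun a => (1 - bigInd R a) * |a| ^ 3) μ := by
  refine (h.integrable_cube.sub (integrable_bigInd_cube h R)).congr (ae_of_all _ fun a => ?_)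
  simp only [Pi.sub_apply]; ring

/-- Time integral of the main part of the velocity. -/
theorem setLIntegral_speed_mul_driftMain_le (h : IsStdLaw μ) (n : ℕ) {R T : ℝ} (hR : 0 ≤ R)
    (hT : 0 < T) :
    ∫⁻ t in Set.Ioc 0 T, ENNReal.ofReal (speed n t)
        * l2norm (invWeight (smoothDensity μ n t)) (driftMain μ n R t)
      ≤ ENNReal.ofReal (Real.exp (T ^ 2 / 4) * (0.575 * T * ∫ a, (1 - bigInd R a) * a ^ 4 ∂μ)
        + 0.07 / T + (Real.exp (T ^ 2 / 4) * (1.98 * T) + T / 2)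
        + |∫ a, a ^ 3 ∂μ| / 2 * (1 + Real.exp (T ^ 2 / 4)
          * (1.98 * T * ∫ a, (1 - bigInd R a) * |a| ^ 3 ∂μ))) := by
  have hB0 : ∀ a, 0 ≤ 1 - bigInd R a := fun a => sub_nonneg.2 (bigInd_le_one R a)
  have I1 := setLIntegral_lintegral_weight_le (μ := μ) (w := fun a => 1 - bigInd R a)
    (G := fun t a => (t ^ 3)⁻¹ * (|a| * (kappaModerate (t * a) + farInd t a))
      + T / 1.12 * (t ^ 3)⁻¹ * (farInd t a * a ^ 2)) (by fun_prop) hB0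
    (by unfold Function.uncurry; fun_prop) (c := fun a => 0.575 * a ^ 4 * T)
    (fun a => by positivity) (fun a => setLIntegral_weightModerate_le a hT)
    (by refine ((integrable_moderate_pow_four h hR).const_mul (0.575 * T)).congr
          (ae_of_all _ fun a => ?_)
        ring)
  have I2 := setLIntegral_lintegral_weight_le (μ := μ) (w := fun _ => 1)
    (G := fun t a => (t ^ 2)⁻¹ * weightDeriv t a) (by fun_prop) (fun _ => zero_le_one)
    (by unfold Function.uncurry; fun_prop) (c := fun a => 1.98 * a ^ 2 * T)
    (fun a => by positivity) (fun a => setLIntegral_weightDeriv_le a hT)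
    (by refine (h.integrable_sq.const_mul (1.98 * T)).congr (ae_of_all _ fun a => ?_)
        ring)
  have I3 := setLIntegral_lintegral_weight_le (μ := μ) (w := fun a => (1 - bigInd R a) * |a|)
    (G := fun t a => (t ^ 2)⁻¹ * weightDeriv t a) (by fun_prop)
    (fun a => mul_nonneg (hB0 a) (abs_nonneg a))
    (by unfold Function.uncurry; fun_prop) (c := fun a => 1.98 * a ^ 2 * T)
    (fun a => by positivity) (fun a => setLIntegral_weightDeriv_le a hT)
    (by refine ((integrable_moderate_cube h R).const_mul (1.98 * T)).congr
          (ae_of_all _ fun a => ?_)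
        simp only; rw [← sq_abs a]; ring)
  have e1 : ∫ a, (1 - bigInd R a) * (0.575 * a ^ 4 * T) ∂μ
      = 0.575 * T * ∫ a, (1 - bigInd R a) * a ^ 4 ∂μ := by
    rw [← integral_const_mul]; congr 1; ext a; ring
  have e2 : ∫ a, 1 * (1.98 * a ^ 2 * T) ∂μ = 1.98 * T := by
    have : (fun a : ℝ => 1 * (1.98 * a ^ 2 * T)) = fun a => 1.98 * T * a ^ 2 := by ext a; ring
    rw [this, integral_const_mul, h.var, mul_one]
  have e3 : ∫ a, (1 - bigInd R a) * |a| * (1.98 * a ^ 2 * T) ∂μ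
      = 1.98 * T * ∫ a, (1 - bigInd R a) * |a| ^ 3 ∂μ := by
    rw [← integral_const_mul]; congr 1; ext a; rw [← sq_abs a]; ring
  rw [e1] at I1
  rw [e2] at I2
  rw [e3] at I3
  simp only [one_mul] at I2
  simp only [mul_assoc (1 - bigInd R _)] at I3
  have n1 : 0 ≤ ∫ a, (1 - bigInd R a) * a ^ 4 ∂μ :=
    integral_nonneg fun a => mul_nonneg (hB0 a) (by positivity)
  have n3 : 0 ≤ ∫ a, (1 - bigInd R a) * |a| ^ 3 ∂μ :=
    integral_nonneg fun a => mul_nonneg (hB0 a) (by positivity)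
  set m4 := ∫ a, (1 - bigInd R a) * a ^ 4 ∂μ
  set m3 := ∫ a, (1 - bigInd R a) * |a| ^ 3 ∂μ
  refine (setLIntegral_mono' measurableSet_Ioc fun t ht =>
    speed_mul_l2norm_driftMain_le h n R ht.1 ht.2).trans ?_
  rw [lintegral_add_left (by fun_prop), lintegral_add_left (by fun_prop),
    lintegral_add_left (by fun_prop), lintegral_add_left (by fun_prop),
    lintegral_const_mul _ (by fun_prop), lintegral_const_mul _ (by fun_prop),
    lintegral_const_mul _ (by fun_prop), lintegral_add_left (by fun_prop),
    lintegral_const_mul _ (by fun_prop), setLIntegral_const, Real.volume_Ioc, sub_zero,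
    ENNReal.ofReal_add (by positivity) (by positivity),
    ENNReal.ofReal_add (by positivity) (by positivity),
    ENNReal.ofReal_add (by positivity) (by positivity),
    ENNReal.ofReal_add (by positivity) (by positivity),
    ENNReal.ofReal_mul (by positivity : 0 ≤ Real.exp (T ^ 2 / 4)),
    ENNReal.ofReal_mul (by positivity : 0 ≤ Real.exp (T ^ 2 / 4)),
    ENNReal.ofReal_mul (by positivity : 0 ≤ |∫ a, a ^ 3 ∂μ| / 2),
    ENNReal.ofReal_add zero_le_one (by positivity),
    ENNReal.ofReal_mul (by positivity : 0 ≤ Real.exp (T ^ 2 / 4)),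
    ← ENNReal.ofReal_mul (by norm_num : (0 : ℝ) ≤ 1 / 2), ENNReal.ofReal_one]
  refine add_le_add (add_le_add (add_le_add (mul_le_mul_right I1 _)
    (setLIntegral_quartic_weight_le n hT)) (add_le_add (mul_le_mul_right I2 _) ?_))
    (mul_le_mul_right (add_le_add (setLIntegral_linear_weight_le n hT) (mul_le_mul_right I3 _)) _)
  apply ENNReal.ofReal_le_ofReal; linarith

/-- Time integral of the remaining part of the velocity. -/
theorem setLIntegral_speed_mul_driftRest_le (h : IsStdLaw μ) (n : ℕ) (R : ℝ) {T : ℝ}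
    (hT : 0 < T) :
    ∫⁻ t in Set.Ioc 0 T, ENNReal.ofReal (speed n t) * ∫⁻ z, driftRest μ n R t z
      ≤ ENNReal.ofReal (Real.exp (T ^ 2 / 4) * (1.7663 * ∫ a, bigInd R a * |a| ^ 3 ∂μ)
        + (∫ a, bigInd R a * |a| ^ 3 ∂μ) / 2 * (1 + Real.exp (T ^ 2 / 4)
          * (1.98 * T * ∫ a, |a| ^ 3 ∂μ))
        + |∫ a, a ^ 3 ∂μ| / 2 * (Real.exp (T ^ 2 / 4)
          * (1.98 * T * ∫ a, bigInd R a * |a| ^ 3 ∂μ))) := by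
  have hB0 := bigInd_nonneg R
  have I1 := setLIntegral_lintegral_weight_le (μ := μ) (w := bigInd R)
    (G := fun t a => (t ^ 3)⁻¹ * (|a| * (kappaBig (t * a) + farInd t a))) (by fun_prop) hB0
    (by unfold Function.uncurry; fun_prop) (c := fun a => 1.7663 * |a| ^ 3)
    (fun a => by positivity) (fun a => setLIntegral_weightBig_le a hT)
    (by refine ((integrable_bigInd_cube h R).const_mul 1.7663).congr (ae_of_all _ fun a => ?_)
        ring)
  have I2 := setLIntegral_lintegral_weight_le (μ := μ) (w := fun a => |a|)
    (G := fun t a => (t ^ 2)⁻¹ * weightDeriv t a) (by fun_prop) (fun a => abs_nonneg a)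
    (by unfold Function.uncurry; fun_prop) (c := fun a => 1.98 * a ^ 2 * T)
    (fun a => by positivity) (fun a => setLIntegral_weightDeriv_le a hT)
    (by refine (h.integrable_cube.const_mul (1.98 * T)).congr (ae_of_all _ fun a => ?_)
        simp only; rw [← sq_abs a]; ring)
  have I3 := setLIntegral_lintegral_weight_le (μ := μ) (w := fun a => bigInd R a * |a|)
    (G := fun t a => (t ^ 2)⁻¹ * weightDeriv t a) (by fun_prop)
    (fun a => mul_nonneg (hB0 a) (abs_nonneg a))
    (by unfold Function.uncurry; fun_prop) (c := fun a => 1.98 * a ^ 2 * T)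
    (fun a => by positivity) (fun a => setLIntegral_weightDeriv_le a hT)
    (by refine ((integrable_bigInd_cube h R).const_mul (1.98 * T)).congr
          (ae_of_all _ fun a => ?_)
        simp only; rw [← sq_abs a]; ring)
  have e1 : ∫ a, bigInd R a * (1.7663 * |a| ^ 3) ∂μ
      = 1.7663 * ∫ a, bigInd R a * |a| ^ 3 ∂μ := by
    rw [← integral_const_mul]; congr 1; ext a; ring
  have e2 : ∫ a, |a| * (1.98 * a ^ 2 * T) ∂μ = 1.98 * T * ∫ a, |a| ^ 3 ∂μ := by
    rw [← integral_const_mul]; congr 1; ext a; rw [← sq_abs a]; ring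
  have e3 : ∫ a, bigInd R a * |a| * (1.98 * a ^ 2 * T) ∂μ
      = 1.98 * T * ∫ a, bigInd R a * |a| ^ 3 ∂μ := by
    rw [← integral_const_mul]; congr 1; ext a; rw [← sq_abs a]; ring
  rw [e1] at I1
  rw [e2] at I2
  rw [e3] at I3
  simp only [mul_assoc (bigInd R _)] at I3
  have n1 : 0 ≤ ∫ a, |a| ^ 3 ∂μ := integral_nonneg fun a => by positivity
  have n3 : 0 ≤ ∫ a, bigInd R a * |a| ^ 3 ∂μ :=
    integral_nonneg fun a => mul_nonneg (hB0 a) (by positivity)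
  refine (setLIntegral_mono' measurableSet_Ioc fun t ht =>
    speed_mul_lintegral_driftRest_le h n R ht.1 ht.2).trans ?_
  set m4 := ∫ a, |a| ^ 3 ∂μ
  set m3 := ∫ a, bigInd R a * |a| ^ 3 ∂μ
  rw [lintegral_add_left (by fun_prop), lintegral_add_left (by fun_prop),
    lintegral_const_mul _ (by fun_prop), lintegral_const_mul _ (by fun_prop),
    lintegral_const_mul _ (by fun_prop), lintegral_const_mul _ (by fun_prop),
    lintegral_add_left (by fun_prop), lintegral_const_mul _ (by fun_prop),
    ENNReal.ofReal_add (by positivity) (by positivity),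
    ENNReal.ofReal_add (by positivity) (by positivity),
    ENNReal.ofReal_mul (by positivity : 0 ≤ Real.exp (T ^ 2 / 4)),
    ENNReal.ofReal_mul (by positivity : 0 ≤ m3 / 2),
    ENNReal.ofReal_add zero_le_one (by positivity),
    ENNReal.ofReal_mul (by positivity : 0 ≤ Real.exp (T ^ 2 / 4)),
    ENNReal.ofReal_mul (by positivity : 0 ≤ |∫ a, a ^ 3 ∂μ| / 2),
    ENNReal.ofReal_mul (by positivity : 0 ≤ Real.exp (T ^ 2 / 4)), ENNReal.ofReal_one]
  exact add_le_add (add_le_add (mul_le_mul_right I1 _) (mul_le_mul_right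
    (add_le_add (setLIntegral_linear_weight_le n hT) (mul_le_mul_right I2 _)) _))
    (mul_le_mul_right (mul_le_mul_right I3 _) _)

end TimeAverage


/-! ### The monotone flow between the smoothed laws -/

section Flow

open Filter Topology

variable {n : ℕ} {μ : Measure ℝ} [IsProbabilityMeasure μ]

/-- The standard Gaussian distribution function. -/
noncomputable def stdCdf (z : ℝ) : ℝ := cdf (gaussianReal 0 1) z

theorem stdCdf_eq (z : ℝ) : stdCdf z = ∫ x in Set.Iic z, stdDensity x := by
  rw [stdCdf, cdf_eq_real, measureReal_def, gaussianReal_apply 0 one_ne_zero,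
    integral_eq_lintegral_of_nonneg_ae (ae_of_all _ fun x => (stdDensity_pos x).le) (by fun_prop)]
  rfl

theorem integrable_stdDensity : Integrable stdDensity := by
  simpa using integrable_pow_mul_stdDensity 0

theorem hasDerivAt_stdCdf (z : ℝ) : HasDerivAt stdCdf (stdDensity z) z := by
  have e : stdCdf = fun z => (∫ x in (0 : ℝ)..z, stdDensity x) + stdCdf 0 := by
    ext z
    rw [stdCdf_eq, stdCdf_eq, ← intervalIntegral.integral_Iic_sub_Iic
      integrable_stdDensity.integrableOn integrable_stdDensity.integrableOn]
    ring
  rw [e]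
  exact (continuous_stdDensity.integral_hasStrictDerivAt 0 z).hasDerivAt.add_const _

theorem continuous_stdCdf : Continuous stdCdf :=
  continuous_iff_continuousAt.2 fun z => (hasDerivAt_stdCdf z).continuousAt

theorem stdCdf_nonneg (z : ℝ) : 0 ≤ stdCdf z := cdf_nonneg _ _

theorem norm_stdCdf_le (z : ℝ) : ‖stdCdf z‖ ≤ 1 := by
  rw [stdCdf, Real.norm_of_nonneg (cdf_nonneg _ _)]; exact cdf_le_one _ _

/-- The distribution function of `t S + G`. -/
noncomputable def smoothCdf (μ : Measure ℝ) (n : ℕ) (t z : ℝ) : ℝ :=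
  ∫ ω, stdCdf (z - t * total ω) ∂(iidLaw μ n)

/-- The weight `E[S φ(z - t S)]`. -/
noncomputable def smoothMoment (μ : Measure ℝ) (n : ℕ) (t z : ℝ) : ℝ :=
  ∫ ω, total ω * stdDensity (z - t * total ω) ∂(iidLaw μ n)

theorem integrable_stdCdf (t z : ℝ) :
    Integrable (fun ω : Fin n → ℝ => stdCdf (z - t * total ω)) (iidLaw μ n) :=
  Integrable.of_bound (C := 1)
    (continuous_stdCdf.measurable.comp (by fun_prop)).aestronglyMeasurable
    (ae_of_all _ fun _ => norm_stdCdf_le _)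

theorem continuous_smoothCdf : Continuous fun p : ℝ × ℝ => smoothCdf μ n p.1 p.2 := by
  unfold smoothCdf
  refine continuous_of_dominated (bound := fun _ => 1) (fun p => (integrable_stdCdf _ _).1)
    (fun p => ae_of_all _ fun ω => norm_stdCdf_le _) (integrable_const _) ?_
  exact ae_of_all _ fun ω => continuous_stdCdf.comp (by fun_prop)

theorem hasDerivAt_smoothCdf (t z : ℝ) :
    HasDerivAt (smoothCdf μ n t) (smoothDensity μ n t z) z := by
  refine (hasDerivAt_integral_of_dominated_loc_of_deriv_le (s := Set.univ) (bound := fun _ => 1)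
    (F' := fun z ω => stdDensity (z - t * total ω)) univ_mem
    (Eventually.of_forall fun z => (integrable_stdCdf t z).1) (integrable_stdCdf t z)
    (integrable_stdDensity_comp (by fun_prop)).1 (ae_of_all _ fun ω z _ => ?_)
    (integrable_const _) (ae_of_all _ fun ω z _ => ?_)).2
  · rw [Real.norm_of_nonneg (stdDensity_pos _).le]; exact stdDensity_le_one _
  · exact ((hasDerivAt_stdCdf (z - t * total ω)).comp z
      ((hasDerivAt_id z).sub_const _)).congr_deriv (mul_one _)

theorem integrable_total (h : IsStdLaw μ) : Integrable (total (n := n)) (iidLaw μ n) := by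
  unfold total
  exact integrable_finsetSum _ fun i _ => integrable_coord h.integrable_id i

theorem hasDerivAt_smoothCdf_time (h : IsStdLaw μ) (t z : ℝ) :
    HasDerivAt (fun t => smoothCdf μ n t z) (-smoothMoment μ n t z) t := by
  rw [smoothMoment, ← integral_neg]
  refine (hasDerivAt_integral_of_dominated_loc_of_deriv_le (s := Set.univ)
    (bound := fun ω => |total ω|)
    (F' := fun t ω => -(total ω * stdDensity (z - t * total ω))) univ_mem
    (Eventually.of_forall fun t => (integrable_stdCdf t z).1) (integrable_stdCdf t z)
    (Measurable.aestronglyMeasurable (by fun_prop)) (ae_of_all _ fun ω t _ => ?_)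
    (integrable_total h).abs (ae_of_all _ fun ω t _ => ?_)).2
  · rw [norm_neg, norm_mul, Real.norm_of_nonneg (stdDensity_pos _).le]
    exact mul_le_of_le_one_right (norm_nonneg _) (stdDensity_le_one _)
  · have h1 : HasDerivAt (fun t => z - t * total ω) (-total ω) t := by
      simpa using ((hasDerivAt_id t).mul_const (total ω)).const_sub z
    exact ((hasDerivAt_stdCdf (z - t * total ω)).comp t h1).congr_deriv (by ring)

theorem strictMono_smoothCdf (t : ℝ) : StrictMono (smoothCdf μ n t) :=
  strictMono_of_hasDerivAt_pos (fun z => hasDerivAt_smoothCdf t z) fun z => smoothDensity_pos t z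

theorem tendsto_smoothCdf_atBot (t : ℝ) : Tendsto (smoothCdf μ n t) atBot (𝓝 0) := by
  have := tendsto_integral_filter_of_dominated_convergence (μ := iidLaw μ n) (l := atBot)
    (F := fun z ω => stdCdf (z - t * total ω)) (f := fun _ => 0) (fun _ => (1 : ℝ))
    (Eventually.of_forall fun z => (integrable_stdCdf t z).1)
    (Eventually.of_forall fun z => ae_of_all _ fun ω => norm_stdCdf_le _) (integrable_const _)
    (ae_of_all _ fun ω => (tendsto_cdf_atBot _).comp (tendsto_atBot_add_const_right _ _ tendsto_id))
  rw [integral_zero] at this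
  exact this

theorem tendsto_smoothCdf_atTop (t : ℝ) : Tendsto (smoothCdf μ n t) atTop (𝓝 1) := by
  have := tendsto_integral_filter_of_dominated_convergence (μ := iidLaw μ n) (l := atTop)
    (F := fun z ω => stdCdf (z - t * total ω)) (f := fun _ => 1) (fun _ => (1 : ℝ))
    (Eventually.of_forall fun z => (integrable_stdCdf t z).1)
    (Eventually.of_forall fun z => ae_of_all _ fun ω => norm_stdCdf_le _) (integrable_const _)
    (ae_of_all _ fun ω => (tendsto_cdf_atTop _).comp (tendsto_atTop_add_const_right _ _ tendsto_id))
  rw [integral_const, probReal_univ, one_smul] at this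
  exact this

theorem smoothCdf_pos (t z : ℝ) : 0 < smoothCdf μ n t z := by
  have h : 0 ≤ smoothCdf μ n t (z - 1) := integral_nonneg fun ω => cdf_nonneg _ _
  exact h.trans_lt (strictMono_smoothCdf t (by linarith))

theorem smoothCdf_lt_one (t z : ℝ) : smoothCdf μ n t z < 1 :=
  (strictMono_smoothCdf (μ := μ) (n := n) t (by linarith : z < z + 1)).trans_le
    ((strictMono_smoothCdf (μ := μ) (n := n) t).monotone.ge_of_tendsto
      (tendsto_smoothCdf_atTop t) _)

/-- Intermediate value theorem: the level lies strictly between the limits 0 and 1 of the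
distribution function at time t. -/
theorem exists_smoothCdf_eq (T t τ : ℝ) : ∃ z, smoothCdf μ n t z = smoothCdf μ n T τ := by
  have h0 := smoothCdf_pos (μ := μ) (n := n) T τ
  have h1 := smoothCdf_lt_one (μ := μ) (n := n) T τ
  have hc : Continuous fun z => smoothCdf μ n t z :=
    continuous_iff_continuousAt.2 fun z => (hasDerivAt_smoothCdf t z).continuousAt
  obtain ⟨a, ha⟩ :=
    ((tendsto_smoothCdf_atBot (μ := μ) (n := n) t).eventually_le_const h0).exists
  obtain ⟨b, hb⟩ :=
    ((tendsto_smoothCdf_atTop (μ := μ) (n := n) t).eventually_const_le h1).exists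
  exact mem_range_of_exists_le_of_exists_ge hc ⟨a, ha⟩ ⟨b, hb⟩

/-- The monotone map which transports the law at time `T` to the law at time `t`. -/
noncomputable def flowMap (μ : Measure ℝ) [IsProbabilityMeasure μ] (n : ℕ) (T t τ : ℝ) : ℝ :=
  (exists_smoothCdf_eq (μ := μ) (n := n) T t τ).choose

theorem smoothCdf_flowMap (T t τ : ℝ) :
    smoothCdf μ n t (flowMap μ n T t τ) = smoothCdf μ n T τ :=
  (exists_smoothCdf_eq (μ := μ) (n := n) T t τ).choose_spec

theorem flowMap_self (T τ : ℝ) : flowMap μ n T T τ = τ :=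
  (strictMono_smoothCdf T).injective (smoothCdf_flowMap T T τ)

/-- By strict monotonicity, comparing the flow with a level a is comparing two jointly continuous
distribution functions, and strict inequalities are open conditions. -/
theorem continuous_flowMap (T : ℝ) :
    Continuous fun p : ℝ × ℝ => flowMap μ n T p.1 p.2 := by
  rw [continuous_iff_continuousAt]
  rintro ⟨t, τ⟩
  have hF := continuous_smoothCdf (μ := μ) (n := n)
  refine tendsto_order.2 ⟨fun a ha => ?_, fun a ha => ?_⟩
  · have h1 : smoothCdf μ n t a < smoothCdf μ n T τ := by
      rw [← smoothCdf_flowMap T t τ]; exact strictMono_smoothCdf t ha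
    have h2 : ∀ᶠ p : ℝ × ℝ in 𝓝 (t, τ), smoothCdf μ n p.1 a < smoothCdf μ n T p.2 :=
      ((hF.comp (by fun_prop : Continuous fun p : ℝ × ℝ => (p.1, a))).tendsto (t, τ)).eventually_lt
        ((hF.comp (by fun_prop : Continuous fun p : ℝ × ℝ => (T, p.2))).tendsto (t, τ)) h1
    filter_upwards [h2] with p hp
    rw [← smoothCdf_flowMap T p.1 p.2] at hp
    exact (strictMono_smoothCdf p.1).lt_iff_lt.1 hp
  · have h1 : smoothCdf μ n T τ < smoothCdf μ n t a := by
      rw [← smoothCdf_flowMap T t τ]; exact strictMono_smoothCdf t ha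
    have h2 : ∀ᶠ p : ℝ × ℝ in 𝓝 (t, τ), smoothCdf μ n T p.2 < smoothCdf μ n p.1 a :=
      ((hF.comp (by fun_prop : Continuous fun p : ℝ × ℝ => (T, p.2))).tendsto (t, τ)).eventually_lt
        ((hF.comp (by fun_prop : Continuous fun p : ℝ × ℝ => (p.1, a))).tendsto (t, τ)) h1
    filter_upwards [h2] with p hp
    rw [← smoothCdf_flowMap T p.1 p.2] at hp
    exact (strictMono_smoothCdf p.1).lt_iff_lt.1 hp

/-- Mean value theorem without assuming an order of the endpoints; the intermediate point is needed
to differentiate the flow. -/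
theorem exists_smoothCdf_sub_eq (t a b : ℝ) : ∃ ξ ∈ Set.uIcc a b,
    smoothCdf μ n t b - smoothCdf μ n t a = smoothDensity μ n t ξ * (b - a) := by
  rcases lt_trichotomy a b with hab | rfl | hab
  · obtain ⟨ξ, hξ, h⟩ := exists_hasDerivAt_eq_slope (smoothCdf μ n t) (smoothDensity μ n t) hab
      (fun z _ => (hasDerivAt_smoothCdf t z).continuousAt.continuousWithinAt)
      fun z _ => hasDerivAt_smoothCdf t z
    refine ⟨ξ, by rw [Set.uIcc_of_le hab.le]; exact Set.Ioo_subset_Icc_self hξ, ?_⟩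
    rw [h, div_mul_cancel₀ _ (sub_pos.2 hab).ne']
  · exact ⟨a, by simp, by simp⟩
  · obtain ⟨ξ, hξ, h⟩ := exists_hasDerivAt_eq_slope (smoothCdf μ n t) (smoothDensity μ n t) hab
      (fun z _ => (hasDerivAt_smoothCdf t z).continuousAt.continuousWithinAt)
      fun z _ => hasDerivAt_smoothCdf t z
    refine ⟨ξ, by rw [Set.uIcc_of_ge hab.le]; exact Set.Ioo_subset_Icc_self hξ, ?_⟩
    have := (sub_pos.2 hab).ne'
    rw [h]; field_simp; ring

/-- Implicit differentiation of F_t(Θ_t) = const, F_t being the distribution function. The increment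
of F in z is written as f_s(ξ_s)(Θ_s - Θ_t), so the slope of Θ is minus the slope of F in time over
f_s(ξ_s), and ξ_s → Θ_t by continuity of the flow. -/
theorem hasDerivAt_flowMap (h : IsStdLaw μ) (T t τ : ℝ) :
    HasDerivAt (fun t => flowMap μ n T t τ)
      (smoothMoment μ n t (flowMap μ n T t τ) / smoothDensity μ n t (flowMap μ n T t τ)) t := by
  set θ := fun t => flowMap μ n T t τ
  have hθ : Continuous θ := (continuous_flowMap T).comp (by fun_prop : Continuous fun t : ℝ => (t, τ))
  choose ξ hξ hξ2 using fun s => exists_smoothCdf_sub_eq (μ := μ) (n := n) s (θ t) (θ s)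
  have hξt : Tendsto ξ (𝓝 t) (𝓝 (θ t)) := by
    rw [tendsto_iff_dist_tendsto_zero]
    have h1 : Tendsto (fun s => dist (θ s) (θ t)) (𝓝 t) (𝓝 0) :=
      tendsto_iff_dist_tendsto_zero.1 (hθ.tendsto t)
    refine squeeze_zero (fun _ => dist_nonneg) (fun s => ?_) h1
    rw [Real.dist_eq, Real.dist_eq]
    exact Set.abs_sub_left_of_mem_uIcc (hξ s)
  have hden : Tendsto (fun s => smoothDensity μ n s (ξ s)) (𝓝 t) (𝓝 (smoothDensity μ n t (θ t))) := by
    have h1 : Tendsto (fun s => (s, ξ s)) (𝓝 t) (𝓝 (t, θ t)) := tendsto_id.prodMk_nhds hξt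
    have h2 := (continuous_smoothDensity (μ := μ) (n := n)).tendsto (t, θ t)
    have h3 := h2.comp h1
    simp only [Function.comp_def] at h3
    exact h3
  rw [hasDerivAt_iff_tendsto_slope]
  have hnum := (hasDerivAt_iff_tendsto_slope.1 (hasDerivAt_smoothCdf_time (n := n) h t (θ t))).neg
  rw [neg_neg] at hnum
  refine (hnum.div (hden.mono_left nhdsWithin_le_nhds) (smoothDensity_pos _ _).ne').congr' ?_
  filter_upwards [self_mem_nhdsWithin] with s hs
  have hs' : s - t ≠ 0 := sub_ne_zero.2 hs
  have hp := (smoothDensity_pos (μ := μ) (n := n) s (ξ s)).ne'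
  have e : smoothCdf μ n s (θ s) = smoothCdf μ n t (θ t) := by
    simp only [θ, smoothCdf_flowMap]
  have h2 := hξ2 s
  rw [e] at h2
  simp only [slope_def_field, Pi.div_apply]
  rw [div_eq_iff hp, ← neg_div, neg_sub, h2]
  ring

/-- The law with density `smoothDensity μ n t`. -/
noncomputable def smoothLaw (μ : Measure ℝ) (n : ℕ) (t : ℝ) : Measure ℝ :=
  volume.withDensity fun z => ENNReal.ofReal (smoothDensity μ n t z)

instance isProbabilityMeasure_smoothLaw (t : ℝ) : IsProbabilityMeasure (smoothLaw μ n t) :=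
  ⟨by rw [smoothLaw, withDensity_apply _ MeasurableSet.univ, Measure.restrict_univ,
    lintegral_smoothDensity]⟩

theorem lintegral_smoothLaw (t : ℝ) {g : ℝ → ℝ≥0∞} (hg : Measurable g) :
    ∫⁻ z, g z ∂(smoothLaw μ n t)
      = ∫⁻ ω, ∫⁻ x, g (t * total ω + x) ∂(gaussianReal 0 1) ∂(iidLaw μ n) := by
  have hm : Measurable fun z => ENNReal.ofReal (smoothDensity μ n t z) :=
    (measurable_smoothDensity t).ennreal_ofReal
  rw [smoothLaw, lintegral_withDensity_eq_lintegral_mul _ hm hg]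
  simp only [Pi.mul_apply, ofReal_smoothDensity]
  have e : ∀ ω : Fin n → ℝ, ∫⁻ x, g (t * total ω + x) ∂(gaussianReal 0 1)
      = ∫⁻ z, ENNReal.ofReal (stdDensity (z - t * total ω)) * g z := fun ω => by
    rw [gaussianReal_of_var_ne_zero 0 one_ne_zero,
      lintegral_withDensity_eq_lintegral_mul _ (measurable_gaussianPDF 0 1) (by fun_prop),
      ← lintegral_add_left_eq_self (μ := volume) (fun z => ENNReal.ofReal
        (stdDensity (z - t * total ω)) * g z) (t * total ω)]
    refine lintegral_congr fun x => ?_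
    rw [add_sub_cancel_left]; rfl
  simp only [e]
  rw [lintegral_lintegral_swap]
  · refine lintegral_congr fun z => ?_
    rw [lintegral_mul_const _ (by fun_prop)]
  · exact Measurable.aemeasurable (by unfold Function.uncurry; fun_prop)

theorem smoothLaw_zero : smoothLaw μ n 0 = gaussianReal 0 1 := by
  refine Measure.ext_of_lintegral _ fun g hg => ?_
  rw [lintegral_smoothLaw 0 hg]; simp

theorem cdf_smoothLaw (t z : ℝ) : cdf (smoothLaw μ n t) z = smoothCdf μ n t z := by
  rw [cdf_eq_real, measureReal_def, ← lintegral_indicator_one measurableSet_Iic,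
    lintegral_smoothLaw t (by fun_prop (disch := exact measurableSet_Iic)), smoothCdf,
    integral_eq_lintegral_of_nonneg_ae (ae_of_all _ fun ω => stdCdf_nonneg _)
      (integrable_stdCdf t z).1]
  congr 1
  refine lintegral_congr fun ω => ?_
  have e : (fun x => (Set.Iic z).indicator (1 : ℝ → ℝ≥0∞) (t * total ω + x))
      = (Set.Iic (z - t * total ω)).indicator 1 := by
    ext x
    simp only [Set.indicator, Set.mem_Iic, le_sub_iff_add_le', Pi.one_apply]
  rw [e, lintegral_indicator_one measurableSet_Iic, stdCdf, ofReal_cdf]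

/-- Distribution functions are compared: the preimage of a half-line is the half-line ending at the
matching quantile. -/
theorem map_flowMap (T t : ℝ) : (smoothLaw μ n T).map (flowMap μ n T t) = smoothLaw μ n t := by
  have hc : Continuous (flowMap μ n T t) :=
    (continuous_flowMap T).comp (by fun_prop : Continuous fun τ : ℝ => (t, τ))
  have : IsProbabilityMeasure ((smoothLaw μ n T).map (flowMap μ n T t)) :=
    Measure.isProbabilityMeasure_map hc.aemeasurable
  refine Measure.eq_of_cdf _ _ ?_
  ext z
  obtain ⟨b, hb⟩ := exists_smoothCdf_eq (μ := μ) (n := n) t T z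
  have e : flowMap μ n T t ⁻¹' Set.Iic z = Set.Iic b := by
    ext τ
    rw [Set.mem_preimage, Set.mem_Iic, Set.mem_Iic,
      ← (strictMono_smoothCdf (μ := μ) (n := n) t).le_iff_le, smoothCdf_flowMap, ← hb,
      (strictMono_smoothCdf (μ := μ) (n := n) T).le_iff_le]
  rw [cdf_eq_real, measureReal_def, Measure.map_apply hc.measurable measurableSet_Iic, e,
    ← measureReal_def, ← cdf_eq_real, cdf_smoothLaw, cdf_smoothLaw, hb]

theorem integrable_total_mul_stdDensity (h : IsStdLaw μ) (t z : ℝ) :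
    Integrable (fun ω : Fin n → ℝ => total ω * stdDensity (z - t * total ω)) (iidLaw μ n) := by
  refine (integrable_total h).mono (by fun_prop) (ae_of_all _ fun ω => ?_)
  rw [norm_mul, Real.norm_of_nonneg (stdDensity_pos _).le]
  exact mul_le_of_le_one_right (norm_nonneg _) (stdDensity_le_one _)

theorem continuous_smoothMoment (h : IsStdLaw μ) :
    Continuous fun p : ℝ × ℝ => smoothMoment μ n p.1 p.2 := by
  unfold smoothMoment
  refine continuous_of_dominated (bound := fun ω => |total ω|)
    (fun p => (integrable_total_mul_stdDensity h p.1 p.2).1)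
    (fun p => ae_of_all _ fun ω => ?_) (integrable_total h).abs ?_
  · rw [norm_mul, Real.norm_of_nonneg (stdDensity_pos _).le]
    exact mul_le_of_le_one_right (norm_nonneg _) (stdDensity_le_one _)
  · exact ae_of_all _ fun ω => continuous_const.mul (continuous_stdDensity.comp (by fun_prop))

/-- Follows from H₁(z - tS) = (z - tS) φ(z - tS). In this form the drift is what differentiating s_t
Θ_t produces; in its original form it splits over coordinates. -/
theorem drift_eq (h : IsStdLaw μ) (t z : ℝ) :
    drift μ n t z = (1 + n * t ^ 2) * smoothMoment μ n t z - n * t * (z * smoothDensity μ n t z) := by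
  have i1 := integrable_total_mul_stdDensity (n := n) h t z
  have i2 : Integrable (fun ω : Fin n → ℝ => stdDensity (z - t * total ω)) (iidLaw μ n) :=
    integrable_stdDensity_comp (by fun_prop)
  rw [drift, smoothMoment, smoothDensity, ← integral_const_mul, ← integral_const_mul,
    ← integral_const_mul, ← integral_sub (i1.const_mul _) ((i2.const_mul z).const_mul _)]
  congr 1; ext ω; rw [hermOne]; ring

theorem hasDerivAt_scale (n : ℕ) (t : ℝ) :
    HasDerivAt (fun t : ℝ => √n / √(1 + n * t ^ 2)) (-(n * t) * speed n t) t := by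
  have hpos : 0 < 1 + n * t ^ 2 := by positivity
  have h1 := ((((hasDerivAt_pow 2 t).const_mul (n : ℝ)).const_add 1).sqrt hpos.ne').fun_inv
    (Real.sqrt_pos.2 hpos).ne'
  refine (h1.const_mul (√n)).congr_deriv ?_
  have := (Real.sqrt_pos.2 hpos).ne'
  rw [speed]
  field_simp
  simp

/-- Product rule: s_t contributes -n t Θ_t and the flow (1 + n t²) E[S φ(Θ_t - tS)] / f_t, with
common factor `speed n t`. -/
theorem hasDerivAt_scale_mul_flowMap (h : IsStdLaw μ) (T t τ : ℝ) :
    HasDerivAt (fun t => √n / √(1 + n * t ^ 2) * flowMap μ n T t τ)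
      (speed n t * (drift μ n t (flowMap μ n T t τ) / smoothDensity μ n t (flowMap μ n T t τ)))
      t := by
  refine ((hasDerivAt_scale n t).mul (hasDerivAt_flowMap h T t τ)).congr_deriv ?_
  rw [drift_eq h]
  have hf := (smoothDensity_pos (μ := μ) (n := n) t (flowMap μ n T t τ)).ne'
  have hpos : 0 < 1 + n * t ^ 2 := by positivity
  have hr := (Real.sqrt_pos.2 hpos).ne'
  have hr2 : √(1 + n * t ^ 2) ^ 2 = 1 + n * t ^ 2 := Real.sq_sqrt hpos.le
  rw [speed]
  generalize √(1 + n * t ^ 2) = r at hr hr2 ⊢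
  rw [← hr2]
  field_simp
  ring

/-- Fundamental theorem of calculus along a trajectory: the flow is the identity at time T, and the
scale is √n at time 0. -/
theorem enorm_scale_mul_flowMap_sub_le (h : IsStdLaw μ) {T : ℝ} (hT : 0 ≤ T) (τ : ℝ) :
    ‖√n / √(1 + n * T ^ 2) * τ - √n * flowMap μ n T 0 τ‖ₑ
      ≤ ∫⁻ t in Set.Ioc 0 T, ENNReal.ofReal (speed n t)
        * ((ENNReal.ofReal (smoothDensity μ n t (flowMap μ n T t τ)))⁻¹
          * ‖drift μ n t (flowMap μ n T t τ)‖ₑ) := by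
  have hθ : Continuous fun t => flowMap μ n T t τ :=
    (continuous_flowMap T).comp (by fun_prop : Continuous fun t : ℝ => (t, τ))
  have hp : Continuous fun t => (t, flowMap μ n T t τ) := by fun_prop
  have hf : Continuous fun t => smoothDensity μ n t (flowMap μ n T t τ) := by
    have := (continuous_smoothDensity (μ := μ) (n := n)).comp hp
    simp only [Function.comp_def] at this
    exact this
  have hm : Continuous fun t => smoothMoment μ n t (flowMap μ n T t τ) := by
    have := (continuous_smoothMoment (n := n) h).comp hp
    simp only [Function.comp_def] at this
    exact this
  have hs : Continuous fun t => speed n t := by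
    unfold speed
    exact Continuous.div (by fun_prop) (by fun_prop) fun t =>
      (pow_pos (Real.sqrt_pos.2 (by positivity : 0 < 1 + n * t ^ 2)) 3).ne'
  have hc : Continuous fun t => speed n t * (drift μ n t (flowMap μ n T t τ)
      / smoothDensity μ n t (flowMap μ n T t τ)) := by
    simp only [drift_eq h]
    exact hs.mul (Continuous.div (by fun_prop) hf fun t => (smoothDensity_pos _ _).ne')
  have key := intervalIntegral.integral_eq_sub_of_hasDerivAt (a := 0) (b := T)
    (fun t _ => hasDerivAt_scale_mul_flowMap (n := n) h T t τ) (hc.intervalIntegrable 0 T)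
  have e : √n / √(1 + n * T ^ 2) * τ - √n * flowMap μ n T 0 τ
      = ∫ t in (0 : ℝ)..T, speed n t * (drift μ n t (flowMap μ n T t τ)
      / smoothDensity μ n t (flowMap μ n T t τ)) := by
    rw [key, flowMap_self]; simp
  rw [e, intervalIntegral.integral_of_le hT]
  refine (enorm_integral_le_lintegral_enorm _).trans_eq (lintegral_congr fun t => ?_)
  have hf := smoothDensity_pos (μ := μ) (n := n) t (flowMap μ n T t τ)
  rw [enorm_mul, div_eq_inv_mul, enorm_mul, enorm_inv hf.ne', Real.enorm_of_nonneg hf.le,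
    Real.enorm_of_nonneg (speed_nonneg n t)]

end Flow


/-! ### The coupling and its cost -/

section Coupling

variable {n : ℕ} {μ : Measure ℝ} [IsProbabilityMeasure μ]

/-- ψ_x is the infimal convolution of t²/4 and x|t|. For |v| > 2x the inequality is (u/2 - x)² ≥ 0;
for u ≤ |v| ≤ 2x, it follows from |v|² - u² ≤ 4x (|v| - u). -/
theorem psiCost_le {x u b v : ℝ} (hx : 0 < x) (hb : 0 ≤ b) (hv : |v| ≤ u + b) :
    psiCost x v ≤ u ^ 2 / 4 + x * b := by
  have hv0 := abs_nonneg v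
  rw [psiCost]
  split_ifs with h
  · rw [← sq_abs]
    rcases le_total |v| u with h1 | h1
    · have : |v| ^ 2 ≤ u ^ 2 := by gcongr
      nlinarith [mul_nonneg hx.le hb]
    · have h2 : |v| ^ 2 - u ^ 2 ≤ (|v| - u) * (4 * x) := by
        have : |v| ^ 2 - u ^ 2 = (|v| - u) * (|v| + u) := by ring
        rw [this]
        exact mul_le_mul_of_nonneg_left (by linarith) (by linarith)
      nlinarith
  · rw [abs_mul, abs_of_pos hx]
    nlinarith [sq_nonneg (u / 2 - x), mul_le_mul_of_nonneg_right hv hx.le]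

theorem ofReal_psiCost_add_le {x : ℝ} (hx : 0 < x) (d e : ℝ) {A B : ℝ≥0∞} (h : ‖e‖ₑ ≤ A + B) :
    ENNReal.ofReal (psiCost x (d + e))
      ≤ ENNReal.ofReal (1 / 4) * (‖d‖ₑ + A) ^ 2 + ENNReal.ofReal x * B := by
  rcases eq_or_ne A ⊤ with rfl | hA
  · rw [add_top, ENNReal.top_pow two_ne_zero, ENNReal.mul_top (by norm_num)]; simp
  rcases eq_or_ne B ⊤ with rfl | hB
  · rw [ENNReal.mul_top (by simpa using hx)]; simp
  lift A to ℝ≥0 using hA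
  lift B to ℝ≥0 using hB
  have h1 : |e| ≤ A + B := by
    rw [← Real.norm_eq_abs, ← coe_nnnorm, ← NNReal.coe_add, NNReal.coe_le_coe]
    exact_mod_cast h
  have h2 := psiCost_le (v := d + e) (u := |d| + A) hx B.coe_nonneg
    ((abs_add_le _ _).trans (by linarith : |d| + |e| ≤ |d| + A + B))
  refine (ENNReal.ofReal_le_ofReal h2).trans (le_of_eq ?_)
  have hdA : 0 ≤ |d| + A := add_nonneg (abs_nonneg d) A.coe_nonneg
  rw [ENNReal.ofReal_add (by positivity) (mul_nonneg hx.le B.coe_nonneg), ENNReal.ofReal_mul hx.le,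
    div_eq_mul_one_div, mul_comm _ (1 / 4 : ℝ),
    ENNReal.ofReal_mul (by norm_num), ENNReal.ofReal_pow hdA,
    ENNReal.ofReal_add (abs_nonneg d) A.coe_nonneg, ← Real.enorm_eq_ofReal_abs,
    ENNReal.ofReal_coe_nnreal, ENNReal.ofReal_coe_nnreal]

/-- The sum of the main part over the flow. -/
noncomputable def flowMain (μ : Measure ℝ) [IsProbabilityMeasure μ] (n : ℕ) (T : ℝ)
    (q : ℝ → ℝ → ℝ≥0∞) (τ : ℝ) : ℝ≥0∞ :=
  ∫⁻ t in Set.Ioc 0 T, ENNReal.ofReal (speed n t)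
    * ((ENNReal.ofReal (smoothDensity μ n t (flowMap μ n T t τ)))⁻¹ * q t (flowMap μ n T t τ))

theorem measurable_smoothDensity_uncurry :
    Measurable fun p : ℝ × ℝ => smoothDensity μ n p.1 p.2 := continuous_smoothDensity.measurable

theorem measurable_flowMap (T t : ℝ) : Measurable (flowMap μ n T t) :=
  ((continuous_flowMap T).comp (by fun_prop : Continuous fun τ : ℝ => (t, τ))).measurable

theorem measurable_speed (n : ℕ) : Measurable (speed n) := by unfold speed; fun_prop

theorem measurable_flowMain_integrand (T : ℝ) {q : ℝ → ℝ → ℝ≥0∞}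
    (hq : Measurable fun p : ℝ × ℝ => q p.1 p.2) :
    Measurable (Function.uncurry fun t τ => ENNReal.ofReal (speed n t)
      * ((ENNReal.ofReal (smoothDensity μ n t (flowMap μ n T t τ)))⁻¹
        * q t (flowMap μ n T t τ))) := by
  have hp : Measurable fun p : ℝ × ℝ => (p.1, flowMap μ n T p.1 p.2) :=
    measurable_fst.prodMk (continuous_flowMap T).measurable
  have h1 := ((measurable_smoothDensity_uncurry (μ := μ) (n := n)).ennreal_ofReal.inv.mul hq).comp hp
  exact ((measurable_speed n).ennreal_ofReal.comp measurable_fst).mul h1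

theorem measurable_flowMain (T : ℝ) {q : ℝ → ℝ → ℝ≥0∞}
    (hq : Measurable fun p : ℝ × ℝ => q p.1 p.2) : Measurable (flowMain μ n T q) :=
  (measurable_flowMain_integrand T hq).lintegral_prod_left'

theorem lintegral_smoothLaw_inv_mul (t : ℝ) (g : ℝ → ℝ≥0∞) (hg : Measurable g) :
    ∫⁻ z, (ENNReal.ofReal (smoothDensity μ n t z))⁻¹ * g z ∂(smoothLaw μ n t) = ∫⁻ z, g z := by
  have hm : Measurable fun z => ENNReal.ofReal (smoothDensity μ n t z) :=
    (measurable_smoothDensity t).ennreal_ofReal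
  rw [smoothLaw, lintegral_withDensity_eq_lintegral_mul _ hm (by fun_prop)]
  refine lintegral_congr fun z => ?_
  have h0 : ENNReal.ofReal (smoothDensity μ n t z) ≠ 0 := by simpa using smoothDensity_pos t z
  simp only [Pi.mul_apply]
  rw [← mul_assoc, ENNReal.mul_inv_cancel h0 ENNReal.ofReal_ne_top, one_mul]

theorem lintegral_flowMain (T : ℝ) {q : ℝ → ℝ → ℝ≥0∞}
    (hq : Measurable fun p : ℝ × ℝ => q p.1 p.2) :
    ∫⁻ τ, flowMain μ n T q τ ∂(smoothLaw μ n T)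
      = ∫⁻ t in Set.Ioc 0 T, ENNReal.ofReal (speed n t) * ∫⁻ z, q t z := by
  unfold flowMain
  have hm := measurable_flowMain_integrand (μ := μ) (n := n) T hq
  rw [lintegral_lintegral_swap (f := fun τ t => ENNReal.ofReal (speed n t)
      * ((ENNReal.ofReal (smoothDensity μ n t (flowMap μ n T t τ)))⁻¹
        * q t (flowMap μ n T t τ))) (hm.comp measurable_swap).aemeasurable]
  refine lintegral_congr fun t => ?_
  have hqt : Measurable (q t) := hq.comp (by fun_prop : Measurable fun z : ℝ => (t, z))
  have hm : Measurable fun z => (ENNReal.ofReal (smoothDensity μ n t z))⁻¹ * q t z :=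
    (measurable_smoothDensity t).ennreal_ofReal.inv.mul hqt
  rw [lintegral_const_mul' _ _ ENNReal.ofReal_ne_top, ← lintegral_smoothLaw_inv_mul (μ := μ) (n := n) t _ hqt,
    ← map_flowMap (μ := μ) (n := n) T t, lintegral_map hm (measurable_flowMap (μ := μ) (n := n) T t)]

/-- Minkowski's inequality in time, then change of variables by the flow: under the law at time T
the flow at time t has density f_t, so the squared norm of q/f_t is the integral of q²/f_t. -/
theorem l2norm_flowMain_le (T : ℝ) {q : ℝ → ℝ → ℝ≥0∞}
    (hq : Measurable fun p : ℝ × ℝ => q p.1 p.2) :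
    l2norm (smoothLaw μ n T) (flowMain μ n T q)
      ≤ ∫⁻ t in Set.Ioc 0 T, ENNReal.ofReal (speed n t)
        * l2norm (invWeight (smoothDensity μ n t)) (q t) := by
  refine (l2norm_lintegral_le (measurable_flowMain_integrand (μ := μ) (n := n) T hq)).trans
    (lintegral_mono fun t => ?_)
  have hqt : Measurable (q t) := hq.comp (by fun_prop : Measurable fun z : ℝ => (t, z))
  have hm : Measurable fun z => (ENNReal.ofReal (smoothDensity μ n t z))⁻¹ * q t z :=
    (measurable_smoothDensity t).ennreal_ofReal.inv.mul hqt
  have hm2 := hm.comp (measurable_flowMap (μ := μ) (n := n) T t)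
  simp only [Function.comp_def] at hm2
  rw [l2norm_const_mul hm2.aemeasurable]
  gcongr
  refine l2norm_le_of_sq_le (le_of_eq ?_)
  rw [l2norm_sq, lintegral_invWeight (measurable_smoothDensity t) (smoothDensity_pos t)]
  have h2 : ∀ z, (ENNReal.ofReal (smoothDensity μ n t z))⁻¹ * q t z ^ 2
      = ENNReal.ofReal (smoothDensity μ n t z)
        * ((ENNReal.ofReal (smoothDensity μ n t z))⁻¹ * q t z) ^ 2 := fun z => by
    have h0 : ENNReal.ofReal (smoothDensity μ n t z) ≠ 0 := by simpa using smoothDensity_pos t z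
    rw [mul_pow, sq (ENNReal.ofReal _)⁻¹, ← mul_assoc, ← mul_assoc,
      ENNReal.mul_inv_cancel h0 ENNReal.ofReal_ne_top, one_mul]
  simp only [h2]
  have h3 := lintegral_withDensity_eq_lintegral_mul volume
    (measurable_smoothDensity (μ := μ) (n := n) t).ennreal_ofReal (hm.pow_const 2)
  simp only [Pi.mul_apply] at h3
  rw [← h3, ← lintegral_map (f := fun z => ((ENNReal.ofReal (smoothDensity μ n t z))⁻¹
    * q t z) ^ 2) (hm.pow_const 2) (measurable_flowMap T t), map_flowMap]
  rfl

theorem lintegral_sq_sub_gaussian (c β : ℝ) :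
    ∫⁻ g, ENNReal.ofReal ((c - β * g) ^ 2) ∂(gaussianReal 0 1)
      = ENNReal.ofReal (c ^ 2 + β ^ 2) := by
  have h2 : Integrable (fun g : ℝ => g ^ 2) (gaussianReal 0 1) :=
    (memLp_id_gaussianReal (μ := 0) (v := 1) 2).integrable_sq
  have h1 : Integrable (fun g : ℝ => g) (gaussianReal 0 1) :=
    (memLp_id_gaussianReal (μ := 0) (v := 1) 1).integrable le_rfl
  have e1 : ∫ g, g ∂(gaussianReal 0 1) = 0 := integral_id_gaussianReal
  have e2 : ∫ g, g ^ 2 ∂(gaussianReal 0 1) = 1 := by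
    have := variance_id_gaussianReal (μ := 0) (v := 1)
    rw [variance_of_integral_eq_zero aemeasurable_id e1] at this
    simpa using this
  have e : (fun g : ℝ => (c - β * g) ^ 2) = fun g => c ^ 2 + (-(2 * c * β)) * g + β ^ 2 * g ^ 2 := by
    ext g; ring
  have hi0 : Integrable (fun g : ℝ => c ^ 2 + (-(2 * c * β)) * g) (gaussianReal 0 1) :=
    (integrable_const _).fun_add (h1.const_mul _)
  have hi : Integrable (fun g : ℝ => (c - β * g) ^ 2) (gaussianReal 0 1) := by
    rw [e]; exact hi0.fun_add (h2.const_mul _)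
  rw [← ofReal_integral_eq_lintegral_ofReal hi (ae_of_all _ fun _ => sq_nonneg _), e,
    integral_add hi0 (h2.const_mul _), integral_add (integrable_const _) (h1.const_mul _),
    integral_const_mul, integral_const_mul, e1, e2]
  simp

/-- The left side is the variance of S - s(TS + G). With q = sT and s²(1 + nT²) = n it equals 2n(1 -
q), while nT²(1 - q²) = q²; multiplied by T²(1 + q) the claim becomes 2q² ≤ 1 + q, true as 0 < q ≤
1. -/
theorem scale_bound {n : ℕ} {T : ℝ} (hn : 1 ≤ n) (hT : 0 < T) :
    n * (1 - √n / √(1 + n * T ^ 2) * T) ^ 2 + (√n / √(1 + n * T ^ 2)) ^ 2 ≤ (1 / T) ^ 2 := by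
  have hn0 : (0 : ℝ) < n := by exact_mod_cast hn
  set s := √n / √(1 + n * T ^ 2) with hs
  have hs0 : 0 < s := by positivity
  have hs2 : s ^ 2 * (1 + n * T ^ 2) = n := by
    rw [hs, div_pow, Real.sq_sqrt hn0.le, Real.sq_sqrt (by positivity), div_mul_cancel₀]
    positivity
  have hq : s * T ≤ 1 := by
    have h1 : (s * T) ^ 2 ≤ 1 := by
      have : n * (s * T) ^ 2 ≤ n * 1 := by nlinarith [sq_nonneg s]
      exact le_of_mul_le_mul_left this hn0
    nlinarith [mul_pos hs0 hT]
  have e : n * (1 - s * T) ^ 2 + s ^ 2 = 2 * n * (1 - s * T) := by linear_combination hs2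
  rw [e, div_pow, one_pow, le_div_iff₀ (by positivity)]
  set q := s * T with hqd
  have hq0 : 0 < q := mul_pos hs0 hT
  have h3 : n * T ^ 2 * (1 - q ^ 2) = q ^ 2 := by
    rw [hqd]; linear_combination (-T ^ 2) * hs2
  have h4 : 2 * n * (1 - q) * T ^ 2 * ((1 + q) * 1) ≤ 1 * ((1 + q) * 1) := by
    have : 2 * n * (1 - q) * T ^ 2 * ((1 + q) * 1) = 2 * q ^ 2 := by linear_combination 2 * h3
    rw [this]; nlinarith
  exact le_of_mul_le_mul_right h4 (by positivity)

theorem lintegral_total_sq_le (h : IsStdLaw μ) (n : ℕ) :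
    ∫⁻ ω : Fin n → ℝ, ENNReal.ofReal (total ω ^ 2) ∂(iidLaw μ n) ≤ n := by
  have h1 := l2norm_sum_sub_mean_le n (c := fun a => a) measurable_id h.integrable_sq
  rw [← ofReal_integral_eq_lintegral_ofReal h.integrable_sq (ae_of_all _ fun _ => sq_nonneg _),
    h.var, h.mean] at h1
  have h2 := pow_le_pow_left' h1 2
  rw [l2norm_sq] at h2
  simp only [mul_zero, sub_zero, ENNReal.ofReal_one, ENNReal.one_rpow, mul_one] at h2
  rw [← ENNReal.ofReal_pow (Real.sqrt_nonneg _), Real.sq_sqrt n.cast_nonneg,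
    ENNReal.ofReal_natCast] at h2
  refine le_trans (le_of_eq (lintegral_congr fun ω => ?_)) h2
  rw [Real.enorm_eq_ofReal_abs, ← ENNReal.ofReal_pow (abs_nonneg _), sq_abs, total]

theorem lintegral_comp_smooth (T : ℝ) {g : ℝ → ℝ≥0∞} (hg : Measurable g) :
    ∫⁻ p, g (T * total p.1 + p.2) ∂((iidLaw μ n).prod (gaussianReal 0 1))
      = ∫⁻ τ, g τ ∂(smoothLaw μ n T) := by
  rw [lintegral_smoothLaw T hg, lintegral_prod _ (Measurable.aemeasurable (by fun_prop))]

theorem l2norm_initial_le (h : IsStdLaw μ) {n : ℕ} (hn : 1 ≤ n) {T : ℝ} (hT : 0 < T) :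
    l2norm ((iidLaw μ n).prod (gaussianReal 0 1))
      (fun p => ‖total p.1 - √n / √(1 + n * T ^ 2) * (T * total p.1 + p.2)‖ₑ)
      ≤ ENNReal.ofReal (1 / T) := by
  apply l2norm_le_of_sq_le
  set s := √n / √(1 + n * T ^ 2) with hs
  have e : ∀ p : (Fin n → ℝ) × ℝ, ‖total p.1 - s * (T * total p.1 + p.2)‖ₑ ^ 2
      = ENNReal.ofReal (((1 - s * T) * total p.1 - s * p.2) ^ 2) := fun p => by
    rw [Real.enorm_eq_ofReal_abs, ← ENNReal.ofReal_pow (abs_nonneg _), sq_abs]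
    congr 1; ring
  simp only [e]
  rw [lintegral_prod _ (Measurable.aemeasurable (by fun_prop))]
  simp only [lintegral_sq_sub_gaussian]
  calc ∫⁻ ω : Fin n → ℝ, ENNReal.ofReal (((1 - s * T) * total ω) ^ 2 + s ^ 2) ∂(iidLaw μ n)
      = ∫⁻ ω : Fin n → ℝ, (ENNReal.ofReal ((1 - s * T) ^ 2) * ENNReal.ofReal (total ω ^ 2)
          + ENNReal.ofReal (s ^ 2)) ∂(iidLaw μ n) := by
        refine lintegral_congr fun ω => ?_
        rw [ENNReal.ofReal_add (sq_nonneg _) (sq_nonneg _), mul_pow,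
          ENNReal.ofReal_mul (sq_nonneg _)]
    _ = ENNReal.ofReal ((1 - s * T) ^ 2) * (∫⁻ ω : Fin n → ℝ, ENNReal.ofReal (total ω ^ 2)
          ∂(iidLaw μ n)) + ENNReal.ofReal (s ^ 2) := by
        rw [lintegral_add_right _ measurable_const, lintegral_const_mul _ (by fun_prop),
          lintegral_const, measure_univ, mul_one]
    _ ≤ ENNReal.ofReal ((1 - s * T) ^ 2) * ENNReal.ofReal n + ENNReal.ofReal (s ^ 2) := by
        gcongr
        rw [ENNReal.ofReal_natCast]; exact lintegral_total_sq_le h n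
    _ = ENNReal.ofReal (n * (1 - s * T) ^ 2 + s ^ 2) := by
        rw [← ENNReal.ofReal_mul (sq_nonneg _), ← ENNReal.ofReal_add (by positivity)
          (sq_nonneg _), mul_comm]
    _ ≤ ENNReal.ofReal (1 / T) ^ 2 := by
        rw [← ENNReal.ofReal_pow (by positivity)]
        exact ENNReal.ofReal_le_ofReal (scale_bound hn hT)

/-- Transport cost bound from the two parts of the velocity. -/
theorem transportCost_le (h : IsStdLaw μ) {n : ℕ} (hn : 1 ≤ n) {x T R LA LB : ℝ} (hx : 0 < x)
    (hT : 0 < T) (hLA : 0 ≤ LA) (hLB : 0 ≤ LB)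
    (hA : ∫⁻ t in Set.Ioc 0 T, ENNReal.ofReal (speed n t)
        * l2norm (invWeight (smoothDensity μ n t)) (driftMain μ n R t) ≤ ENNReal.ofReal LA)
    (hB : ∫⁻ t in Set.Ioc 0 T, ENNReal.ofReal (speed n t) * ∫⁻ z, driftRest μ n R t z
      ≤ ENNReal.ofReal LB) :
    transportCost (psiCost x) ((iidLaw μ n).map total) (gaussianReal 0 n)
      ≤ ENNReal.ofReal ((1 / T + LA) ^ 2 / 4 + x * LB) := by
  set Q := (iidLaw μ n).prod (gaussianReal 0 1)
  have hθ := measurable_flowMap (μ := μ) (n := n) T 0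
  set s := √n / √(1 + n * T ^ 2) with hs
  have hV : Measurable fun p : (Fin n → ℝ) × ℝ => √n * flowMap μ n T 0 (T * total p.1 + p.2) :=
    (hθ.comp (by fun_prop : Measurable fun p : (Fin n → ℝ) × ℝ =>
      T * total p.1 + p.2)).const_mul _
  have hU : Measurable fun p : (Fin n → ℝ) × ℝ => total p.1 := by fun_prop
  have hpair := hU.prodMk hV
  -- The second component is N(0, n): the flow sends the law of TS + G at time T to the standard
  -- Gaussian law at time 0.
  have hmem : Q.map (fun p => (total p.1, √n * flowMap μ n T 0 (T * total p.1 + p.2)))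
      ∈ couplings ((iidLaw μ n).map total) (gaussianReal 0 n) := by
    constructor
    · rw [Measure.map_map measurable_fst hpair]
      have : (Prod.fst ∘ fun p : (Fin n → ℝ) × ℝ =>
          (total p.1, √n * flowMap μ n T 0 (T * total p.1 + p.2))) = total ∘ Prod.fst := rfl
      rw [this, ← Measure.map_map measurable_total measurable_fst, Measure.map_fst_prod]
      simp
    · rw [Measure.map_map measurable_snd hpair]
      have e1 : Q.map (fun p => T * total p.1 + p.2) = smoothLaw μ n T := by
        refine Measure.ext_of_lintegral _ fun g hg => ?_
        rw [lintegral_map hg (by fun_prop), lintegral_comp_smooth T hg]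
      have e2 : (Prod.snd ∘ fun p : (Fin n → ℝ) × ℝ =>
          (total p.1, √n * flowMap μ n T 0 (T * total p.1 + p.2)))
          = (fun y => √n * y) ∘ flowMap μ n T 0 ∘ fun p => T * total p.1 + p.2 := rfl
      rw [e2, ← Measure.map_map (by fun_prop) (hθ.comp (by fun_prop)),
        ← Measure.map_map hθ (by fun_prop), e1, map_flowMap, smoothLaw_zero,
        gaussianReal_map_const_mul]
      congr 1
      · simp
      · ext; simp
  have mA := measurable_flowMain (μ := μ) (n := n) T (measurable_driftMain (μ := μ) (n := n) R)
  have mB := measurable_flowMain (μ := μ) (n := n) T (measurable_driftRest (μ := μ) (n := n) R)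
  have hτ : Measurable fun p : (Fin n → ℝ) × ℝ => T * total p.1 + p.2 := by fun_prop
  refine (iInf₂_le _ hmem).trans ?_
  have hψ : Measurable (psiCost x) := by
    unfold psiCost
    exact Measurable.ite (measurableSet_le (by fun_prop) measurable_const) (by fun_prop)
      (by fun_prop)
  rw [lintegral_map (by fun_prop) hpair]
  have pt : ∀ p : (Fin n → ℝ) × ℝ, ENNReal.ofReal (psiCost x (total p.1
      - √n * flowMap μ n T 0 (T * total p.1 + p.2)))
      ≤ ENNReal.ofReal (1 / 4) * (‖total p.1 - s * (T * total p.1 + p.2)‖ₑ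
        + flowMain μ n T (driftMain μ n R) (T * total p.1 + p.2)) ^ 2
        + ENNReal.ofReal x * flowMain μ n T (driftRest μ n R) (T * total p.1 + p.2) := fun p => by
    -- The initial error is square integrable and joins the quadratic part; the displacement along
    -- the flow is dominated by the main plus the remaining velocity.
    have e : total p.1 - √n * flowMap μ n T 0 (T * total p.1 + p.2)
        = (total p.1 - s * (T * total p.1 + p.2)) + (s * (T * total p.1 + p.2)
          - √n * flowMap μ n T 0 (T * total p.1 + p.2)) := by ring
    rw [e]
    refine ofReal_psiCost_add_le hx _ _ ((enorm_scale_mul_flowMap_sub_le h hT.le _).trans ?_)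
    generalize T * total p.1 + p.2 = τ
    have hqm := (measurable_flowMain_integrand (μ := μ) (n := n) T
      (measurable_driftMain (μ := μ) (n := n) R)).comp (by fun_prop : Measurable fun t : ℝ => (t, τ))
    simp only [Function.comp_def, Function.uncurry] at hqm
    rw [flowMain, flowMain, ← lintegral_add_left hqm]
    refine lintegral_mono fun t => ?_
    rw [← mul_add, ← mul_add]
    gcongr
    exact enorm_drift_le h R t _
  refine (lintegral_mono pt).trans ?_
  have mD : Measurable fun p : (Fin n → ℝ) × ℝ =>
      ‖total p.1 - s * (T * total p.1 + p.2)‖ₑ := by fun_prop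
  have mA' := mA.comp hτ
  have mB' := mB.comp hτ
  simp only [Function.comp_def] at mA' mB'
  have mDA : Measurable fun p : (Fin n → ℝ) × ℝ => (‖total p.1 - s * (T * total p.1 + p.2)‖ₑ
      + flowMain μ n T (driftMain μ n R) (T * total p.1 + p.2)) ^ 2 := (mD.add mA').pow_const 2
  rw [lintegral_add_right _ (mB'.const_mul _),
    lintegral_const_mul _ mDA, lintegral_const_mul _ mB',
    ← l2norm_sq, lintegral_comp_smooth T mB, lintegral_flowMain T (measurable_driftRest R)]
  have hl2 : l2norm Q (fun p => ‖total p.1 - s * (T * total p.1 + p.2)‖ₑ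
        + flowMain μ n T (driftMain μ n R) (T * total p.1 + p.2))
      ≤ ENNReal.ofReal (1 / T + LA) := by
    refine (l2norm_add_le mD.aemeasurable mA'.aemeasurable).trans ?_
    rw [ENNReal.ofReal_add (by positivity) hLA]
    refine add_le_add (l2norm_initial_le h hn hT) ?_
    have e : l2norm Q (fun p => flowMain μ n T (driftMain μ n R) (T * total p.1 + p.2))
        = l2norm (smoothLaw μ n T) (flowMain μ n T (driftMain μ n R)) := by
      rw [l2norm, l2norm, lintegral_comp_smooth T (g := fun τ =>
        flowMain μ n T (driftMain μ n R) τ ^ 2) (mA.pow_const 2)]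
    rw [e]
    exact (l2norm_flowMain_le T (measurable_driftMain R)).trans hA
  calc _ ≤ ENNReal.ofReal (1 / 4) * ENNReal.ofReal (1 / T + LA) ^ 2
        + ENNReal.ofReal x * ENNReal.ofReal LB := by gcongr
    _ = _ := by
        rw [← ENNReal.ofReal_pow (by positivity), ← ENNReal.ofReal_mul (by norm_num),
          ← ENNReal.ofReal_mul hx.le, ← ENNReal.ofReal_add (by positivity) (by positivity)]
        congr 1; ring

end Coupling


/-! ### Choice of the time T and comparison of constants -/

section Standard

variable {n : ℕ} {μ : Measure ℝ} [IsProbabilityMeasure μ]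

/-- This is 1 - y ≤ exp(-y) at y = 1/(4w²); it is all that is used later about the exponential
factor at T = 1/w. -/
theorem exp_quarter_le {w : ℝ} (hw : 0 < w) :
    Real.exp ((1 / w) ^ 2 / 4) * (1 - 1 / (4 * w ^ 2)) ≤ 1 := by
  have e : (1 / w) ^ 2 / 4 = 1 / (4 * w ^ 2) := by field_simp
  rw [e]
  set y := 1 / (4 * w ^ 2)
  have h := Real.one_sub_le_exp_neg y
  calc _ ≤ Real.exp y * Real.exp (-y) := by gcongr
    _ = 1 := by rw [← Real.exp_add]; simp

/-- Expanding, A²/4 is at most W² + 1.85 uW + 0.856 u², while the right side has 1.936 uS and more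
of u². The rest costs 4.2 xl, against 8 · 0.64584 xl available. -/
theorem squared_bound_of_le {A B x l u V W S : ℝ} (hA0 : 0 ≤ A) (hA : A ≤ 2 * W + 1.85 * u)
    (hB : B ≤ 4.2 * l) (hx : 0 ≤ x) (hu : 0 ≤ u) (hWS : W ≤ S)
    (hS2 : S ^ 2 = V + 1.6917 * u ^ 2 + 0.64584 * (8 * x * l)) (hW0 : 0 ≤ W) (hWV : W ^ 2 ≤ V)
    (hxl : 0 ≤ x * l) : A ^ 2 / 4 + x * B ≤ (S + 0.968 * u) ^ 2 := by
  have h1 := pow_le_pow_left₀ hA0 hA 2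
  have h2 : x * B ≤ x * (4.2 * l) := mul_le_mul_of_nonneg_left hB hx
  have h3 : u * W ≤ u * S := mul_le_mul_of_nonneg_left hWS hu
  have h4 : 0 ≤ u * S := mul_nonneg hu (hW0.trans hWS)
  have e1 : (2 * W + 1.85 * u) ^ 2 = 4 * W ^ 2 + 7.4 * (u * W) + 3.4225 * u ^ 2 := by ring
  have e2 : (S + 0.968 * u) ^ 2 = S ^ 2 + 1.936 * (u * S) + 0.937024 * u ^ 2 := by ring
  rw [e1] at h1
  rw [e2, hS2]
  linarith [sq_nonneg u]

/-- Bounds on the exponential factor `ε` at the terminal time `1 / w`. -/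
theorem factor_bounds {m lam k w ε : ℝ} (hm : 0 ≤ m) (hlam : 1 ≤ lam)
    (hkm : k ^ 2 ≤ m) (hw : 0 < w) (hw2 : w ^ 2 = 0.54 * m + 1.5 * lam ^ 2 + 2) (hε0 : 0 < ε)
    (hε : ε * (1 - 1 / (4 * w ^ 2)) ≤ 1) :
    ε ≤ 1.077 ∧ ε * m ≤ m + 0.5 ∧ ε * (1 / w) * k ≤ 1.3609 ∧ 1 / w * lam ≤ 0.8165 := by
  have hlam2 : 1 ≤ lam ^ 2 := by nlinarith
  have hw35 : 0.54 * m + 3.5 ≤ w ^ 2 := by linarith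
  have hwpos : 0 < w ^ 2 := by positivity
  set y := 1 / (4 * w ^ 2) with hy
  have hyw : y * w ^ 2 = 1 / 4 := by rw [hy]; field_simp
  have hy0 : 0 < y := by positivity
  -- From w² ≥ 3.5; then ε ≤ 14/13 < 1.077.
  have hy14 : y ≤ 1 / 14 := by nlinarith
  have hε1 : ε ≤ 1.077 := by nlinarith
  have hεm : ε * m ≤ m + 0.5 := by
    have h1 : ε - 1 ≤ ε * y := by linarith
    have h2 : m * y ≤ 0.25 / 0.54 := by
      have : 0.54 * m * y ≤ w ^ 2 * y := by gcongr; linarith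
      nlinarith
    have h3 : (ε - 1) * m ≤ ε * y * m := by gcongr
    nlinarith
  -- Since 1 - 2y ≤ (1 - y)², ε²(w² - 1/2) ≤ w². As 0.54 k² ≤ w² - 1/2, the ratio εk/w is at most
  -- 0.54^(-1/2) < 1.3609: the constant in w² absorbs the exponential factor.
  have hεk : ε * (1 / w) * k ≤ 1.3609 := by
    have h1 : ε ^ 2 * (1 - 2 * y) ≤ 1 := by
      have : (ε * (1 - y)) ^ 2 ≤ 1 := pow_le_one₀ (mul_nonneg hε0.le (by linarith)) hε
      nlinarith [mul_nonneg (sq_nonneg ε) (sq_nonneg y)]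
    have h2 : ε ^ 2 * (w ^ 2 - 1 / 2) ≤ w ^ 2 := by
      calc ε ^ 2 * (w ^ 2 - 1 / 2) = ε ^ 2 * (1 - 2 * y) * w ^ 2 := by
            linear_combination (2 * ε ^ 2) * hyw
        _ ≤ 1 * w ^ 2 := by gcongr
        _ = _ := one_mul _
    have h3 : ε ^ 2 * k ^ 2 ≤ 1.3609 ^ 2 * w ^ 2 := by
      have h4 : ε ^ 2 * (0.54 * k ^ 2) ≤ ε ^ 2 * (w ^ 2 - 1 / 2) := by
        gcongr; linarith
      nlinarith
    have h5 : ε * k ≤ 1.3609 * w :=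
      abs_le_of_sq_le_sq' (by nlinarith) (by positivity) |>.2
    have : ε * (1 / w) * k = ε * k / w := by field_simp
    rw [this, div_le_iff₀ hw]; exact h5
  -- From w² ≥ 1.5 λ², and 1/√1.5 < 0.8165.
  have hlw : 1 / w * lam ≤ 0.8165 := by
    have h5 : lam ≤ 0.8165 * w := abs_le_of_sq_le_sq' (by nlinarith) (by positivity) |>.2
    rw [one_div_mul_eq_div, div_le_iff₀ hw]; exact h5
  exact ⟨hε1, hεm, hεk, hlw⟩

/-- The choice of w nearly balances the two terms in m, as 0.575/1.07 is close to 0.54. The quotient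
by w² is replaced by the linear majorant 0.613 m + 2.5, so that the comparison becomes linear in m
and λ². -/
theorem moderate_part_sq_le {m lam w : ℝ} (hm : 0 ≤ m) (hlam : 1 ≤ lam) (hw : 0 < w)
    (hw2 : w ^ 2 = 0.54 * m + 1.5 * lam ^ 2 + 2) :
    ((1.07 * w + (0.575 * m + 2.92) / w) / 2) ^ 2
      ≤ 3.0376 + 3 / 5 * lam ^ 2 + 0.64584 * m := by
  have hlam2 : 1 ≤ lam ^ 2 := by nlinarith
  have hw35 : 0.54 * m + 3.5 ≤ w ^ 2 := by linarith
  have hwpos : 0 < w ^ 2 := by positivity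
  have e : ((1.07 * w + (0.575 * m + 2.92) / w) / 2) ^ 2 = (1.1449 * w ^ 2 + 2.14 * (0.575 * m + 2.92)
      + (0.575 * m + 2.92) ^ 2 / w ^ 2) / 4 := by
    field_simp; ring
  have h1 : (0.575 * m + 2.92) ^ 2 / w ^ 2 ≤ 0.613 * m + 2.5 := by
    rw [div_le_iff₀ hwpos]
    calc _ ≤ (0.613 * m + 2.5) * (0.54 * m + 3.5) := by nlinarith [sq_nonneg m]
      _ ≤ _ := by gcongr
  rw [e, hw2]
  rw [hw2] at h1
  linarith

/-- The constants are roundings of 0.575 · 0.5 + 1.98 · 1.077 + 0.5 ≤ 2.92 and (1 + 1.98 · 1.3609)/2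
≤ 1.85. -/
theorem moderate_part_le {m u k w ε : ℝ} (hu : 0 ≤ u) (hw : 0 < w)
    (hε1 : ε ≤ 1.077) (hεm : ε * m ≤ m + 0.5) (hεk : ε * (1 / w) * k ≤ 1.3609) :
    1 / (1 / w) + (ε * (0.575 * (1 / w) * m) + 0.07 / (1 / w)
      + (ε * (1.98 * (1 / w)) + 1 / w / 2)
      + u / 2 * (1 + ε * (1.98 * (1 / w) * k)))
      ≤ 2 * ((1.07 * w + (0.575 * m + 2.92) / w) / 2) + 1.85 * u := by
  have e1 : 2 * ((1.07 * w + (0.575 * m + 2.92) / w) / 2) = 1.07 * w + (0.575 * m + 2.92) * (1 / w) := by field_simp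
  have e2 : 1 / (1 / w) = w := one_div_one_div w
  have e3 : 0.07 / (1 / w) = 0.07 * w := by field_simp
  rw [e1, e2, e3]
  have hiw : 0 < 1 / w := by positivity
  have h1 : (0.575 * (ε * m) + 1.98 * ε + 1 / 2) * (1 / w) ≤ (0.575 * m + 2.92) * (1 / w) :=
    mul_le_mul_of_nonneg_right (by linarith) hiw.le
  have h2 : u / 2 * (1 + 1.98 * (ε * (1 / w) * k)) ≤ u / 2 * 3.7 := by gcongr; linarith
  calc _ = w + 0.07 * w + (0.575 * (ε * m) + 1.98 * ε + 1 / 2) * (1 / w)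
        + u / 2 * (1 + 1.98 * (ε * (1 / w) * k)) := by ring
    _ ≤ w + 0.07 * w + (0.575 * m + 2.92) * (1 / w) + u / 2 * 3.7 := by gcongr
    _ = _ := by ring

/-- With u ≤ λ the two correction terms are equal at worst, and Tλ ≤ 0.8165 turns them into
multiples of l. Keeping Tλ bounded is the purpose of the λ² term in w². -/
theorem large_part_le {lam u l w ε : ℝ} (hu : 0 ≤ u) (hul : u ≤ lam) (hl : 0 ≤ l) (hw : 0 < w)
    (hε0 : 0 < ε) (hε1 : ε ≤ 1.077) (hlw : 1 / w * lam ≤ 0.8165) :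
    ε * (1.7663 * l) + l / 2 * (1 + ε * (1.98 * (1 / w) * lam))
        + u / 2 * (ε * (1.98 * (1 / w) * l))
      ≤ 4.2 * l := by
  have hlam : 0 ≤ lam := hu.trans hul
  have h1 : ε * (1 / w * lam) ≤ 1.077 * 0.8165 :=
    mul_le_mul hε1 hlw (by positivity) (by norm_num)
  have h2 : u * (1 / w * (ε * l)) ≤ lam * (1 / w * (ε * l)) :=
    mul_le_mul_of_nonneg_right hul (by positivity)
  have h3 : ε * l ≤ 1.077 * l := mul_le_mul_of_nonneg_right hε1 hl
  have h4 : ε * (1 / w * lam) * l ≤ 1.077 * 0.8165 * l := mul_le_mul_of_nonneg_right h1 hl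
  calc _ = 1.7663 * (ε * l) + l / 2 + 0.99 * (ε * (1 / w * lam) * l)
        + 0.99 * (u * (1 / w * (ε * l))) := by ring
    _ ≤ 1.7663 * (ε * l) + l / 2 + 0.99 * (ε * (1 / w * lam) * l)
        + 0.99 * (ε * (1 / w * lam) * l) := by linarith
    _ ≤ _ := by linarith

/-- The final numerical comparison. -/
theorem numerical_bound {m lam u k l x w ε : ℝ} (hm : 0 ≤ m) (hlam : 1 ≤ lam) (hu : 0 ≤ u)
    (hul : u ≤ lam) (hk : 0 ≤ k) (hkm : k ^ 2 ≤ m) (hl : 0 ≤ l) (hx : 0 < x) (hw : 0 < w)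
    (hw2 : w ^ 2 = 0.54 * m + 1.5 * lam ^ 2 + 2) (hε0 : 0 < ε)
    (hε : ε * (1 - 1 / (4 * w ^ 2)) ≤ 1) :
    (1 / (1 / w) + (ε * (0.575 * (1 / w) * m) + 0.07 / (1 / w) + (ε * (1.98 * (1 / w)) + 1 / w / 2)
      + u / 2 * (1 + ε * (1.98 * (1 / w) * k)))) ^ 2 / 4
      + x * (ε * (1.7663 * l) + l / 2 * (1 + ε * (1.98 * (1 / w) * lam))
        + u / 2 * (ε * (1.98 * (1 / w) * l)))
      ≤ (√(3.0376 + 3 / 5 * lam ^ 2 + 1.6917 * u ^ 2 + 0.64584 * (m + 8 * x * l))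
        + 0.968 * u) ^ 2 := by
  obtain ⟨hε1, hεm, hεk, hlw⟩ := factor_bounds hm hlam hkm hw hw2 hε0 hε
  have hW0 : 0 ≤ (1.07 * w + (0.575 * m + 2.92) / w) / 2 := by positivity
  have hWV := moderate_part_sq_le hm hlam hw hw2
  have hA := moderate_part_le hu hw hε1 hεm hεk
  have hB := large_part_le hu hul hl hw hε0 hε1 hlw
  have hxl : 0 ≤ x * l := by positivity
  have hS2 := Real.sq_sqrt (show 0 ≤ 3.0376 + 3 / 5 * lam ^ 2 + 1.6917 * u ^ 2
    + 0.64584 * (m + 8 * x * l) by positivity)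
  refine squared_bound_of_le (by positivity) hA hB hx.le hu
    (Real.le_sqrt_of_sq_le (by linarith [sq_nonneg u])) ?_ hW0 hWV hxl
  rw [hS2]; ring

/-- Integrate a² ≤ (2|a|³ + 1)/3, the arithmetic-geometric mean inequality. -/
theorem IsStdLaw.one_le_cube (h : IsStdLaw μ) : 1 ≤ ∫ a, |a| ^ 3 ∂μ := by
  have h1 : ∫ a, a ^ 2 ∂μ ≤ ∫ a, (2 / 3 * |a| ^ 3 + 1 / 3) ∂μ := by
    refine integral_mono h.integrable_sq ((h.integrable_cube.const_mul _).fun_add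
      (integrable_const _)) fun a => ?_
    simp only
    rw [← sq_abs]
    have h0 := abs_nonneg a
    nlinarith [mul_nonneg h0 (sq_nonneg (|a| - 1)), sq_nonneg (|a| - 1)]
  rw [h.var, integral_add (h.integrable_cube.const_mul _) (integrable_const _),
    integral_const_mul] at h1
  simp only [integral_const, probReal_univ, smul_eq_mul] at h1
  linarith

-- Cauchy-Schwarz for |a| and a² on moderate values with unit variance, by integrating 2k|a|³ ≤ k²a²
-- + a⁴ at the optimal k.
omit [IsProbabilityMeasure μ] in
theorem moderate_cube_sq_le (h : IsStdLaw μ) {R : ℝ} (hR : 0 ≤ R) :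
    (∫ a, (1 - bigInd R a) * |a| ^ 3 ∂μ) ^ 2 ≤ ∫ a, (1 - bigInd R a) * a ^ 4 ∂μ := by
  set k := ∫ a, (1 - bigInd R a) * |a| ^ 3 ∂μ with hk
  have h4 := integrable_moderate_pow_four h hR
  have h1 : ∫ a, 2 * k * ((1 - bigInd R a) * |a| ^ 3) ∂μ
      ≤ ∫ a, (k ^ 2 * a ^ 2 + (1 - bigInd R a) * a ^ 4) ∂μ := by
    refine integral_mono ((integrable_moderate_cube h R).const_mul _)
      ((h.integrable_sq.const_mul _).fun_add h4) fun a => ?_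
    simp only
    have e : a ^ 4 = |a| ^ 4 := (Even.pow_abs (by decide) a).symm
    rw [e, ← sq_abs a]
    rcases bigInd_cases R a with ⟨h1, -⟩ | ⟨h1, -⟩
    · rw [h1]; nlinarith [sq_nonneg (k * |a| - |a| ^ 2)]
    · rw [h1]; simp only [sub_self, zero_mul, mul_zero, add_zero]; positivity
  rw [integral_const_mul, integral_add (h.integrable_sq.const_mul _) h4, integral_const_mul,
    h.var, ← hk] at h1
  nlinarith

-- Splitting at |a| = R separates the fourth moment of the main part from R times the third moment
-- of the rest; with R = 8x the latter matches the linear cost x l.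
omit [IsProbabilityMeasure μ] in
theorem integral_cube_mul_min (h : IsStdLaw μ) {R : ℝ} (hR : 0 ≤ R) :
    ∫ a, |a| ^ 3 * min |a| R ∂μ
      = (∫ a, (1 - bigInd R a) * a ^ 4 ∂μ) + R * ∫ a, bigInd R a * |a| ^ 3 ∂μ := by
  rw [← integral_const_mul, ← integral_add (integrable_moderate_pow_four h hR)
    ((integrable_bigInd_cube h R).const_mul R)]
  congr 1; ext a
  have e : a ^ 4 = |a| ^ 4 := (Even.pow_abs (by decide) a).symm
  rw [e]
  rcases bigInd_cases R a with ⟨h1, h2⟩ | ⟨h1, h2⟩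
  · rw [h1, min_eq_left h2]; ring
  · rw [h1, min_eq_right h2.le]; ring

/-- The transport cost bound for standardized laws. -/
theorem transportCost_std_le (h : IsStdLaw μ) (hn : 1 ≤ n) {x : ℝ} (hx : 0 < x) :
    transportCost (psiCost x) ((iidLaw μ n).map total) (gaussianReal 0 n)
      ≤ ENNReal.ofReal (√(3.0376 + 3 / 5 * (∫ a, |a| ^ 3 ∂μ) ^ 2 + 1.6917 * (∫ a, a ^ 3 ∂μ) ^ 2
        + 0.64584 * ∫ a, |a| ^ 3 * min |a| (8 * x) ∂μ) + 0.968 * |∫ a, a ^ 3 ∂μ|) ^ 2 := by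
  have hR : 0 ≤ 8 * x := by positivity
  have hB0 : ∀ a, 0 ≤ 1 - bigInd (8 * x) a := fun a => sub_nonneg.2 (bigInd_le_one _ a)
  have n4 : 0 ≤ ∫ a, (1 - bigInd (8 * x) a) * a ^ 4 ∂μ :=
    integral_nonneg fun a => mul_nonneg (hB0 a) (by positivity)
  have nk : 0 ≤ ∫ a, (1 - bigInd (8 * x) a) * |a| ^ 3 ∂μ :=
    integral_nonneg fun a => mul_nonneg (hB0 a) (by positivity)
  have nl : 0 ≤ ∫ a, bigInd (8 * x) a * |a| ^ 3 ∂μ :=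
    integral_nonneg fun a => mul_nonneg (bigInd_nonneg _ a) (by positivity)
  have hkm := moderate_cube_sq_le h hR
  have hlam := h.one_le_cube
  have hu : |∫ a, a ^ 3 ∂μ| ≤ ∫ a, |a| ^ 3 ∂μ := by
    refine abs_integral_le_integral_abs.trans_eq ?_
    simp only [abs_pow]
  have key := fun T (hT : 0 < T) => setLIntegral_speed_mul_driftMain_le h n hR hT
  have key2 := fun T (hT : 0 < T) => setLIntegral_speed_mul_driftRest_le h n (8 * x) hT
  rw [integral_cube_mul_min h hR, ← sq_abs (∫ a, a ^ 3 ∂μ)]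
  set m := ∫ a, (1 - bigInd (8 * x) a) * a ^ 4 ∂μ
  set k := ∫ a, (1 - bigInd (8 * x) a) * |a| ^ 3 ∂μ
  set l := ∫ a, bigInd (8 * x) a * |a| ^ 3 ∂μ
  set lam := ∫ a, |a| ^ 3 ∂μ
  set u := |∫ a, a ^ 3 ∂μ|
  have hu0 : 0 ≤ u := abs_nonneg _
  have hlam0 : 0 ≤ lam := by linarith
  -- The terminal time is T = 1/w. The term in m balances 1/T against T m, the term in λ² keeps Tλ
  -- bounded, and together with λ ≥ 1 the constant makes w² ≥ 3.5, so exp(T²/4) stays near 1.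
  obtain ⟨w, hw, hw2⟩ : ∃ w : ℝ, 0 < w ∧ w ^ 2 = 0.54 * m + 1.5 * lam ^ 2 + 2 :=
    ⟨√(0.54 * m + 1.5 * lam ^ 2 + 2), by positivity, Real.sq_sqrt (by positivity)⟩
  have hT : 0 < 1 / w := by positivity
  have hfin := numerical_bound n4 hlam hu0 hu nk hkm nl hx hw hw2 (Real.exp_pos ((1 / w) ^ 2 / 4))
    (exp_quarter_le hw)
  refine (transportCost_le h hn hx hT ?_ ?_ (key _ hT) (key2 _ hT)).trans ?_
  · positivity
  · positivity
  · rw [← ENNReal.ofReal_pow (by positivity)]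
    exact ENNReal.ofReal_le_ofReal hfin

end Standard


/-! ### Reduction to unit variance by scaling -/

theorem psiCost_mul {σ : ℝ} (hσ : 0 < σ) (x t : ℝ) :
    psiCost x (σ * t) = σ ^ 2 * psiCost (x / σ) t := by
  unfold psiCost
  have e : |σ * t| ≤ 2 * x ↔ |t| ≤ 2 * (x / σ) := by
    rw [abs_mul, abs_of_pos hσ, ← mul_div_assoc, le_div_iff₀ hσ, mul_comm]
  simp only [e]
  split_ifs
  · ring
  · have : |σ * t * x| = σ ^ 2 * |t * (x / σ)| := by
      have e2 : σ ^ 2 = |σ ^ 2| := (abs_of_pos (pow_pos hσ 2)).symm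
      rw [show σ * t * x = σ ^ 2 * (t * (x / σ)) by field_simp, abs_mul, ← e2]
    rw [this]; field_simp

theorem measurable_psiCost_sub (x : ℝ) :
    Measurable fun p : ℝ × ℝ => ENNReal.ofReal (psiCost x (p.1 - p.2)) := by
  refine Measurable.ennreal_ofReal ?_
  unfold psiCost
  exact Measurable.ite (measurableSet_le (by fun_prop) (by fun_prop)) (by fun_prop) (by fun_prop)

/-- Scaling both marginals by `σ` multiplies the cost by at most `σ²`, with parameter `x / σ`. -/
theorem transportCost_map_mul_le {σ : ℝ} (hσ : 0 < σ) (x : ℝ) (α β : Measure ℝ) :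
    transportCost (psiCost x) (α.map (σ * ·)) (β.map (σ * ·))
      ≤ ENNReal.ofReal (σ ^ 2) * transportCost (psiCost (x / σ)) α β := by
  have h0 : ENNReal.ofReal (σ ^ 2) ≠ 0 := by simpa using hσ.ne'
  rw [← ENNReal.div_le_iff' h0 ENNReal.ofReal_ne_top]
  refine le_iInf₂ fun π hπ => ?_
  rw [ENNReal.div_le_iff' h0 ENNReal.ofReal_ne_top]
  have hm : Measurable fun p : ℝ × ℝ => (σ * p.1, σ * p.2) := by fun_prop
  have hc : π.map (fun p : ℝ × ℝ => (σ * p.1, σ * p.2))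
      ∈ couplings (α.map (σ * ·)) (β.map (σ * ·)) := by
    constructor
    · rw [Measure.map_map measurable_fst hm, ← hπ.1,
        Measure.map_map (by fun_prop) measurable_fst]; rfl
    · rw [Measure.map_map measurable_snd hm, ← hπ.2,
        Measure.map_map (by fun_prop) measurable_snd]; rfl
  refine (iInf₂_le _ hc).trans_eq ?_
  rw [lintegral_map (measurable_psiCost_sub x) hm,
    ← lintegral_const_mul _ (measurable_psiCost_sub _)]
  refine lintegral_congr fun p => ?_
  rw [← mul_sub, psiCost_mul hσ, ENNReal.ofReal_mul (by positivity)]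

theorem gaussianReal_zero_mul_sq (n : ℕ) (σ : ℝ≥0) :
    gaussianReal 0 ((n : ℝ≥0) * σ ^ 2) = (gaussianReal 0 n).map ((σ : ℝ) * ·) := by
  rw [gaussianReal_map_const_mul]
  congr 1
  · simp
  · rw [mul_comm]; congr 1

/-! ### From the sequence of variables to the product law -/

section Transfer

variable {Ω : Type*} [MeasurableSpace Ω] {P : Measure Ω}

theorem isStdLaw_map [IsProbabilityMeasure P] {Y : Ω → ℝ} (hL3 : MemLp Y 3 P) (hcentered : ∫ ω, Y ω ∂P = 0)
    {σ : ℝ} (hσ : 0 < σ) (hvar : Var[Y; P] = σ ^ 2) :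
    IsStdLaw (P.map fun ω => σ⁻¹ * Y ω) := by
  have hY : AEMeasurable Y P := hL3.aestronglyMeasurable.aemeasurable
  have hσY : AEMeasurable (fun ω => σ⁻¹ * Y ω) P := hY.const_mul _
  have h1 : Integrable Y P := hL3.integrable (by norm_num)
  have h2 : Integrable (fun ω => Y ω ^ 2) P := (hL3.mono_exponent (by norm_num)).integrable_sq
  have h3 : Integrable (fun ω => |Y ω| ^ 3) P := by
    simpa using hL3.integrable_norm_pow (p := 3) (by norm_num)
  rw [variance_of_integral_eq_zero hY hcentered] at hvar
  refine ⟨?_, ?_, ?_, ?_, ?_⟩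
  · rw [integrable_map_measure (by fun_prop) hσY]
    exact h1.const_mul _
  · rw [integrable_map_measure (by fun_prop) hσY]
    simpa only [Function.comp_def, mul_pow] using h2.const_mul _
  · rw [integrable_map_measure (by fun_prop) hσY]
    simpa only [Function.comp_def, abs_mul, mul_pow] using h3.const_mul _
  · rw [integral_map hσY (by fun_prop), integral_const_mul, hcentered, mul_zero]
  · rw [integral_map hσY (by fun_prop)]
    simp only [mul_pow]
    rw [integral_const_mul]
    rw [hvar, ← mul_pow, inv_mul_cancel₀ hσ.ne', one_pow]

theorem sum_Icc_int_eq (f : ℤ → ℝ) (n : ℕ) :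
    ∑ i ∈ Finset.Icc (1 : ℤ) (n : ℤ), f i = ∑ i : Fin n, f ((i : ℤ) + 1) := by
  rw [Fin.sum_univ_eq_sum_range (fun i => f ((i : ℤ) + 1))]
  symm
  refine Finset.sum_bij (fun i _ => (i : ℤ) + 1) ?_ ?_ ?_ ?_
  · intro i hi; simp at hi ⊢; lia
  · intro i _ j _ h; simpa using h
  · intro b hb
    simp at hb
    exact ⟨(b - 1).toNat, by simp; lia, by lia⟩
  · intro i _; rfl

/-- By independence the standardized variables have a product joint law, and σ times their total
gives back the original sum. The indices 1, …, n correspond to `Fin n` through the shift by one. -/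
theorem map_sum_eq {X : ℤ → Ω → ℝ} (hindep : iIndepFun X P)
    (hident : ∀ i, IdentDistrib (X i) (X 1) P P) {σ : ℝ} (hσ : 0 < σ) (n : ℕ) :
    P.map (fun ω => ∑ i ∈ Finset.Icc (1 : ℤ) (n : ℤ), X i ω)
      = ((iidLaw (P.map fun ω => σ⁻¹ * X 1 ω) n).map total).map (σ * ·) := by
  set Z : Fin n → Ω → ℝ := fun i ω => σ⁻¹ * X ((i : ℤ) + 1) ω with hZ
  have hZm : ∀ i, AEMeasurable (Z i) P := fun i => (hident _).aemeasurable_fst.const_mul _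
  have hinj : Function.Injective fun i : Fin n => (i : ℤ) + 1 := by
    intro i j h; ext; simpa using h
  have hZi : iIndepFun Z P :=
    (hindep.precomp hinj).comp (fun _ y => σ⁻¹ * y) fun _ => by fun_prop
  have hlaw : ∀ i, P.map (Z i) = P.map fun ω => σ⁻¹ * X 1 ω := fun i =>
    ((hident ((i : ℤ) + 1)).comp (u := fun y => σ⁻¹ * y) (by fun_prop)).map_eq
  have hpi := hZi.map_fun_eq_pi_map hZm
  simp only [hlaw] at hpi
  have ht : Measurable (total : (Fin n → ℝ) → ℝ) := by unfold total; fun_prop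
  rw [iidLaw, ← hpi, Measure.map_map (by fun_prop) ht,
    AEMeasurable.map_map_of_aemeasurable (by fun_prop) (aemeasurable_pi_lambda _ hZm)]
  congr 1
  ext ω
  simp only [Function.comp_apply, total]
  rw [sum_Icc_int_eq (fun i => X i ω), ← Finset.mul_sum, ← mul_assoc, mul_inv_cancel₀ hσ.ne',
    one_mul]

end Transfer

theorem theorem2p1 {Ω : Type*} [MeasurableSpace Ω] (P : Measure Ω) [IsProbabilityMeasure P]
    (X : ℤ → Ω → ℝ) (hindep : iIndepFun X P) (hident : ∀ i, IdentDistrib (X i) (X 1) P P)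
    (hL3 : MemLp (X 1) 3 P) (hcentered : ∫ ω, X 1 ω ∂P = 0)
    (σ : ℝ≥0) (hσ : 0 < σ) (hvar : Var[X 1; P] = (σ : ℝ) ^ 2)
    (n : ℕ) (hn : 1 ≤ n) (x : ℝ) (hx : 0 < x) :
    (transportCost (psiCost x) (P.map (fun ω => ∑ i ∈ Finset.Icc (1 : ℤ) (n : ℤ), X i ω))
        (gaussianReal 0 ((n : ℝ≥0) * σ ^ 2))) ^ (1 / 2 : ℝ) ≤
      ENNReal.ofReal
        (√(constC0 (σ : ℝ) (∫ ω, |X 1 ω| ^ 3 ∂P) (∫ ω, (X 1 ω) ^ 3 ∂P) +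
            0.64584 * ((σ : ℝ) ^ 2)⁻¹ * ∫ ω, |X 1 ω| ^ 3 * min |X 1 ω| (8 * x) ∂P) +
          0.968 * ((σ : ℝ) ^ 2)⁻¹ * |∫ ω, (X 1 ω) ^ 3 ∂P|) := by
  have hs : (0 : ℝ) < σ := hσ
  rw [gaussianReal_zero_mul_sq, map_sum_eq hindep hident hs n]
  generalize (σ : ℝ) = s at hvar hs ⊢
  have hσY : AEMeasurable (fun ω => s⁻¹ * X 1 ω) P :=
    (hident 1).aemeasurable_fst.const_mul _
  have hprob : IsProbabilityMeasure (P.map fun ω => s⁻¹ * X 1 ω) :=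
    Measure.isProbabilityMeasure_map hσY
  have hstd := transportCost_std_le (isStdLaw_map hL3 hcentered hs hvar) hn (div_pos hx hs)
  have e1 : ∫ a, |a| ^ 3 ∂(P.map fun ω => s⁻¹ * X 1 ω) = (s⁻¹) ^ 3 * ∫ ω, |X 1 ω| ^ 3 ∂P := by
    rw [integral_map hσY (by fun_prop), ← integral_const_mul]
    simp only [abs_mul, mul_pow, abs_of_pos (inv_pos.2 hs)]
  have e2 : ∫ a, a ^ 3 ∂(P.map fun ω => s⁻¹ * X 1 ω) = (s⁻¹) ^ 3 * ∫ ω, X 1 ω ^ 3 ∂P := by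
    rw [integral_map hσY (by fun_prop), ← integral_const_mul]
    simp only [mul_pow]
  -- Scaling changes the cost parameter from x to x/σ, so the truncation level scales like |X| and
  -- the whole expectation is homogeneous of degree 4.
  have e3 : ∫ a, |a| ^ 3 * min |a| (8 * (x / s)) ∂(P.map fun ω => s⁻¹ * X 1 ω)
      = (s⁻¹) ^ 4 * ∫ ω, |X 1 ω| ^ 3 * min |X 1 ω| (8 * x) ∂P := by
    rw [integral_map hσY (by fun_prop), ← integral_const_mul]
    congr 1; ext ω
    have : 8 * (x / s) = s⁻¹ * (8 * x) := by ring
    rw [abs_mul, abs_of_pos (inv_pos.2 hs), this,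
      ← mul_min_of_nonneg _ _ (inv_pos.2 hs).le]
    ring
  rw [e1, e2, e3, abs_mul, abs_of_pos (pow_pos (inv_pos.2 hs) 3)] at hstd
  refine ENNReal.rpow_half_le_of_le_sq ?_
  refine (transportCost_map_mul_le hs x _ _).trans ((mul_le_mul_right hstd _).trans_eq ?_)
  rw [ENNReal.ofReal_pow hs.le, ← mul_pow, ← ENNReal.ofReal_mul hs.le]
  congr 2
  rw [mul_add]
  congr 1
  -- The outer factor σ enters the square root as σ², turning σ⁻⁶ and σ⁻⁴ into the stated σ⁻⁴ and
  -- σ⁻².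
  · rw [← Real.sqrt_sq hs.le, ← Real.sqrt_mul (sq_nonneg _), Real.sqrt_sq hs.le]
    congr 1
    unfold constC0
    field_simp
    ring
  · field_simp
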